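/- Let $K$ be a field. For a homogeneous ideal $I$ of a polynomial ring $S$ over $K$ in finitely many variables (standard grading), the monomial poset of $S/I$ is the set of cosets $\bar\mu$ of the monomials $\mu\notin I$, ordered by divisibility: $\bar\mu\le\bar\nu$ if and only if $\bar\nu=\bar\mu\,\bar\theta$ for some monomial $\bar\theta$ of $S/I$. A poset is ranked if it has a function $r$ to $\mathbb{N}$ with $r=0$ at a minimum element and $r(b)=r(a)+1$ whenever $b$ covers $a$; its $d$-th level is $\{x : r(x)=d\}$. The upper shadow $\nabla A$ of a set $A$ is the set of all elements covering some element of $A$. A ranked poset is Macaulay if it has a total order such that, with $\operatorname{Seg}_d q$ denoting the set of the $q$ largest elements of the $d$-th level in that order, every $d$ and every subset $A$ of the $d$-th level satisfy $|\nabla\operatorname{Seg}_d|A||\le|\nabla A|$ and $\nabla\operatorname{Seg}_d|A|=\operatorname{Seg}_{d+1}|\nabla\operatorname{Seg}_d|A||$. The ring $S/I$ is a Macaulay ring if its monomial poset is Macaulay. (1) For integers $a_i,b_j\ge 2$ such that $\sum_{i=1}^n a_i-n=\sum_{j=1}^m b_j-m$, the ring \[ \frac{K[x_1,\ldots,x_n,y_1,\ldots,y_m]}{(x_1^{a_1},\ldots,x_n^{a_n},y_1^{b_1},\ldots,y_m^{b_m})+(x_iy_j:1\le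 i\le n,\,1\le j\le m)+(x_1^{a_1-1}\cdots x_n^{a_n-1}-y_1^{b_1-1}\cdots y_m^{b_m-1})} \] is Macaulay if and only if one of the following holds: (a) $n=1$, $m=2$ and $\min\{b_1,b_2\}=2$; (b) $n=2$, $m=1$ and $\min\{a_1,a_2\}=2$; (c) $n=m$ and $(b_1,\ldots,b_m)$ is a permutation of $(a_1,\ldots,a_n)$. (2) For integers $a_i,b_j\ge 2$ such that $a_1\le a_2$ and $b_1\le b_2$, the ring \[ \frac{K[x_1,x_2,y_1,y_2]}{(x_1^{a_1},x_2^{a_2},y_1^{b_1},y_2^{b_2},x_1y_1,x_1y_2,x_2y_1,x_2y_2)} \] is Macaulay if and only if either $a_1\le b_1$ and $a_2\le b_2$, or $b_1\le a_1$ and $b_2\le a_2$. (3) For integers $a_0,a_1,b_0,b_1\ge 1$, the ring \[ \frac{K[x,y]}{(x^{a_0},y^{a_1})\cap(x^{b_0},y^{b_1})} \] is Macaulay if and only if one of the following holds: (i) $a_0\le b_0$ and $a_1\le b_1$; (ii) $b_0\le a_0$ and $b_1\le a_1$; (iii) $b_0<a_0$ and $a_1<b_1$, and moreover $a_0=b_1$,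 or ($b_1<a_0$ and $b_1+b_0\le a_0+a_1$), or ($a_0<b_1$ and $a_0+a_1\le b_0+b_1$); (iv) condition (iii) with the roles of $a_i$ and $b_i$ exchanged. -/

import Mathlib

open MvPolynomial

/-! ### Macaulay posets -/

/-- The upper shadow of `A`: all elements that cover some element of `A`. -/
def upperShadow {P : Type*} [PartialOrder P] (A : Set P) : Set P :=
  {b | ∃ a ∈ A, a ⋖ b}

/-- `r` is a rank function: there is a minimum element, of rank `0`, and the rank
goes up by one along every covering relation. -/
structure IsRankFunction {P : Type*} [PartialOrder P] (r : P → ℕ) : Prop where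
  exists_bot : ∃ x : P, IsBot x ∧ r x = 0
  covBy : ∀ a b : P, a ⋖ b → r b = r a + 1

/-- The `d`-th level of a ranked poset. -/
def level {P : Type*} (r : P → ℕ) (d : ℕ) : Set P := {x | r x = d}

/-- The initial segment of size `q` in level `d`: the `q` largest elements of that level with
respect to the total order `O`, i.e. the elements of the level that have fewer than `q`
elements of the level above them in `O`. -/
def initialSegment {P : Type*} (r : P → ℕ) (O : LinearOrder P) (d : ℕ) (q : ℕ∞) : Set P :=
  {x | x ∈ level r d ∧ {y | y ∈ level r d ∧ O.lt x y}.encard < q}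

/-- A ranked poset is Macaulay if there is a total order on it such that initial segments have
the smallest upper shadows among the sets of the same size in the same level, and upper shadows
of initial segments are initial segments. -/
def IsMacaulayPoset (P : Type*) [PartialOrder P] : Prop :=
  ∃ r : P → ℕ, IsRankFunction r ∧ ∃ O : LinearOrder P,
    ∀ (d : ℕ) (A : Set P), A ⊆ level r d →
      (upperShadow (initialSegment r O d A.encard)).encard ≤ (upperShadow A).encard ∧
      upperShadow (initialSegment r O d A.encard) =
        initialSegment r O (d + 1) (upperShadow (initialSegment r O d A.encard)).encard

/-! ### The monomial poset of a quotient of a polynomial ring -/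

section MonomialPoset

attribute [local instance] MvPolynomial.gradedAlgebra

variable {σ K : Type*} [Field K]

/-- The monomials of `K[σ] / I`: the cosets of the monomials that do not lie in `I`. -/
def MonomialPoset (I : Ideal (MvPolynomial σ K)) : Type _ :=
  {z : MvPolynomial σ K ⧸ I //
    ∃ m : σ →₀ ℕ, monomial m (1 : K) ∉ I ∧ z = Ideal.Quotient.mk I (monomial m 1)}

theorem degree_eq_of_sub_mem {I : Ideal (MvPolynomial σ K)}
    (hI : I.IsHomogeneous (homogeneousSubmodule σ K)) {m n : σ →₀ ℕ}
    (hm : monomial m (1 : K) ∉ I) (h : monomial m (1 : K) - monomial n 1 ∈ I) :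
    m.degree = n.degree := by
  by_contra hne
  apply hm
  have h1 := homogeneousComponent_mem_of_mem hI h m.degree
  have e : homogeneousComponent m.degree (monomial m (1 : K) - monomial n 1) = monomial m 1 := by
    classical
    ext d
    simp only [coeff_homogeneousComponent, coeff_sub, coeff_monomial]
    by_cases h1 : m = d
    · subst h1
      have : n ≠ m := fun h => hne (by rw [h])
      simp [this]
    · by_cases h2 : n = d
      · subst h2
        simp only [h1, if_false, if_true, Ne.symm hne]
      · simp [h1, h2]
  rw [e] at h1
  exact h1

/-- The poset of monomials of `K[σ] / I` for a homogeneous ideal `I`, ordered by divisibility: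
`z ≤ w` means that `w = z * t` for a monomial `t` of `K[σ] / I`. -/
abbrev monomialPartialOrder (I : Ideal (MvPolynomial σ K))
    (hI : I.IsHomogeneous (homogeneousSubmodule σ K)) : PartialOrder (MonomialPoset I) where
  le z w := ∃ t : MonomialPoset I, w.1 = z.1 * t.1
  le_refl := by
    rintro ⟨z, m, hm, rfl⟩
    refine ⟨⟨1, 0, fun h => hm ?_, by simp⟩, by simp⟩
    have : (monomial 0 (1 : K) : MvPolynomial σ K) = 1 := rfl
    rw [this] at h
    rw [(Ideal.eq_top_iff_one I).2 h]
    trivial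
  le_trans := by
    rintro ⟨z, m, hm, rfl⟩ ⟨w, n, hn, rfl⟩ ⟨u, p, hp, rfl⟩ ⟨⟨_, s, hs, rfl⟩, h1⟩
      ⟨⟨_, t, ht, rfl⟩, h2⟩
    have e : Ideal.Quotient.mk I (monomial p (1 : K)) =
        Ideal.Quotient.mk I (monomial m 1) * Ideal.Quotient.mk I (monomial (s + t) 1) := by
      have : monomial (s + t) (1 : K) = monomial s 1 * monomial t 1 := by simp
      simp only at h1 h2
      rw [h2, h1, this, map_mul, mul_assoc]
    refine ⟨⟨_, s + t, fun h => hp ?_, rfl⟩, e⟩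
    rw [← Ideal.Quotient.eq_zero_iff_mem, e, Ideal.Quotient.eq_zero_iff_mem.2 h, mul_zero]
  le_antisymm := by
    rintro ⟨z, m, hm, rfl⟩ ⟨w, n, hn, rfl⟩ ⟨⟨_, s, hs, rfl⟩, h1⟩ ⟨⟨_, t, ht, rfl⟩, h2⟩
    simp only [← map_mul, monomial_mul, mul_one] at h1 h2
    have d1 := degree_eq_of_sub_mem hI hn ((Ideal.Quotient.eq).1 h1)
    have d2 := degree_eq_of_sub_mem hI hm ((Ideal.Quotient.eq).1 h2)
    rw [map_add] at d1 d2
    have hs0 : s = 0 := by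
      rw [← Finsupp.degree_eq_zero_iff]
      omega
    subst hs0
    apply Subtype.ext
    simp [h1]

/-- The quotient `K[σ] / I` by a homogeneous ideal `I` is a Macaulay ring if its poset of
monomials is a Macaulay poset. -/
def IsMacaulayQuotient (I : Ideal (MvPolynomial σ K)) : Prop :=
  ∃ hI : I.IsHomogeneous (homogeneousSubmodule σ K),
    @IsMacaulayPoset (MonomialPoset I) (monomialPartialOrder I hI)

end MonomialPoset

/-! ### The ideals of the three families of rings -/

section Ideals

variable (K : Type*) [Field K]

/-- In `K[x_1, …, x_n, y_1, …, y_m]` (`x_i = X (Sum.inl i)`, `y_j = X (Sum.inr j)`), the ideal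
generated by all `x_i ^ a_i`, all `y_j ^ b_j` and all `x_i * y_j`. -/
noncomputable def wedgeIdeal {n m : ℕ} (a : Fin n → ℕ) (b : Fin m → ℕ) :
    Ideal (MvPolynomial (Fin n ⊕ Fin m) K) :=
  Ideal.span (Set.range fun i => X (Sum.inl i) ^ a i) ⊔
  Ideal.span (Set.range fun j => X (Sum.inr j) ^ b j) ⊔
  Ideal.span (Set.range fun p : Fin n × Fin m => X (Sum.inl p.1) * X (Sum.inr p.2))

/-- The ideal `wedgeIdeal K a b` together with the difference
`∏ x_i ^ (a_i - 1) - ∏ y_j ^ (b_j - 1)`. -/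
noncomputable def diamondIdeal {n m : ℕ} (a : Fin n → ℕ) (b : Fin m → ℕ) :
    Ideal (MvPolynomial (Fin n ⊕ Fin m) K) :=
  wedgeIdeal K a b ⊔
  Ideal.span {(∏ i, X (Sum.inl i) ^ (a i - 1)) - ∏ j, X (Sum.inr j) ^ (b j - 1)}

/-- The ideal `(x ^ a_0, y ^ a_1) ∩ (x ^ b_0, y ^ b_1)` of `K[x, y]`. -/
noncomputable def heartIdeal (a₀ a₁ b₀ b₁ : ℕ) : Ideal (MvPolynomial (Fin 2) K) :=
  Ideal.span {X 0 ^ a₀, X 1 ^ a₁} ⊓ Ideal.span {X 0 ^ b₀, X 1 ^ b₁}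

end Ideals

/-- The third condition of the classification for `heartIdeal`; the fourth one is the same with
the roles of `a` and `b` exchanged. -/
def HeartCondition (a₀ a₁ b₀ b₁ : ℕ) : Prop :=
  b₀ < a₀ ∧ a₁ < b₁ ∧
    (a₀ = b₁ ∨ (b₁ < a₀ ∧ b₁ + b₀ ≤ a₀ + a₁) ∨ (a₀ < b₁ ∧ a₀ + a₁ ≤ b₀ + b₁))

/-! ### Rank functions, initial segments and a criterion for being Macaulay. -/

section Framework

variable {P : Type*} [PartialOrder P]

/-! All three families have combinatorial monomial posets made of boxes of exponent vectors: two
boxes sharing their bottom (wedge), two boxes sharing bottom and top (diamond), or a union of two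
boxes inside the same plane (heart). The rank is the degree and is forced, so only the total order
is in question. To prove the Macaulay property, one exhibits a key on each level whose up-sets have
minimal shadows that are again up-sets (`isMacaulayPoset_of_key`). To refute it, one uses only that
initial segments are nested, that their shadows are minimal, and that these shadows are again
initial segments. In particular the first element of a level covers the first element of the level
below whenever the latter is covered by anything (`IsSegFamily.subset_upperShadow`). An order that
has once chosen a box or corner is therefore bound to it, and the contradiction appears at a level
where the other choice would have been cheaper.

Diamond, sufficiency. If the side lengths agree up to a permutation, write the two boxes as the
vectors `(1, 0, x)` and `(0, 1, y)` and adjoin all vectors `(1, 1, w)`. Sets in the gluing become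
sets in one large box, the adjoined block is lexicographically first, and taking shadows commutes
with adjoining it. The Clements–Lindström theorem (`lexSegMinimal`) then applies. It is proved by
compressing along every coordinate and exchanging the last element present for the first one
missing. A chain glued to a box of width one is treated by the strip method below.

Diamond, necessity. Let the first atom lie in the first box. Comparing the second box with the
initial segment of the same size, once two levels below the top and once among the atoms, gives two
inequalities between binomial coefficients (`top_estimate`, `bottom_estimate`). By `gluing_numerics`
they leave the small cases and the case `n = m` with an initial segment of coatoms inside the first
box. In the latter case the comparison descends through all levels, so the two boxes have equal
level sizes. The generating function of these sizes, multiplied by `(X - 1) ^ n`, is `∏ (X ^ (c i +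
1) - 1)`, and its roots of unity recover the side lengths.

Wedge and heart. In two variables a level is a set of integers and the shadow is `t ↦ t, t + 1` cut
off to the next level. Along an interval the shadow of a proper nonempty subset gains at least a
constant `g`, while the whole interval gains `h` (`HasGain`). For two components that do not
interact, a short case analysis decides when filling one first is optimal (`isStripOptimal_union`).
The phases grow, flat and shrink of the two boxes then give both the orders and the obstructions. -/

theorem IsRankFunction.unique [Finite P] {r s : P → ℕ} (hr : IsRankFunction r)
    (hs : IsRankFunction s) : r = s := by
  obtain ⟨x₀, hx₀, hr0⟩ := hr.exists_bot
  obtain ⟨x₁, hx₁, hs0⟩ := hs.exists_bot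
  obtain rfl : x₀ = x₁ := le_antisymm (hx₀ _) (hx₁ _)
  funext x
  induction h : r x using Nat.strong_induction_on generalizing x with
  | _ n ih =>
    subst h
    by_cases hx : x = x₀
    · rw [hx, hr0, hs0]
    · obtain ⟨a, -, ha⟩ := exists_le_covBy_of_lt (lt_of_le_of_ne (hx₀ x) (Ne.symm hx))
      have h1 := hr.covBy _ _ ha
      have h2 := hs.covBy _ _ ha
      have h3 := ih (r a) (by omega) a rfl
      omega

theorem upperShadow_subset_level {r : P → ℕ} (hr : IsRankFunction r) {d : ℕ} {A : Set P}
    (hA : A ⊆ level r d) : upperShadow A ⊆ level r (d + 1) := by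
  rintro b ⟨a, ha, hab⟩
  have h : r a = d := hA ha
  exact (hr.covBy a b hab).trans (by rw [h])

theorem upperShadow_mono {A B : Set P} (h : A ⊆ B) : upperShadow A ⊆ upperShadow B :=
  fun _ ⟨a, ha, hab⟩ => ⟨a, h ha, hab⟩

@[simp] theorem upperShadow_empty : upperShadow (∅ : Set P) = ∅ := by
  ext; simp [upperShadow]

/-- Counting the elements above `x` is injective on `L` and takes exactly the values below `L.card`,
so any threshold `q` cuts off `q` elements. -/
theorem card_filter_card_lt {α β : Type*} [LinearOrder β] (L : Finset α) (f : α → β)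
    (hf : Set.InjOn f L) {q : ℕ} (hq : q ≤ L.card) :
    (L.filter fun x => (L.filter fun y => f x < f y).card < q).card = q := by
  set ρ : α → ℕ := fun x => (L.filter fun y => f x < f y).card with hρ
  have hlt : ∀ x ∈ L, ∀ y ∈ L, f x < f y → ρ y < ρ x := by
    intro x _ y hy hxy
    refine Finset.card_lt_card ⟨fun z hz => ?_, fun h => ?_⟩
    · simp only [Finset.mem_filter] at hz ⊢
      exact ⟨hz.1, hxy.trans hz.2⟩
    · have := h (Finset.mem_filter.2 ⟨hy, hxy⟩)
      simp at this
  have hinj : Set.InjOn ρ L := by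
    intro x hx y hy h
    rcases lt_trichotomy (f x) (f y) with h1 | h1 | h1
    · have := hlt x hx y hy h1
      omega
    · exact hf hx hy h1
    · have := hlt y hy x hx h1
      omega
  have himg : L.image ρ = Finset.range L.card := by
    refine Finset.eq_of_subset_of_card_le ?_ ?_
    · intro k hk
      obtain ⟨x, hx, rfl⟩ := Finset.mem_image.1 hk
      refine Finset.mem_range.2 (Finset.card_lt_card ⟨Finset.filter_subset _ _, fun h => ?_⟩)
      have := h hx
      simp at this
    · rw [Finset.card_image_of_injOn hinj, Finset.card_range]
  have h2 : (L.filter fun x => ρ x < q).image ρ = Finset.range q := by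
    ext k
    simp only [Finset.mem_image, Finset.mem_filter, Finset.mem_range]
    constructor
    · rintro ⟨x, ⟨_, h⟩, rfl⟩
      exact h
    · intro hk
      have : k ∈ L.image ρ := by
        rw [himg]
        exact Finset.mem_range.2 (by omega)
      obtain ⟨x, hx, rfl⟩ := Finset.mem_image.1 this
      exact ⟨x, ⟨hx, hk⟩, rfl⟩
  rw [← Finset.card_image_of_injOn (hinj.mono (Finset.coe_subset.2 (Finset.filter_subset _ _))),
    h2, Finset.card_range]

omit [PartialOrder P] in
theorem ncard_initialSegment [Finite P] (r : P → ℕ) (O : LinearOrder P) (d q : ℕ)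
    (hq : q ≤ (level r d).ncard) : (initialSegment r O d q).ncard = q := by
  classical
  have := Fintype.ofFinite P
  rw [Set.ncard_eq_toFinset_card'] at hq
  have h := @card_filter_card_lt P P O (level r d).toFinset id (Set.injOn_id _) q hq
  rw [Set.ncard_eq_toFinset_card']
  refine Eq.trans (congrArg Finset.card ?_) h
  ext x
  rw [Set.mem_toFinset, Finset.mem_filter, Set.mem_toFinset]
  refine and_congr_right fun _ => ?_
  rw [← Set.Finite.cast_ncard_eq (Set.toFinite _), Nat.cast_lt, Set.ncard_eq_toFinset_card']
  refine Iff.of_eq (congrArg (· < q) (congrArg Finset.card ?_))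
  ext y
  simp

/-- The refutations need nothing of the order except its family of initial segments, and for any
rank function at hand, since there is only one. -/
theorem IsMacaulayPoset.exists_seg [Finite P] (h : IsMacaulayPoset P) {r : P → ℕ}
    (hr : IsRankFunction r) :
    ∃ seg : ℕ → ℕ → Set P,
      (∀ d q, seg d q ⊆ level r d) ∧ (∀ d, Monotone (seg d)) ∧
      (∀ d q, q ≤ (level r d).ncard → (seg d q).ncard = q) ∧
      ∀ d A, A ⊆ level r d →
        (upperShadow (seg d A.ncard)).ncard ≤ (upperShadow A).ncard ∧
        upperShadow (seg d A.ncard) = seg (d + 1) (upperShadow (seg d A.ncard)).ncard := by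
  obtain ⟨s, hs, O, hO⟩ := h
  obtain rfl := hs.unique hr
  refine ⟨fun d q => initialSegment s O d q, fun d q x hx => hx.1, ?_, ?_, ?_⟩
  · intro d q q' hqq x hx
    exact ⟨hx.1, lt_of_lt_of_le hx.2 (by exact_mod_cast hqq)⟩
  · intro d q hq
    exact ncard_initialSegment s O d q hq
  · intro d A hA
    have := hO d A hA
    rw [← Set.Finite.cast_ncard_eq (Set.toFinite A),
      ← Set.Finite.cast_ncard_eq (Set.toFinite (upperShadow A)),
      ← Set.Finite.cast_ncard_eq (Set.toFinite (upperShadow (initialSegment s O d _))),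
      Nat.cast_le] at this
    exact this

/-- Up-closed subsets of a level, for the order given by `key`. -/
def IsUpSegment {K : Type*} [LT K] (r : P → ℕ) (key : P → K) (d : ℕ) (S : Set P) : Prop :=
  S ⊆ level r d ∧ ∀ x ∈ S, ∀ y ∈ level r d, key x < key y → y ∈ S

-- Up-closed sets in a linearly ordered level are nested, so the size determines them.
omit [PartialOrder P] in
theorem IsUpSegment.eq_of_ncard [Finite P] {K : Type*} [LinearOrder K] {r : P → ℕ} {key : P → K}
    (hinj : ∀ x y, r x = r y → key x = key y → x = y) {d : ℕ} {S T : Set P}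
    (hS : IsUpSegment r key d S) (hT : IsUpSegment r key d T) (h : S.ncard = T.ncard) : S = T := by
  by_cases hST : S ⊆ T
  · exact Set.eq_of_subset_of_ncard_le hST h.ge
  · obtain ⟨x, hx, hxT⟩ := Set.not_subset.1 hST
    refine (Set.eq_of_subset_of_ncard_le (fun y hy => ?_) h.le).symm
    rcases lt_trichotomy (key x) (key y) with h1 | h1 | h1
    · exact hS.2 x hx y (hT.1 hy) h1
    · have hxl : r x = d := hS.1 hx
      have hyl : r y = d := hT.1 hy
      rwa [← hinj x y (hxl.trans hyl.symm) h1]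
    · exact absurd (hT.2 y hy x (hS.1 hx) h1) hxT

/-- Sufficient condition for being Macaulay: order every level by decreasing `key`. -/
theorem isMacaulayPoset_of_key [Finite P] {K : Type*} [LinearOrder K] {r : P → ℕ}
    (hr : IsRankFunction r) (key : P → K) (hinj : ∀ x y, r x = r y → key x = key y → x = y)
    (h : ∀ d, (∀ A ⊆ level r d, A.Nonempty → upperShadow A = level r (d + 1)) ∨
      ∀ A S : Set P, A ⊆ level r d → IsUpSegment r key d S → S.ncard = A.ncard →
        (upperShadow S).ncard ≤ (upperShadow A).ncard ∧
        IsUpSegment r key (d + 1) (upperShadow S)) : IsMacaulayPoset P := by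
  have hinj' : Function.Injective (fun x => toLex (r x, key x)) := by
    intro x y hxy
    have := toLex.injective hxy
    rw [Prod.mk.injEq] at this
    exact hinj x y this.1 this.2
  -- Only comparisons inside a level matter; putting the rank in front merely makes the order total
  -- on `P`.
  let O : LinearOrder P := LinearOrder.lift' (fun x => toLex (r x, key x)) hinj'
  have hlt : ∀ x y, r x = r y → (O.lt x y ↔ key x < key y) := by
    intro x y hxy
    have : O.lt x y ↔ toLex (r x, key x) < toLex (r y, key y) := Iff.rfl
    rw [this, Prod.Lex.toLex_lt_toLex]
    simp [hxy]
  have hseg : ∀ d (q : ℕ), IsUpSegment r key d (initialSegment r O d q) := by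
    refine fun d q => ⟨fun x hx => hx.1, fun x hx y hy hxy => ⟨hy, lt_of_le_of_lt ?_ hx.2⟩⟩
    refine Set.encard_le_encard fun z hz => ⟨hz.1, ?_⟩
    have hxl : r x = d := hx.1
    have hyl : r y = d := hy
    have hzl : r z = d := hz.1
    exact (hlt x z (hxl.trans hzl.symm)).2
      (hxy.trans ((hlt y z (hyl.trans hzl.symm)).1 hz.2))
  have key1 : ∀ d (A : Set P), A ⊆ level r d →
      (upperShadow (initialSegment r O d A.ncard)).ncard ≤ (upperShadow A).ncard ∧
        IsUpSegment r key (d + 1) (upperShadow (initialSegment r O d A.ncard)) := by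
    intro d A hA
    have hc := ncard_initialSegment r O d A.ncard (Set.ncard_le_ncard hA)
    -- If every nonempty set has full shadow, minimality is automatic; only the empty segment needs
    -- separate treatment.
    rcases h d with h1 | h1
    · rcases Set.eq_empty_or_nonempty A with rfl | hne
      · have : initialSegment r O d ((∅ : Set P).ncard : ℕ) = ∅ := by
          rw [Set.ncard_empty] at hc ⊢
          exact (Set.ncard_eq_zero (Set.toFinite _)).1 hc
        rw [this]
        simp [IsUpSegment]
      · have hne' : (initialSegment r O d A.ncard).Nonempty := by
          rw [← Set.ncard_pos, hc, Set.ncard_pos]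
          exact hne
        rw [h1 A hA hne, h1 _ (hseg d _).1 hne']
        exact ⟨le_rfl, subset_rfl, fun _ _ y hy _ => hy⟩
    · exact h1 A _ hA (hseg d _) hc
  refine ⟨r, hr, O, fun d A hA => ?_⟩
  rw [← Set.Finite.cast_ncard_eq (Set.toFinite A),
      ← Set.Finite.cast_ncard_eq (Set.toFinite (upperShadow A)),
      ← Set.Finite.cast_ncard_eq (Set.toFinite (upperShadow (initialSegment r O d _))),
      Nat.cast_le]
  obtain ⟨h1, h2⟩ := key1 d A hA
  exact ⟨h1, h2.eq_of_ncard hinj (hseg _ _)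
    (ncard_initialSegment r O _ _ (Set.ncard_le_ncard h2.1)).symm⟩

end Framework


/-! ### Levels, shadows and lexicographic segments in a box. -/

section BoxShadow

variable {ι : Type*} [Fintype ι] [LinearOrder ι]

/-- The vectors of coordinate sum `d` in the box `[l, c]`. -/
def boxLevel (l c : ι → ℕ) (d : ℕ) : Finset (ι → ℕ) :=
  (Finset.Icc l c).filter fun x => ∑ i, x i = d

/-- The upper shadow of `A` in the box of vectors below `c`. -/
def boxShadow (c : ι → ℕ) (A : Finset (ι → ℕ)) : Finset (ι → ℕ) :=
  (A.biUnion fun x => Finset.univ.image fun i => x + Pi.single i 1).filter fun y => ∀ i, y i ≤ c i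

/-- `S` is a lexicographic segment of `L`, consisting of its largest elements. -/
def IsLexSeg (L S : Finset (ι → ℕ)) : Prop :=
  S ⊆ L ∧ ∀ x ∈ S, ∀ y ∈ L, toLex x < toLex y → y ∈ S

theorem mem_boxLevel {l c : ι → ℕ} {d : ℕ} {x : ι → ℕ} :
    x ∈ boxLevel l c d ↔ (∀ i, l i ≤ x i ∧ x i ≤ c i) ∧ ∑ i, x i = d := by
  simp only [boxLevel, Finset.mem_filter, Finset.mem_Icc, Pi.le_def]
  exact and_congr_left fun _ => forall_and.symm

theorem mem_boxShadow {c : ι → ℕ} {A : Finset (ι → ℕ)} {y : ι → ℕ} :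
    y ∈ boxShadow c A ↔ (∀ i, y i ≤ c i) ∧ ∃ x ∈ A, ∃ i, x + Pi.single i 1 = y := by
  simp only [boxShadow, Finset.mem_filter, Finset.mem_biUnion, Finset.mem_image, Finset.mem_univ,
    true_and]
  tauto

theorem sum_add_single (x : ι → ℕ) (i : ι) :
    ∑ j, (x + Pi.single i 1 : ι → ℕ) j = ∑ j, x j + 1 := by
  simp [Finset.sum_add_distrib]

omit [Fintype ι] in
theorem add_single_self (x : ι → ℕ) (i : ι) : (x + Pi.single i 1 : ι → ℕ) i = x i + 1 := by
  simp

omit [Fintype ι] in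
theorem add_single_of_ne (x : ι → ℕ) {i j : ι} (h : j ≠ i) :
    (x + Pi.single i 1 : ι → ℕ) j = x j := by
  simp [h]

theorem boxShadow_subset {l c : ι → ℕ} {d : ℕ} {A : Finset (ι → ℕ)} (hA : A ⊆ boxLevel l c d) :
    boxShadow c A ⊆ boxLevel l c (d + 1) := by
  intro y hy
  obtain ⟨hyc, x, hx, i, rfl⟩ := mem_boxShadow.1 hy
  have h := mem_boxLevel.1 (hA hx)
  refine mem_boxLevel.2 ⟨fun j => ⟨(h.1 j).1.trans ?_, hyc j⟩, ?_⟩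
  · simp
  · rw [sum_add_single, h.2]

omit [Fintype ι] in
theorem toLex_lt_iff {x y : ι → ℕ} :
    toLex x < toLex y ↔ ∃ i, (∀ j < i, x j = y j) ∧ x i < y i := Iff.rfl

theorem toLex_lt_of_le_of_lt {x y : ι → ℕ} (k : ι) (h : ∀ j < k, x j ≤ y j) (hk : x k < y k) :
    toLex x < toLex y := by
  by_contra hc
  rcases (not_lt.1 hc).lt_or_eq with h1 | h1
  · obtain ⟨i, hi, hi'⟩ := toLex_lt_iff.1 h1
    rcases lt_trichotomy i k with h2 | rfl | h2
    · exact absurd (h i h2) (not_le.2 hi')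
    · exact absurd hi' (not_lt.2 hk.le)
    · exact hk.ne (hi k h2).symm
  · rw [toLex.injective h1] at hk
    exact lt_irrefl _ hk

omit [Fintype ι] in
theorem toLex_add_single_lt {x y : ι → ℕ} {i : ι} :
    toLex (x + Pi.single i 1) < toLex (y + Pi.single i 1) ↔ toLex x < toLex y := by
  simp only [toLex_lt_iff, Pi.add_apply, add_left_inj, add_lt_add_iff_right]

theorem IsLexSeg.subset_or {L S T : Finset (ι → ℕ)} (hS : IsLexSeg L S) (hT : IsLexSeg L T) :
    S ⊆ T ∨ T ⊆ S := by
  by_contra hc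
  rw [not_or, Finset.not_subset, Finset.not_subset] at hc
  obtain ⟨⟨x, hx, hxT⟩, y, hy, hyS⟩ := hc
  rcases lt_trichotomy (toLex x) (toLex y) with h | h | h
  · exact hyS (hS.2 x hx y (hT.1 hy) h)
  · rw [toLex.injective h] at hx
    exact hyS hx
  · exact hxT (hT.2 y hy x (hS.1 hx) h)

theorem IsLexSeg.eq_of_card {L S T : Finset (ι → ℕ)} (hS : IsLexSeg L S) (hT : IsLexSeg L T)
    (h : S.card = T.card) : S = T := by
  rcases hS.subset_or hT with h1 | h1
  · exact Finset.eq_of_subset_of_card_le h1 h.ge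
  · exact (Finset.eq_of_subset_of_card_le h1 h.le).symm

theorem exists_isLexSeg (L : Finset (ι → ℕ)) {q : ℕ} (hq : q ≤ L.card) :
    ∃ S, IsLexSeg L S ∧ S.card = q := by
  refine ⟨_, ⟨Finset.filter_subset _ _, ?_⟩,
    card_filter_card_lt L (fun x => toLex x) (toLex.injective.injOn) hq⟩
  intro x hx y hy hxy
  rw [Finset.mem_filter] at hx ⊢
  refine ⟨hy, lt_of_le_of_lt (Finset.card_le_card fun z hz => ?_) hx.2⟩
  rw [Finset.mem_filter] at hz ⊢
  exact ⟨hz.1, hxy.trans hz.2⟩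

/-- Move `δ` units from coordinate `j` to coordinate `k`. -/
def transfer (x : ι → ℕ) (j k : ι) (δ : ℕ) : ι → ℕ :=
  fun i => if i = k then x k + δ else if i = j then x j - δ else x i

omit [Fintype ι] in
@[simp] theorem transfer_right (x : ι → ℕ) (j k : ι) (δ : ℕ) : transfer x j k δ k = x k + δ := by
  simp [transfer]

omit [Fintype ι] in
theorem transfer_left (x : ι → ℕ) {j k : ι} (h : j ≠ k) (δ : ℕ) : transfer x j k δ j = x j - δ := by
  simp [transfer, h]

omit [Fintype ι] in
theorem transfer_of_ne (x : ι → ℕ) {i j k : ι} (hj : i ≠ j) (hk : i ≠ k) (δ : ℕ) :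
    transfer x j k δ i = x i := by
  simp [transfer, hj, hk]

theorem sum_transfer (x : ι → ℕ) {j k : ι} (h : j ≠ k) {δ : ℕ} (hδ : δ ≤ x j) :
    ∑ i, transfer x j k δ i = ∑ i, x i := by
  have e : ∀ y : ι → ℕ, ∑ i, y i = y j + (y k + ∑ i ∈ (Finset.univ.erase j).erase k, y i) := by
    intro y
    rw [Finset.add_sum_erase _ _ (by simp [Ne.symm h]), Finset.add_sum_erase _ _ (by simp)]
  have e' : ∑ i ∈ (Finset.univ.erase j).erase k, transfer x j k δ i =
      ∑ i ∈ (Finset.univ.erase j).erase k, x i := by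
    refine Finset.sum_congr rfl fun i hi => ?_
    simp only [Finset.mem_erase] at hi
    exact transfer_of_ne x hi.2.1 hi.1 δ
  rw [e, e x, transfer_left x h, transfer_right, e']
  omega

theorem transfer_mem_boxLevel {l c : ι → ℕ} {d : ℕ} {x : ι → ℕ} (hx : x ∈ boxLevel l c d)
    {j k : ι} (h : j ≠ k) {δ : ℕ} (hj : l j + δ ≤ x j) (hk : x k + δ ≤ c k) :
    transfer x j k δ ∈ boxLevel l c d := by
  rw [mem_boxLevel] at hx ⊢
  refine ⟨fun i => ?_, by rw [sum_transfer x h (by omega), hx.2]⟩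
  have := hx.1 i
  by_cases hik : i = k
  · subst hik
    rw [transfer_right]
    omega
  · by_cases hij : i = j
    · subst hij
      rw [transfer_left x h]
      omega
    · rw [transfer_of_ne x hij hik]
      exact this

omit [Fintype ι] in
theorem transfer_add_single (x : ι → ℕ) {j k : ι} (h : j ≠ k) (hj : 1 ≤ x j) :
    transfer x j k 1 + Pi.single j 1 = x + Pi.single k 1 := by
  funext i
  by_cases hik : i = k
  · subst hik
    rw [add_single_self, add_single_of_ne _ (Ne.symm h), transfer_right]
  · by_cases hij : i = j
    · subst hij
      rw [add_single_self, add_single_of_ne _ h, transfer_left x h]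
      omega
    · rw [add_single_of_ne _ hij, add_single_of_ne _ hik, transfer_of_ne x hij hik]

omit [Fintype ι] in
theorem lt_transfer (x : ι → ℕ) {j k : ι} (h : k < j) {δ : ℕ} (hδ : 0 < δ) :
    toLex x < toLex (transfer x j k δ) := by
  refine toLex_lt_iff.2 ⟨k, fun i hi => ?_, ?_⟩
  · rw [transfer_of_ne x (hi.trans h).ne hi.ne]
  · rw [transfer_right]
    omega

omit [Fintype ι] in
theorem transfer_lt (x : ι → ℕ) {j k : ι} (h : j < k) {δ : ℕ} (hδ : 0 < δ) (hj : δ ≤ x j) :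
    toLex (transfer x j k δ) < toLex x := by
  refine toLex_lt_iff.2 ⟨j, fun i hi => ?_, ?_⟩
  · rw [transfer_of_ne x hi.ne (hi.trans h).ne]
  · rw [transfer_left x h.ne]
    omega

/-- The shadow of a lexicographic segment is a lexicographic segment. -/
theorem IsLexSeg.boxShadow {l c : ι → ℕ} {d : ℕ} {S : Finset (ι → ℕ)}
    (hS : IsLexSeg (boxLevel l c d) S) : IsLexSeg (boxLevel l c (d + 1)) (boxShadow c S) := by
  refine ⟨boxShadow_subset hS.1, fun x hx y hy hxy => ?_⟩
  obtain ⟨-, u, hu, i, rfl⟩ := mem_boxShadow.1 hx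
  obtain ⟨k, hk, hk'⟩ := toLex_lt_iff.1 hxy
  have huL := mem_boxLevel.1 (hS.1 hu)
  have hyL := mem_boxLevel.1 hy
  have hux : ∀ j, u j ≤ (u + Pi.single i 1 : ι → ℕ) j := fun j => by simp
  have aux : ∀ j, l j < y j → (∃ z : ι → ℕ, z + Pi.single j 1 = y ∧ z ∈ boxLevel l c d ∧
      z j + 1 = y j ∧ ∀ t ≠ j, z t = y t) := by
    intro j hj
    have e : (fun t => y t - Pi.single (M := fun _ => ℕ) j 1 t) + Pi.single j 1 = y := by
      funext t
      by_cases h : t = j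
      · subst h
        rw [add_single_self]
        simp
        omega
      · rw [add_single_of_ne _ h]
        simp [h]
    refine ⟨_, e, ?_, ?_, ?_⟩
    · refine mem_boxLevel.2 ⟨fun t => ?_, ?_⟩
      · have := hyL.1 t
        by_cases h : t = j
        · subst h
          simp
          omega
        · simpa [h] using this
      · have h1 := sum_add_single (fun t => y t - Pi.single (M := fun _ => ℕ) j 1 t) j
        rw [e, hyL.2] at h1
        omega
    · simp
      omega
    · intro t ht
      simp [ht]
  -- A predecessor of `y` that is lexicographically at least `u` is wanted. Lowering a coordinate
  -- behind `k` keeps the strict gain at `k`. If there is none, the tail of `y` is minimal; then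
  -- lowering `k` itself yields a vector that dominates `u` up to `k`, and equality of sums leaves
  -- only `u` itself when no strict gain remains.
  by_cases hex : ∃ j, k < j ∧ l j < y j
  · obtain ⟨j, hkj, hj⟩ := hex
    obtain ⟨z, hz, hzL, -, hz2⟩ := aux j hj
    refine mem_boxShadow.2 ⟨fun t => (hyL.1 t).2, z, hS.2 u hu z hzL ?_, j, hz⟩
    refine toLex_lt_of_le_of_lt k (fun t ht => ?_) ?_
    · rw [hz2 t (ht.trans hkj).ne, ← hk t ht]
      exact hux t
    · rw [hz2 k hkj.ne]
      exact (hux k).trans_lt hk'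
  · push Not at hex
    have hlk : l k < y k := ((huL.1 k).1.trans (hux k)).trans_lt hk'
    obtain ⟨z, hz, hzL, hz1, hz2⟩ := aux k hlk
    refine mem_boxShadow.2 ⟨fun t => (hyL.1 t).2, z, ?_, k, hz⟩
    have h1 : ∀ t < k, u t ≤ z t := by
      intro t ht
      rw [hz2 t ht.ne, ← hk t ht]
      exact hux t
    have h2 : u k ≤ z k := by
      have := hux k
      omega
    have h3 : ∀ t, k < t → z t ≤ u t := by
      intro t ht
      rw [hz2 t ht.ne']
      exact (hex t ht).trans (huL.1 t).1
    have hzL' := mem_boxLevel.1 hzL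
    by_cases hlt : ∃ t ≤ k, u t < z t
    · obtain ⟨t, ht, htz⟩ := hlt
      exact hS.2 u hu z hzL (toLex_lt_of_le_of_lt t (fun s hs => h1 s (hs.trans_le ht)) htz)
    · push Not at hlt
      have hle : ∀ t ∈ Finset.univ, z t ≤ u t := by
        intro t _
        rcases le_or_gt t k with h | h
        · exact hlt t h
        · exact h3 t h
      have : z = u := by
        funext t
        exact (Finset.sum_eq_sum_iff_of_le hle).1 (hzL'.2.trans huL.2.symm) t (Finset.mem_univ t)
      rw [this]
      exact hu

/-- In a box with at least three free coordinates, the last present element of a compressed set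
has a smaller last coordinate than its first missing element. -/
theorem last_coord_lt_of_compressed {l c : ι → ℕ} {d : ℕ} {B : Finset (ι → ℕ)}
    (hcomp : ∀ i, l i < c i → ∀ v ∈ B, ∀ w ∈ boxLevel l c d, w i = v i → toLex v < toLex w → w ∈ B)
    {u v : ι → ℕ} (hu : u ∈ boxLevel l c d) (huB : u ∉ B) (hvL : v ∈ boxLevel l c d) (hv : v ∈ B)
    (hvu : toLex v < toLex u) {f m z : ι} (hf : l f < c f) (hm : l m < c m) (hz : l z < c z)
    (hff : ∀ i, l i < c i → f ≤ i) (hzz : ∀ i, l i < c i → i ≤ z) (hfm : f ≠ m) (hmz : m ≠ z)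
    (hfz : f ≠ z) : v z < u z := by
  have hu' := mem_boxLevel.1 hu
  have hv' := mem_boxLevel.1 hvL
  -- Agreement in one free coordinate would let compression along it pass membership from `v` to
  -- `u`.
  have hfree : ∀ i, l i < c i → u i ≠ v i := fun i hi h => huB (hcomp i hi v hv u hu h hvu)
  have hfix : ∀ i, ¬ l i < c i → u i = v i := by
    intro i hi
    have := hu'.1 i
    have := hv'.1 i
    omega
  have hfz' : f < z := lt_of_le_of_ne (hff z hz) hfz
  -- The same obstruction through a stepping stone: a vector between `v` and `u` that agrees with
  -- each of them somewhere links the two by two compressions.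
  have hno : ∀ w ∈ boxLevel l c d, toLex v < toLex w → toLex w < toLex u →
      (∃ i, l i < c i ∧ w i = v i) → (∃ j, l j < c j ∧ w j = u j) → False := by
    rintro w hw hvw hwu ⟨i, hi, hwi⟩ ⟨j, hj, hwj⟩
    exact huB (hcomp j hj w (hcomp i hi v hv w hw hwi hvw) u hu hwj.symm hwu)
  have hbelow : ∀ i < f, u i = v i := fun i hi => hfix i fun h => not_lt.2 (hff i h) hi
  have hvf : v f < u f := by
    obtain ⟨k, hk, hk'⟩ := toLex_lt_iff.1 hvu
    have hkf : l k < c k := by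
      by_contra h
      exact hk'.ne (hfix k h).symm
    rcases (hff k hkf).lt_or_eq with h | h
    · exact absurd (hk f h).symm (hfree f hf)
    · rwa [h]
  by_contra hcon
  have hzlt : u z < v z := lt_of_le_of_ne (not_lt.1 hcon) (hfree z hz)
  -- Otherwise `u` exceeds `v` at `j` and falls short of it at `z`. Moving the smaller of the two
  -- differences from `j` to `z` makes one of these coordinates agree with `v`, while `f` still
  -- agrees with `u`.
  have hmid : ∀ j, l j < c j → j ≠ f → j ≠ z → u j < v j := by
    intro j hj hjf hjz
    by_contra hc
    have hlt : v j < u j := lt_of_le_of_ne (not_lt.1 hc) (hfree j hj).symm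
    have hjz' : j < z := lt_of_le_of_ne (hzz j hj) hjz
    have b1 := hu'.1 j
    have b2 := hv'.1 j
    have b3 := hv'.1 z
    refine hno (transfer u j z (min (u j - v j) (v z - u z)))
      (transfer_mem_boxLevel hu hjz (by omega) (by omega)) ?_
      (transfer_lt u hjz' (by omega) (by omega)) ?_ ⟨f, hf, transfer_of_ne u (Ne.symm hjf) hfz _⟩
    · refine toLex_lt_iff.2 ⟨f, fun i hi => ?_, ?_⟩
      · have hij : i ≠ j := (hi.trans_le (hff j hj)).ne
        rw [transfer_of_ne u hij (hi.trans hfz').ne, hbelow i hi]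
      · rwa [transfer_of_ne u (Ne.symm hjf) hfz]
    · rcases le_total (u j - v j) (v z - u z) with h | h
      · refine ⟨j, hj, ?_⟩
        rw [transfer_left u hjz, min_eq_left h]
        omega
      · refine ⟨z, hz, ?_⟩
        rw [transfer_right, min_eq_right h]
        omega
  have hmlt := hmid m hm (Ne.symm hfm) hmz
  -- All free coordinates other than `f` are smaller in `u`, so the surplus at `f` exceeds the
  -- deficit at `m` by at least the deficit at `z`. Hence moving the deficit at `m` to `f` inside
  -- `v` stays below `u`.
  have hsum : v f + (v m - u m) < u f := by
    have e : ∀ y : ι → ℕ, ∑ i, y i =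
        y f + (y m + (y z + ∑ i ∈ ((Finset.univ.erase f).erase m).erase z, y i)) := by
      intro y
      rw [Finset.add_sum_erase _ _ (by simp [Ne.symm hfz, Ne.symm hmz]),
        Finset.add_sum_erase _ _ (by simp [Ne.symm hfm]), Finset.add_sum_erase _ _ (by simp)]
    have h1 := e u
    have h2 := e v
    rw [hu'.2] at h1
    rw [hv'.2] at h2
    have h3 : ∑ i ∈ ((Finset.univ.erase f).erase m).erase z, u i ≤
        ∑ i ∈ ((Finset.univ.erase f).erase m).erase z, v i := by
      refine Finset.sum_le_sum fun i hi => ?_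
      simp only [Finset.mem_erase] at hi
      by_cases h : l i < c i
      · exact (hmid i h hi.2.2.1 hi.1).le
      · exact (hfix i h).le
    omega
  have hfm' : f < m := lt_of_le_of_ne (hff m hm) hfm
  have b1 := hu'.1 m
  have b2 := hu'.1 f
  refine hno (transfer v m f (v m - u m))
    (transfer_mem_boxLevel hvL (Ne.symm hfm) (by omega) (by omega)) (lt_transfer v hfm' (by omega))
    ?_ ⟨z, hz, transfer_of_ne v (Ne.symm hmz) (Ne.symm hfz) _⟩ ⟨m, hm, ?_⟩
  · refine toLex_lt_iff.2 ⟨f, fun i hi => ?_, ?_⟩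
    · rw [transfer_of_ne v (hi.trans hfm').ne hi.ne, hbelow i hi]
    · rwa [transfer_right]
  · rw [transfer_left v (Ne.symm hfm)]
    omega

end BoxShadow


/-! ### The Clements–Lindström theorem by compression and exchange. -/

section ClementsLindstrom

variable {ι : Type*} [Fintype ι] [LinearOrder ι]

/-- The coordinates that are not constant on the box `[l, c]`. -/
def freeCoords (l c : ι → ℕ) : Finset ι := Finset.univ.filter fun i => l i < c i

omit [LinearOrder ι] in
theorem mem_freeCoords {l c : ι → ℕ} {i : ι} : i ∈ freeCoords l c ↔ l i < c i := by
  simp [freeCoords]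

/-- With two free coordinates a level is a path parametrised by coordinate `f`. If its first vector
can still be raised at `f`, then, `f` being the narrower direction, every vector has both
successors; any nonempty set gains at least one element and segments gain at most one. Otherwise
segments do not gain, and any set other than the whole level does not lose. -/
theorem card_boxShadow_le_of_two {l c : ι → ℕ} {d : ℕ} {f z : ι} (hfz : f < z)
    (hfree : ∀ i, l i < c i → i = f ∨ i = z) (hw : c f - l f ≤ c z - l z) {A S : Finset (ι → ℕ)}
    (hA : A ⊆ boxLevel l c d) (hS : IsLexSeg (boxLevel l c d) S) (hcard : S.card = A.card) :
    (boxShadow c S).card ≤ (boxShadow c A).card := by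
  by_cases hAS : A = S
  · rw [hAS]
  have hfz' := hfz.ne
  have htwo : ∀ x ∈ boxLevel l c d, ∀ y ∈ boxLevel l c d,
      (∀ i, i ≠ f → i ≠ z → x i = y i) ∧ x f + x z = y f + y z := by
    intro x hx y hy
    rw [mem_boxLevel] at hx hy
    have h1 : ∀ i, i ≠ f → i ≠ z → x i = y i := by
      intro i hif hiz
      have := hx.1 i
      have := hy.1 i
      have : ¬ l i < c i := fun h => (hfree i h).elim hif hiz
      omega
    have e : ∀ y : ι → ℕ, ∑ i, y i = y f + (y z + ∑ i ∈ (Finset.univ.erase f).erase z, y i) := by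
      intro y
      rw [Finset.add_sum_erase _ _ (by simp [hfz'.symm]), Finset.add_sum_erase _ _ (by simp)]
    have h2 : ∑ i ∈ (Finset.univ.erase f).erase z, x i =
        ∑ i ∈ (Finset.univ.erase f).erase z, y i := by
      refine Finset.sum_congr rfl fun i hi => ?_
      simp only [Finset.mem_erase] at hi
      exact h1 i hi.2.1 hi.1
    have h3 := hx.2.trans hy.2.symm
    rw [e, e y, h2] at h3
    exact ⟨h1, by omega⟩
  have hext : ∀ x ∈ boxLevel l c d, ∀ y ∈ boxLevel l c d, x f = y f → x = y := by
    intro x hx y hy h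
    obtain ⟨h1, h2⟩ := htwo x hx y hy
    funext i
    by_cases hif : i = f
    · rw [hif, h]
    · by_cases hiz : i = z
      · rw [hiz]
        omega
      · exact h1 i hif hiz
  have hlt : ∀ x ∈ boxLevel l c d, ∀ y ∈ boxLevel l c d, x f < y f → toLex x < toLex y := by
    intro x hx y hy h
    by_contra hc
    rcases (not_lt.1 hc).lt_or_eq with h1 | h1
    · obtain ⟨k, hk, hk'⟩ := toLex_lt_iff.1 h1
      obtain ⟨h2, h3⟩ := htwo x hx y hy
      by_cases hkf : k = f
      · subst hkf
        omega
      · by_cases hkz : k = z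
        · subst hkz
          have := hk f hfz
          omega
        · exact hk'.ne (h2 k hkf hkz).symm
    · rw [toLex.injective h1] at h
      exact lt_irrefl _ h
  have hSA : ∃ t ∈ boxLevel l c d, t ∉ A := by
    by_contra hc
    push Not at hc
    exact hAS (Finset.eq_of_subset_of_card_le (fun x hx => hc x (hS.1 hx)) hcard.ge).symm
  have hne : S.Nonempty := by
    rw [← Finset.card_pos]
    by_contra h
    have h1 : S.card = 0 := by omega
    rw [Finset.card_eq_zero.1 h1, Finset.card_eq_zero.1 (hcard.symm.trans h1)] at hAS
    exact hAS rfl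
  obtain ⟨m, hm, hmax⟩ := Finset.exists_max_image S (fun x => toLex x) hne
  have hmL := hS.1 hm
  have hmaxL : ∀ x ∈ boxLevel l c d, ¬ toLex m < toLex x :=
    fun x hx h => not_lt.2 (hmax x (hS.2 m hm x hx h)) h
  have hmf : ∀ x ∈ boxLevel l c d, x f ≤ m f :=
    fun x hx => not_lt.1 fun h => hmaxL x hx (hlt m hmL x hx h)
  have hupper : boxShadow c S ⊆
      S.image (· + Pi.single z 1) ∪ (if m f < c f then {m + Pi.single f 1} else ∅) := by
    intro y hy
    obtain ⟨hyc, x, hx, i, rfl⟩ := mem_boxShadow.1 hy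
    have hxL := mem_boxLevel.1 (hS.1 hx)
    have hi1 := hyc i
    rw [add_single_self] at hi1
    have hi2 := hxL.1 i
    rw [Finset.mem_union, Finset.mem_image]
    rcases hfree i (by omega) with rfl | rfl
    · by_cases hxm : x = m
      · right
        subst hxm
        rw [if_pos (by omega)]
        simp
      · left
        have h1 : x i < m i :=
          lt_of_le_of_ne (hmf x (hS.1 hx)) fun h => hxm (hext x (hS.1 hx) m hmL h)
        have h2 := (htwo x (hS.1 hx) m hmL).2
        have h3 := (mem_boxLevel.1 hmL).1 z
        refine ⟨transfer x z i 1, hS.2 x hx _ (transfer_mem_boxLevel (hS.1 hx) hfz'.symm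
          (by omega) (by omega)) (lt_transfer x hfz one_pos),
          transfer_add_single x hfz'.symm (by omega)⟩
    · exact Or.inl ⟨x, hx, rfl⟩
  have hinj : ∀ k, Set.InjOn (fun x : ι → ℕ => x + Pi.single k 1) (A : Set (ι → ℕ)) :=
    fun k x _ y _ h => add_right_cancel h
  have hAne : A.Nonempty := by
    rw [← Finset.card_pos, ← hcard, Finset.card_pos]
    exact hne
  by_cases hc : m f < c f
  · have hSle : (boxShadow c S).card ≤ S.card + 1 := by
      refine (Finset.card_le_card hupper).trans ((Finset.card_union_le _ _).trans ?_)
      rw [if_pos hc, Finset.card_singleton]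
      exact Nat.add_le_add_right Finset.card_image_le 1
    have hmz : m z = l z := by
      by_contra h
      have h1 := (mem_boxLevel.1 hmL).1 z
      exact hmaxL _ (transfer_mem_boxLevel hmL hfz'.symm (δ := 1) (by omega) (by omega))
        (lt_transfer m hfz one_pos)
    have hroom : ∀ x ∈ boxLevel l c d, x f < c f ∧ x z < c z := by
      intro x hx
      have h1 := hmf x hx
      have h2 := (htwo x hx m hmL).2
      have h3 := (mem_boxLevel.1 hx).1 f
      have h4 := (mem_boxLevel.1 hx).1 z
      omega
    obtain ⟨a, ha, hamax⟩ := Finset.exists_max_image A (fun x => x f) hAne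
    have hmem : ∀ x ∈ A, ∀ k, x k < c k → x + Pi.single k 1 ∈ boxShadow c A := by
      intro x hx k hk
      refine mem_boxShadow.2 ⟨fun i => ?_, x, hx, k, rfl⟩
      by_cases hik : i = k
      · subst hik
        rw [add_single_self]
        omega
      · rw [add_single_of_ne _ hik]
        exact ((mem_boxLevel.1 (hA hx)).1 i).2
    have hnot : a + Pi.single f 1 ∉ A.image (· + Pi.single z 1) := by
      intro h
      obtain ⟨x, hx, hxa⟩ := Finset.mem_image.1 h
      have := congrFun hxa f
      rw [add_single_self, add_single_of_ne _ hfz'] at this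
      have := hamax x hx
      omega
    have hsub : insert (a + Pi.single f 1) (A.image (· + Pi.single z 1)) ⊆ boxShadow c A := by
      intro y hy
      rcases Finset.mem_insert.1 hy with rfl | hy
      · exact hmem a ha f (hroom a (hA ha)).1
      · obtain ⟨x, hx, rfl⟩ := Finset.mem_image.1 hy
        exact hmem x hx z (hroom x (hA hx)).2
    have := Finset.card_le_card hsub
    rw [Finset.card_insert_of_notMem hnot, Finset.card_image_of_injOn (hinj z)] at this
    omega
  · have hSle : (boxShadow c S).card ≤ S.card := by
      refine (Finset.card_le_card hupper).trans ?_
      rw [if_neg hc, Finset.union_empty]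
      exact Finset.card_image_le
    rw [hcard] at hSle
    refine hSle.trans ?_
    obtain ⟨t, ht, htA⟩ := hSA
    -- The missing vector `t` supplies an injection into the shadow: vectors with larger `f`
    -- coordinate than `t` step along `z`, those with smaller one along `f`.
    refine Finset.card_le_card_of_injOn
      (fun x => if t f < x f then x + Pi.single z 1 else x + Pi.single f 1) ?_ ?_
    · intro x hx
      have hxL := mem_boxLevel.1 (hA hx)
      have h2 := (htwo x (hA hx) t ht).2
      have h3 := (mem_boxLevel.1 ht).1 z
      have h4 := (mem_boxLevel.1 ht).1 f
      have hxt : x f ≠ t f := fun h => htA (hext x (hA hx) t ht h ▸ hx)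
      have : ∀ k, x k < c k → x + Pi.single k 1 ∈ boxShadow c A := by
        intro k hk
        refine mem_boxShadow.2 ⟨fun i => ?_, x, hx, k, rfl⟩
        by_cases hik : i = k
        · subst hik
          rw [add_single_self]
          omega
        · rw [add_single_of_ne _ hik]
          exact (hxL.1 i).2
      dsimp only
      split_ifs with h
      · exact this z (by omega)
      · exact this f (by omega)
    · intro x hx y hy hxy
      have hxt : x f ≠ t f := fun h => htA (hext x (hA hx) t ht h ▸ hx)
      have hyt : y f ≠ t f := fun h => htA (hext y (hA hy) t ht h ▸ hy)
      refine hext x (hA hx) y (hA hy) ?_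
      have := congrFun hxy f
      dsimp only at this
      split_ifs at this <;> simp [hfz'] at this <;> omega

theorem mem_boxLevel_update {l c : ι → ℕ} {d : ℕ} {i : ι} {t : ℕ} (hl : l i ≤ t) (hc : t ≤ c i)
    {x : ι → ℕ} : x ∈ boxLevel (Function.update l i t) (Function.update c i t) d ↔
      x ∈ boxLevel l c d ∧ x i = t := by
  simp only [mem_boxLevel]
  constructor
  · rintro ⟨h1, h2⟩
    have h3 := h1 i
    simp only [Function.update_self] at h3
    refine ⟨⟨fun j => ?_, h2⟩, by omega⟩
    by_cases hj : j = i
    · subst hj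
      omega
    · simpa [hj] using h1 j
  · rintro ⟨⟨h1, h2⟩, h3⟩
    refine ⟨fun j => ?_, h2⟩
    by_cases hj : j = i
    · subst hj
      simp [h3]
    · simpa [hj] using h1 j

/-- The slice of a shadow at `i`-th coordinate `t` comes from two slices of the set. -/
theorem filter_boxShadow {l c : ι → ℕ} {d : ℕ} {i : ι} {t : ℕ} (hc : t ≤ c i)
    {B : Finset (ι → ℕ)} (hB : B ⊆ boxLevel l c d) :
    (boxShadow c B).filter (fun y => y i = t) =
      boxShadow (Function.update c i t) (B.filter fun x => x i = t) ∪
        (B.filter fun x => x i + 1 = t).image (· + Pi.single i 1) := by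
  ext y
  simp only [Finset.mem_filter, Finset.mem_union, Finset.mem_image, mem_boxShadow]
  constructor
  · rintro ⟨⟨hyc, x, hx, j, rfl⟩, hyi⟩
    by_cases hij : i = j
    · subst hij
      rw [add_single_self] at hyi
      exact Or.inr ⟨x, ⟨hx, hyi⟩, rfl⟩
    · rw [add_single_of_ne _ hij] at hyi
      refine Or.inl ⟨fun k => ?_, x, ⟨hx, hyi⟩, j, rfl⟩
      by_cases hk : k = i
      · subst hk
        rw [add_single_of_ne _ hij, hyi, Function.update_self]
      · rw [Function.update_of_ne hk]
        exact hyc k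
  · rintro (⟨hyc, x, ⟨hx, hxi⟩, j, rfl⟩ | ⟨x, ⟨hx, hxi⟩, rfl⟩)
    · have hle := hyc i
      rw [Function.update_self] at hle
      have hle' : x i ≤ (x + Pi.single j 1 : ι → ℕ) i := by simp
      refine ⟨⟨fun k => ?_, x, hx, j, rfl⟩, by omega⟩
      by_cases hk : k = i
      · subst hk
        exact hle.trans hc
      · have := hyc k
        rwa [Function.update_of_ne hk] at this
    · refine ⟨⟨fun k => ?_, x, hx, i, rfl⟩, by rw [add_single_self, hxi]⟩
      by_cases hk : k = i
      · subst hk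
        rw [add_single_self]
        omega
      · rw [add_single_of_ne _ hk]
        exact ((mem_boxLevel.1 (hB hx)).1 k).2

/-- Adding a unit vector is an order isomorphism from one slice to the next. It makes the two sets
contributing to a slice of the shadow comparable. -/
theorem IsLexSeg.image_add_single {l c : ι → ℕ} {d : ℕ} {i : ι} {t : ℕ} {S : Finset (ι → ℕ)}
    (hS : IsLexSeg (boxLevel (Function.update l i t) (Function.update c i t) d) S) :
    IsLexSeg (boxLevel (Function.update l i (t + 1)) (Function.update c i (t + 1)) (d + 1))
      (S.image (· + Pi.single i 1)) := by
  have key : ∀ x : ι → ℕ, x + Pi.single i 1 ∈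
      boxLevel (Function.update l i (t + 1)) (Function.update c i (t + 1)) (d + 1) ↔
      x ∈ boxLevel (Function.update l i t) (Function.update c i t) d := by
    intro x
    rw [mem_boxLevel, mem_boxLevel, sum_add_single, add_left_inj]
    refine and_congr_left fun _ => forall_congr' fun j => ?_
    by_cases hj : j = i
    · subst hj
      simp
    · simp [hj]
  refine ⟨fun y hy => ?_, fun y hy z hz hyz => ?_⟩
  · obtain ⟨x, hx, rfl⟩ := Finset.mem_image.1 hy
    exact (key x).2 (hS.1 hx)
  · obtain ⟨x, hx, rfl⟩ := Finset.mem_image.1 hy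
    have hzi := (mem_boxLevel.1 hz).1 i
    simp only [Function.update_self] at hzi
    obtain ⟨w, rfl⟩ : ∃ w : ι → ℕ, w + Pi.single i 1 = z := by
      refine ⟨fun j => z j - Pi.single (M := fun _ => ℕ) i 1 j, ?_⟩
      funext j
      by_cases hj : j = i
      · subst hj
        rw [add_single_self]
        simp
        omega
      · rw [add_single_of_ne _ hj]
        simp [hj]
    exact Finset.mem_image.2 ⟨w, hS.2 x hx w ((key w).1 hz) (toLex_add_single_lt.1 hyz), rfl⟩

/-- The minimal shadow property of lexicographic segments on a level of a box. -/
def LexSegMinimal (l c : ι → ℕ) (d : ℕ) : Prop :=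
  ∀ A S : Finset (ι → ℕ), A ⊆ boxLevel l c d → IsLexSeg (boxLevel l c d) S → S.card = A.card →
    (boxShadow c S).card ≤ (boxShadow c A).card

/-- Compression: replacing every slice of `B` in direction `i` by a lexicographic segment. -/
theorem exists_compression {l c : ι → ℕ} {d : ℕ} {i : ι}
    (ih : ∀ t, l i ≤ t → t ≤ c i →
      LexSegMinimal (Function.update l i t) (Function.update c i t) d)
    {B : Finset (ι → ℕ)} (hB : B ⊆ boxLevel l c d) :
    ∃ C ⊆ boxLevel l c d, C.card = B.card ∧ (boxShadow c C).card ≤ (boxShadow c B).card ∧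
      (∀ t, (C.filter fun x => x i = t).card = (B.filter fun x => x i = t).card) ∧
      ∀ v ∈ C, ∀ w ∈ boxLevel l c d, w i = v i → toLex v < toLex w → w ∈ C := by
  have hex : ∀ t, ∃ S : Finset (ι → ℕ), l i ≤ t → t ≤ c i →
      IsLexSeg (boxLevel (Function.update l i t) (Function.update c i t) d) S ∧
      S.card = (B.filter fun x => x i = t).card := by
    intro t
    by_cases h : l i ≤ t ∧ t ≤ c i
    · obtain ⟨S, hS⟩ := exists_isLexSeg
        (boxLevel (Function.update l i t) (Function.update c i t) d)
        (q := (B.filter fun x => x i = t).card) (Finset.card_le_card fun x hx => by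
          rw [Finset.mem_filter] at hx
          exact (mem_boxLevel_update h.1 h.2).2 ⟨hB hx.1, hx.2⟩)
      exact ⟨S, fun _ _ => hS⟩
    · exact ⟨∅, fun h1 h2 => absurd ⟨h1, h2⟩ h⟩
  choose seg hseg using hex
  set C := (boxLevel l c d).filter fun x => x ∈ seg (x i) with hCdef
  have hCsub : C ⊆ boxLevel l c d := Finset.filter_subset _ _
  have hbd : ∀ x ∈ boxLevel l c d, l i ≤ x i ∧ x i ≤ c i := fun x hx => (mem_boxLevel.1 hx).1 i
  have hCt : ∀ t, l i ≤ t → t ≤ c i → C.filter (fun x => x i = t) = seg t := by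
    intro t h1 h2
    ext x
    simp only [hCdef, Finset.mem_filter]
    constructor
    · rintro ⟨⟨_, h⟩, rfl⟩
      exact h
    · intro hx
      obtain ⟨h3, rfl⟩ := (mem_boxLevel_update h1 h2).1 ((hseg t h1 h2).1.1 hx)
      exact ⟨⟨h3, hx⟩, rfl⟩
  have hcardt : ∀ t, (C.filter fun x => x i = t).card = (B.filter fun x => x i = t).card := by
    intro t
    by_cases h : l i ≤ t ∧ t ≤ c i
    · rw [hCt t h.1 h.2, (hseg t h.1 h.2).2]
    · rw [Finset.filter_eq_empty_iff.2, Finset.filter_eq_empty_iff.2]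
      · rintro x hx rfl
        exact h (hbd x (hB hx))
      · rintro x hx rfl
        exact h (hbd x (hCsub hx))
  have hmaps : ∀ {e : ℕ} {D : Finset (ι → ℕ)}, D ⊆ boxLevel l c e →
      D.card = ∑ t ∈ Finset.Icc (l i) (c i), (D.filter fun x => x i = t).card := by
    intro e D hD
    refine Finset.card_eq_sum_card_fiberwise fun x hx => ?_
    have := (mem_boxLevel.1 (hD hx)).1 i
    simpa using this
  refine ⟨C, hCsub, ?_, ?_, hcardt, ?_⟩
  · rw [hmaps hCsub, hmaps hB]
    exact Finset.sum_congr rfl fun t _ => hcardt t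
  · rw [hmaps (boxShadow_subset hCsub), hmaps (boxShadow_subset hB)]
    refine Finset.sum_le_sum fun t ht => ?_
    obtain ⟨h1, h2⟩ := Finset.mem_Icc.1 ht
    rw [filter_boxShadow h2 hCsub, filter_boxShadow h2 hB, hCt t h1 h2]
    have hinj : ∀ D : Finset (ι → ℕ), (D.image (· + Pi.single i 1)).card = D.card :=
      fun D => Finset.card_image_of_injective _ fun x y h => add_right_cancel h
    have hle1 : (boxShadow (Function.update c i t) (seg t)).card ≤
        (boxShadow (Function.update c i t) (B.filter fun x => x i = t)).card := by
      refine ih t h1 h2 _ _ (fun x hx => ?_) (hseg t h1 h2).1 (hseg t h1 h2).2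
      rw [Finset.mem_filter] at hx
      exact (mem_boxLevel_update h1 h2).2 ⟨hB hx.1, hx.2⟩
    have hempty : ∀ D ⊆ boxLevel l c d, (t = 0 ∨ t = l i) →
        (D.filter fun x => x i + 1 = t) = ∅ := by
      intro D hD h
      refine Finset.filter_eq_empty_iff.2 fun x hx => ?_
      have := hbd x (hD hx)
      omega
    -- The lowest slice receives nothing from below; the case `t = 0` is kept apart so that `t` has
    -- a predecessor otherwise.
    by_cases ht0 : t = 0 ∨ t = l i
    · rw [hempty C hCsub ht0, hempty B hB ht0]
      simpa using hle1
    · obtain ⟨s, rfl⟩ : ∃ s, t = s + 1 := ⟨t - 1, by omega⟩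
      have hs1 : l i ≤ s := by omega
      have hs2 : s ≤ c i := by omega
      simp only [add_left_inj]
      rw [hCt s hs1 hs2]
      -- For compressed slices both contributions are segments of the same level, hence nested:
      -- their union has the size of the larger one, which is bounded by the corresponding part of
      -- the shadow of `B`.
      rcases (hseg (s + 1) h1 h2).1.boxShadow.subset_or
        (hseg s hs1 hs2).1.image_add_single with h3 | h3
      · rw [Finset.union_eq_right.2 h3, hinj, (hseg s hs1 hs2).2, ← hinj]
        exact Finset.card_le_card Finset.subset_union_right
      · rw [Finset.union_eq_left.2 h3]
        exact hle1.trans (Finset.card_le_card Finset.subset_union_left)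
  · intro v hv w hw hwv hlt
    rw [hCdef, Finset.mem_filter] at hv ⊢
    have hb := hbd v hv.1
    refine ⟨hw, ?_⟩
    rw [hwv]
    exact (hseg (v i) hb.1 hb.2).1.2 v hv.2 w ((mem_boxLevel_update hb.1 hb.2).2 ⟨hw, hwv⟩) hlt

/-- The Clements–Lindström theorem, for boxes whose free coordinates have increasing widths. -/
theorem lexSegMinimal (l c : ι → ℕ) (d : ℕ)
    (hsort : ∀ i j, i < j → l i < c i → l j < c j → c i - l i ≤ c j - l j) :
    LexSegMinimal l c d := by
  induction hN : (freeCoords l c).card using Nat.strong_induction_on generalizing l c with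
  | _ N ih =>
  subst hN
  intro A S hA hS hcard
  by_cases hfew : (freeCoords l c).card ≤ 1
  · suffices A = S by rw [this]
    have hsub : ∀ x ∈ boxLevel l c d, ∀ y ∈ boxLevel l c d, x = y := by
      intro x hx y hy
      rw [mem_boxLevel] at hx hy
      have h1 : ∀ i, ¬ l i < c i → x i = y i := by
        intro i hi
        have := hx.1 i
        have := hy.1 i
        omega
      funext i
      by_cases hi : l i < c i
      · have h2 : ∀ j ∈ Finset.univ.erase i, x j = y j := by
          intro j hj
          refine h1 j fun hj' => (Finset.mem_erase.1 hj).1 ?_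
          exact Finset.card_le_one.1 hfew j (mem_freeCoords.2 hj') i (mem_freeCoords.2 hi)
        have h3 := hx.2.trans hy.2.symm
        have h4 : ∑ j ∈ Finset.univ.erase i, x j = ∑ j ∈ Finset.univ.erase i, y j :=
          Finset.sum_congr rfl h2
        rw [← Finset.add_sum_erase _ _ (Finset.mem_univ i),
          ← Finset.add_sum_erase _ y (Finset.mem_univ i), h4] at h3
        omega
      · exact h1 i hi
    by_cases hAe : A = ∅
    · rw [hAe, Finset.card_empty, Finset.card_eq_zero] at hcard
      rw [hAe, hcard]
    · obtain ⟨a, ha⟩ := Finset.nonempty_iff_ne_empty.2 hAe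
      have : S.Nonempty := by
        rw [← Finset.card_pos, hcard, Finset.card_pos]
        exact ⟨a, ha⟩
      obtain ⟨b, hb⟩ := this
      ext x
      constructor
      · intro hx
        rwa [hsub x (hA hx) b (hS.1 hb)]
      · intro hx
        rwa [hsub x (hS.1 hx) a (hA ha)]
  have hFne : (freeCoords l c).Nonempty := Finset.card_pos.1 (by omega)
  set f := (freeCoords l c).min' hFne with hfdef
  set z := (freeCoords l c).max' hFne with hzdef
  have hf : l f < c f := mem_freeCoords.1 (Finset.min'_mem _ hFne)
  have hz : l z < c z := mem_freeCoords.1 (Finset.max'_mem _ hFne)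
  have hff : ∀ i, l i < c i → f ≤ i := fun i hi => Finset.min'_le _ _ (mem_freeCoords.2 hi)
  have hzz : ∀ i, l i < c i → i ≤ z := fun i hi => Finset.le_max' _ _ (mem_freeCoords.2 hi)
  have hfz : f < z := Finset.min'_lt_max'_of_card _ (by omega)
  by_cases htwo : ∀ i, l i < c i → i = f ∨ i = z
  · exact card_boxShadow_le_of_two hfz htwo (hsort f z hfz hf hz) hA hS hcard
  push Not at htwo
  obtain ⟨m, hm, hmf, hmz⟩ := htwo
  have hcompr : ∀ i, l i < c i → ∀ t, l i ≤ t → t ≤ c i →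
      LexSegMinimal (Function.update l i t) (Function.update c i t) d := by
    intro i hi t h1 h2
    have hfr : ∀ j, Function.update l i t j < Function.update c i t j ↔ j ≠ i ∧ l j < c j := by
      intro j
      by_cases hj : j = i
      · subst hj
        simp
      · simp [hj]
    refine ih _ (Finset.card_lt_card ⟨fun j hj => ?_, fun h => ?_⟩) _ _ ?_ rfl
    · rw [mem_freeCoords] at hj ⊢
      exact ((hfr j).1 hj).2
    · have := h (mem_freeCoords.2 hi)
      rw [mem_freeCoords, hfr] at this
      exact this.1 rfl
    · intro j k hjk hj hk
      rw [hfr] at hj hk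
      simpa [hj.1, hk.1] using hsort j k hjk hj.2 hk.2
  -- Among all sets as good as `A`, take the one that is largest in the colexicographic order built
  -- on the lexicographic order of vectors. Compression and exchange would both increase it, so it
  -- is a segment.
  set cand := (boxLevel l c d).powerset.filter fun B =>
    B.card = A.card ∧ (boxShadow c B).card ≤ (boxShadow c A).card with hcand
  have hcand_mem : ∀ B, B ∈ cand ↔ B ⊆ boxLevel l c d ∧
      B.card = A.card ∧ (boxShadow c B).card ≤ (boxShadow c A).card := by
    intro B
    simp [hcand]
  obtain ⟨B, hBc, hBmax⟩ := Finset.exists_max_image cand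
    (fun B => toColex (B.map toLex.toEmbedding)) ⟨A, (hcand_mem A).2 ⟨hA, rfl, le_rfl⟩⟩
  obtain ⟨hBL, hBcard, hBsh⟩ := (hcand_mem B).1 hBc
  have hnlt : ∀ C ∈ cand, ¬ ∃ a ∈ C, a ∉ B ∧ ∀ b ∈ B, b ∉ C → toLex b < toLex a := by
    rintro C hC ⟨a, ha, haB, h⟩
    refine not_lt.2 (hBmax C hC) (Finset.Colex.toColex_lt_toColex_iff_exists_forall_lt.2 ?_)
    refine ⟨toLex a, by simpa using ha, by simpa using haB, ?_⟩
    intro b hb hb'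
    simp only [Finset.mem_map, Equiv.coe_toEmbedding] at hb hb'
    obtain ⟨b, hb, rfl⟩ := hb
    exact h b hb fun hbC => hb' ⟨b, hbC, rfl⟩
  have hcomp : ∀ i, l i < c i → ∀ v ∈ B, ∀ w ∈ boxLevel l c d, w i = v i →
      toLex v < toLex w → w ∈ B := by
    intro i hi
    obtain ⟨C, hCL, hCcard, hCsh, hCt, hCcomp⟩ := exists_compression (hcompr i hi) hBL
    suffices C = B by
      rw [← this]
      exact hCcomp
    by_contra hne
    have hCne : (C \ B).Nonempty := by
      rw [Finset.nonempty_iff_ne_empty]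
      intro h
      exact hne (Finset.eq_of_subset_of_card_le (Finset.sdiff_eq_empty_iff_subset.1 h) hCcard.ge)
    obtain ⟨a, ha, hamax⟩ := Finset.exists_max_image (C \ B) (fun x => toLex x) hCne
    rw [Finset.mem_sdiff] at ha
    refine hnlt C ((hcand_mem C).2 ⟨hCL, hCcard.trans hBcard, hCsh.trans hBsh⟩)
      ⟨a, ha.1, ha.2, fun b hb hbC => ?_⟩
    -- A vector lost by compression is replaced by a new one in its own slice, since slice sizes are
    -- preserved; the new one is lexicographically larger because `C` is a segment there.
    obtain ⟨y, hy, hyB⟩ : ∃ y ∈ C.filter (fun x => x i = b i), y ∉ B := by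
      by_contra hcon
      push Not at hcon
      have h1 : C.filter (fun x => x i = b i) ⊆ B.filter fun x => x i = b i := by
        intro y hy
        exact Finset.mem_filter.2 ⟨hcon y hy, (Finset.mem_filter.1 hy).2⟩
      have h2 := Finset.eq_of_subset_of_card_le h1 (hCt (b i)).ge
      have h3 : b ∈ C.filter fun x => x i = b i := by
        rw [h2]
        exact Finset.mem_filter.2 ⟨hb, rfl⟩
      exact hbC (Finset.mem_filter.1 h3).1
    rw [Finset.mem_filter] at hy
    refine lt_of_lt_of_le ?_ (hamax y (Finset.mem_sdiff.2 ⟨hy.1, hyB⟩))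
    rcases lt_trichotomy (toLex b) (toLex y) with h | h | h
    · exact h
    · rw [toLex.injective h] at hb
      exact absurd hb hyB
    · exact absurd (hCcomp y hy.1 b (hBL hb) hy.2.symm h) hbC
  suffices hseg : IsLexSeg (boxLevel l c d) B by
    rwa [hS.eq_of_card hseg (hcard.trans hBcard.symm)]
  by_contra hns
  obtain ⟨x, hx, y, hy, hxy, hyB⟩ : ∃ x ∈ B, ∃ y ∈ boxLevel l c d, toLex x < toLex y ∧ y ∉ B := by
    by_contra hcon
    push Not at hcon
    exact hns ⟨hBL, hcon⟩
  obtain ⟨u, hu, humax⟩ := Finset.exists_max_image (boxLevel l c d \ B) (fun x => toLex x)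
    ⟨y, Finset.mem_sdiff.2 ⟨hy, hyB⟩⟩
  obtain ⟨v, hv, hvmin⟩ := Finset.exists_min_image B (fun x => toLex x) ⟨x, hx⟩
  obtain ⟨huL, huB⟩ := Finset.mem_sdiff.1 hu
  have hvu : toLex v < toLex u :=
    ((hvmin x hx).trans_lt hxy).trans_le (humax y (Finset.mem_sdiff.2 ⟨hy, hyB⟩))
  have hzlt := last_coord_lt_of_compressed hcomp huL huB (hBL hv) hv hvu hf hm hz hff hzz
    (Ne.symm hmf) hmz hfz.ne
  have huL' := mem_boxLevel.1 huL
  have hvL' := mem_boxLevel.1 (hBL hv)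
  have huv : u ∉ B.erase v := fun h => huB (Finset.mem_of_mem_erase h)
  have hv_sh : v + Pi.single z 1 ∈ boxShadow c B := by
    refine mem_boxShadow.2 ⟨fun i => ?_, v, hv, z, rfl⟩
    by_cases hi : i = z
    · subst hi
      rw [add_single_self]
      have := huL'.1 z
      omega
    · rw [add_single_of_ne _ hi]
      exact (hvL'.1 i).2
  have hlast : ∀ (w : ι → ℕ) (i : ι), (∀ k, (w + Pi.single i 1 : ι → ℕ) k ≤ c k) →
      l i ≤ w i → i ≠ z → i < z := by
    intro w i h1 h2 h3
    have := h1 i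
    rw [add_single_self] at this
    exact lt_of_le_of_ne (hzz i (by omega)) h3
  -- Exchanging `v` for `u` costs at most `u + e_z`: any other successor of `u` is also a successor,
  -- along `z`, of a vector above `u`, which lies in `B`. It removes `v + e_z`, because another
  -- predecessor of that vector would be smaller than `v`.
  have hsub : boxShadow c (insert u (B.erase v)) ⊆
      insert (u + Pi.single z 1) ((boxShadow c B).erase (v + Pi.single z 1)) := by
    intro y hy
    obtain ⟨hyc, w, hw, i, rfl⟩ := mem_boxShadow.1 hy
    rw [Finset.mem_insert, Finset.mem_erase]
    rcases Finset.mem_insert.1 hw with rfl | hw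
    · by_cases hi : i = z
      · left
        rw [hi]
      · right
        have hiz := hlast w i hyc (huL'.1 i).1 hi
        have hyi := hyc i
        rw [add_single_self] at hyi
        have h1 := huL'.1 z
        have h2 := hvL'.1 z
        have hgt := lt_transfer w hiz one_pos
        have htL : transfer w z i 1 ∈ boxLevel l c d :=
          transfer_mem_boxLevel huL (Ne.symm hi) (by omega) hyi
        have hadd := transfer_add_single w (Ne.symm hi) (by omega)
        have htB : transfer w z i 1 ∈ B := by
          by_contra h
          exact not_lt.2 (humax _ (Finset.mem_sdiff.2 ⟨htL, h⟩)) hgt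
        refine ⟨fun h => ?_, mem_boxShadow.2 ⟨hyc, _, htB, z, hadd⟩⟩
        rw [← hadd] at h
        rw [add_right_cancel h] at hgt
        exact lt_asymm hgt hvu
    · right
      obtain ⟨hwv, hwB⟩ := Finset.mem_erase.1 hw
      refine ⟨fun h => ?_, mem_boxShadow.2 ⟨hyc, w, hwB, i, rfl⟩⟩
      by_cases hi : i = z
      · rw [hi] at h
        exact hwv (add_right_cancel h)
      · have hiz := hlast w i hyc ((mem_boxLevel.1 (hBL hwB)).1 i).1 hi
        refine not_lt.2 (hvmin w hwB) (toLex_lt_iff.2 ⟨i, fun j hj => ?_, ?_⟩)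
        · have := congrFun h j
          rwa [add_single_of_ne _ hj.ne, add_single_of_ne _ (hj.trans hiz).ne] at this
        · have := congrFun h i
          rw [add_single_self, add_single_of_ne _ hi] at this
          omega
  have hpos : 0 < (boxShadow c B).card := Finset.card_pos.2 ⟨_, hv_sh⟩
  refine hnlt (insert u (B.erase v)) ((hcand_mem _).2 ⟨?_, ?_, ?_⟩)
    ⟨u, Finset.mem_insert_self _ _, huB, ?_⟩
  · intro w hw
    rcases Finset.mem_insert.1 hw with rfl | hw
    · exact huL
    · exact hBL (Finset.mem_of_mem_erase hw)
  · rw [Finset.card_insert_of_notMem huv, Finset.card_erase_add_one hv, hBcard]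
  · refine (Finset.card_le_card hsub).trans ((Finset.card_insert_le _ _).trans ?_)
    rw [Finset.card_erase_of_mem hv_sh]
    omega
  · intro b hb hb'
    have : b = v := by
      by_contra h
      exact hb' (Finset.mem_insert_of_mem (Finset.mem_erase.2 ⟨h, hb⟩))
    rwa [this]

end ClementsLindstrom


/-! ### Order, covering relation and degree on the monomial poset. -/

section MonomialPosetBasics

attribute [local instance] MvPolynomial.gradedAlgebra

variable {σ K : Type*} [Field K] {I : Ideal (MvPolynomial σ K)}

theorem monomial_notMem_of_le {m n : σ →₀ ℕ} (h : m ≤ n) (hn : monomial n (1 : K) ∉ I) :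
    monomial m (1 : K) ∉ I := by
  intro hm
  apply hn
  have : monomial n (1 : K) = monomial (n - m) 1 * monomial m 1 := by
    rw [monomial_mul, one_mul, tsub_add_cancel_of_le h]
  rw [this]
  exact I.mul_mem_left _ hm

/-- The coset of a monomial outside the ideal. -/
noncomputable def MonomialPoset.of (m : σ →₀ ℕ) (hm : monomial m (1 : K) ∉ I) : MonomialPoset I :=
  ⟨Ideal.Quotient.mk I (monomial m 1), m, hm, rfl⟩

/-- The coset of a monomial, as an element of the monomial poset (and the coset of `1` if the
monomial lies in the ideal). -/
noncomputable def monomialCoset (h0 : monomial 0 (1 : K) ∉ I) (m : σ →₀ ℕ) : MonomialPoset I :=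
  open Classical in
  if h : monomial m (1 : K) ∉ I then MonomialPoset.of m h else MonomialPoset.of 0 h0

theorem monomialCoset_val (h0 : monomial 0 (1 : K) ∉ I) {m : σ →₀ ℕ}
    (hm : monomial m (1 : K) ∉ I) :
    (monomialCoset h0 m).1 = Ideal.Quotient.mk I (monomial m 1) :=
  congrArg Subtype.val (dif_pos hm)

theorem exists_monomialCoset_eq (h0 : monomial 0 (1 : K) ∉ I) (z : MonomialPoset I) :
    ∃ m, monomial m (1 : K) ∉ I ∧ monomialCoset h0 m = z := by
  obtain ⟨z, m, hm, rfl⟩ := z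
  exact ⟨m, hm, Subtype.ext (monomialCoset_val h0 hm)⟩

theorem monomialCoset_eq_iff (h0 : monomial 0 (1 : K) ∉ I) {m n : σ →₀ ℕ}
    (hm : monomial m (1 : K) ∉ I) (hn : monomial n (1 : K) ∉ I) :
    monomialCoset h0 m = monomialCoset h0 n ↔ monomial m (1 : K) - monomial n 1 ∈ I := by
  refine Subtype.ext_iff.trans ?_
  rw [monomialCoset_val h0 hm, monomialCoset_val h0 hn, Ideal.Quotient.eq]

/-- The degree of an element of the monomial poset. -/
noncomputable def cosetDegree (z : MonomialPoset I) : ℕ := z.2.choose.degree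

theorem cosetDegree_monomialCoset (hI : I.IsHomogeneous (homogeneousSubmodule σ K))
    (h0 : monomial 0 (1 : K) ∉ I) {m : σ →₀ ℕ} (hm : monomial m (1 : K) ∉ I) :
    cosetDegree (monomialCoset h0 m) = m.degree := by
  have h := (monomialCoset h0 m).2.choose_spec
  have h' := (monomialCoset_val h0 hm).symm.trans h.2
  exact (degree_eq_of_sub_mem hI hm (Ideal.Quotient.eq.1 h')).symm

theorem monomialCoset_le_iff (hI : I.IsHomogeneous (homogeneousSubmodule σ K))
    (h0 : monomial 0 (1 : K) ∉ I) {m : σ →₀ ℕ} (hm : monomial m (1 : K) ∉ I)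
    (z : MonomialPoset I) : (monomialPartialOrder I hI).le (monomialCoset h0 m) z ↔
      ∃ s, monomial (m + s) (1 : K) ∉ I ∧ z = monomialCoset h0 (m + s) := by
  obtain ⟨n, hn, rfl⟩ := exists_monomialCoset_eq h0 z
  constructor
  · rintro ⟨⟨t, s, hs, rfl⟩, ht⟩
    rw [monomialCoset_val h0 hm, monomialCoset_val h0 hn, ← map_mul, monomial_mul, one_mul] at ht
    have hms : monomial (m + s) (1 : K) ∉ I := by
      intro h
      rw [Ideal.Quotient.eq_zero_iff_mem.2 h, Ideal.Quotient.eq_zero_iff_mem] at ht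
      exact hn ht
    refine ⟨s, hms, ?_⟩
    rw [monomialCoset_eq_iff h0 hn hms, ← Ideal.Quotient.eq, ht]
  · rintro ⟨s, hs, h⟩
    refine ⟨monomialCoset h0 s, ?_⟩
    rw [h, monomialCoset_val h0 hm, monomialCoset_val h0 hs, monomialCoset_val h0
      (monomial_notMem_of_le le_add_self hs), ← map_mul, monomial_mul, one_mul]

theorem monomialCoset_lt_iff (hI : I.IsHomogeneous (homogeneousSubmodule σ K))
    (h0 : monomial 0 (1 : K) ∉ I) {m : σ →₀ ℕ} (hm : monomial m (1 : K) ∉ I)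
    (z : MonomialPoset I) : (monomialPartialOrder I hI).lt (monomialCoset h0 m) z ↔
      ∃ s, s ≠ 0 ∧ monomial (m + s) (1 : K) ∉ I ∧ z = monomialCoset h0 (m + s) := by
  let _ := monomialPartialOrder I hI
  have h1 : (monomialPartialOrder I hI).lt (monomialCoset h0 m) z ↔
      monomialCoset h0 m ≤ z ∧ monomialCoset h0 m ≠ z := lt_iff_le_and_ne
  rw [h1]
  constructor
  · rintro ⟨h2, h3⟩
    obtain ⟨s, hs, rfl⟩ := (monomialCoset_le_iff hI h0 hm z).1 h2
    refine ⟨s, ?_, hs, rfl⟩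
    rintro rfl
    simp at h3
  · rintro ⟨s, hs0, hs, rfl⟩
    refine ⟨(monomialCoset_le_iff hI h0 hm _).2 ⟨s, hs, rfl⟩, fun h => hs0 ?_⟩
    have := congrArg cosetDegree h
    rw [cosetDegree_monomialCoset hI h0 hm, cosetDegree_monomialCoset hI h0 hs, map_add] at this
    rw [← Finsupp.degree_eq_zero_iff]
    omega

/-- A proper multiple factors through a multiple by a single variable. Conversely nothing lies
strictly between, because the degree is well defined on cosets and rises strictly. -/
theorem monomialCoset_covBy_iff (hI : I.IsHomogeneous (homogeneousSubmodule σ K))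
    (h0 : monomial 0 (1 : K) ∉ I) {m : σ →₀ ℕ} (hm : monomial m (1 : K) ∉ I)
    (z : MonomialPoset I) :
    @CovBy _ (monomialPartialOrder I hI).toLT (monomialCoset h0 m) z ↔
      ∃ i, monomial (m + Finsupp.single i 1) (1 : K) ∉ I ∧
        z = monomialCoset h0 (m + Finsupp.single i 1) := by
  let _ := monomialPartialOrder I hI
  constructor
  · intro h
    obtain ⟨s, hs0, hs, rfl⟩ := (monomialCoset_lt_iff hI h0 hm z).1 h.lt
    obtain ⟨i, hi⟩ := Finsupp.support_nonempty_iff.2 hs0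
    have hle : Finsupp.single i 1 ≤ s := by
      rw [Finsupp.single_le_iff]
      exact Nat.one_le_iff_ne_zero.2 (Finsupp.mem_support_iff.1 hi)
    obtain ⟨t, rfl⟩ := exists_add_of_le hle
    rw [← add_assoc] at hs h ⊢
    have hmi := monomial_notMem_of_le le_self_add hs
    refine ⟨i, hmi, ?_⟩
    by_contra hne
    refine h.2 (c := monomialCoset h0 (m + Finsupp.single i 1))
      ((monomialCoset_lt_iff hI h0 hm _).2 ⟨_, by simp, hmi, rfl⟩)
      ((monomialCoset_lt_iff hI h0 hmi _).2 ⟨t, ?_, hs, rfl⟩)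
    rintro rfl
    simp at hne
  · rintro ⟨i, hi, rfl⟩
    refine ⟨(monomialCoset_lt_iff hI h0 hm _).2 ⟨_, by simp, hi, rfl⟩, fun c hc hc' => ?_⟩
    obtain ⟨s, hs0, hs, rfl⟩ := (monomialCoset_lt_iff hI h0 hm c).1 hc
    obtain ⟨t, ht0, ht, h⟩ := (monomialCoset_lt_iff hI h0 hs _).1 hc'
    have := congrArg cosetDegree h
    rw [cosetDegree_monomialCoset hI h0 hi, cosetDegree_monomialCoset hI h0 ht] at this
    simp only [map_add, Finsupp.degree_single] at this
    rw [Ne, ← Finsupp.degree_eq_zero_iff] at hs0 ht0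
    omega

theorem isRankFunction_cosetDegree (hI : I.IsHomogeneous (homogeneousSubmodule σ K))
    (h0 : monomial 0 (1 : K) ∉ I) :
    @IsRankFunction _ (monomialPartialOrder I hI) (cosetDegree (I := I)) := by
  let _ := monomialPartialOrder I hI
  refine ⟨⟨monomialCoset h0 0, fun z => ?_, ?_⟩, fun a b hab => ?_⟩
  · obtain ⟨m, hm, rfl⟩ := exists_monomialCoset_eq h0 z
    exact (monomialCoset_le_iff hI h0 h0 _).2 ⟨m, by rwa [zero_add], by rw [zero_add]⟩
  · rw [cosetDegree_monomialCoset hI h0 h0, map_zero]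
  · obtain ⟨m, hm, rfl⟩ := exists_monomialCoset_eq h0 a
    obtain ⟨i, hi, rfl⟩ := (monomialCoset_covBy_iff hI h0 hm b).1 hab
    rw [cosetDegree_monomialCoset hI h0 hm, cosetDegree_monomialCoset hI h0 hi]
    simp

theorem isMacaulayQuotient_iff (hI : I.IsHomogeneous (homogeneousSubmodule σ K)) :
    IsMacaulayQuotient I ↔ @IsMacaulayPoset (MonomialPoset I) (monomialPartialOrder I hI) :=
  ⟨fun ⟨_, h⟩ => h, fun h => ⟨hI, h⟩⟩

end MonomialPosetBasics


/-! ### Two boxes glued at the bottom, and possibly at the top. -/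

section Gluing

/-- `P` consists of two boxes, embedded by `f` and `g`, that share their bottom element
and are disjoint in all ranks strictly between `0` and `D`. -/
structure IsGluing {P ι κ : Type*} [PartialOrder P] [Fintype ι] [Fintype κ] [DecidableEq ι]
    [DecidableEq κ] (r : P → ℕ) (D : ℕ) (c : ι → ℕ) (c' : κ → ℕ) (f : (ι → ℕ) → P)
    (g : (κ → ℕ) → P) : Prop where
  rank : IsRankFunction r
  surj : ∀ z, (∃ x ≤ c, f x = z) ∨ ∃ y ≤ c', g y = z
  f_inj : ∀ x ≤ c, ∀ x' ≤ c, f x = f x' → x = x'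
  g_inj : ∀ y ≤ c', ∀ y' ≤ c', g y = g y' → y = y'
  f_rank : ∀ x ≤ c, r (f x) = ∑ i, x i
  g_rank : ∀ y ≤ c', r (g y) = ∑ j, y j
  disj : ∀ x ≤ c, ∀ y ≤ c', 0 < ∑ i, x i → ∑ i, x i < D → f x ≠ g y
  f_cov : ∀ x ≤ c, x ≠ 0 → ∀ z, f x ⋖ z ↔ ∃ i, x + Pi.single i 1 ≤ c ∧ z = f (x + Pi.single i 1)
  g_cov : ∀ y ≤ c', y ≠ 0 → ∀ z, g y ⋖ z ↔
    ∃ j, y + Pi.single j 1 ≤ c' ∧ z = g (y + Pi.single j 1)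
  f_zero : f 0 = g 0
  bot_cov : ∀ z, r z = 1 → f 0 ⋖ z

theorem IsGluing.symm {P ι κ : Type*} [PartialOrder P] [Fintype ι] [Fintype κ] [DecidableEq ι]
    [DecidableEq κ] {r : P → ℕ} {D : ℕ} {c : ι → ℕ} {c' : κ → ℕ} {f : (ι → ℕ) → P}
    {g : (κ → ℕ) → P} (h : IsGluing r D c c' f g) : IsGluing r D c' c g f where
  rank := h.rank
  surj z := (h.surj z).symm
  f_inj := h.g_inj
  g_inj := h.f_inj
  f_rank := h.g_rank
  g_rank := h.f_rank
  disj y hy x hx h1 h2 e := by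
    have e' := congrArg r e
    rw [h.g_rank y hy, h.f_rank x hx] at e'
    exact h.disj x hx y hy (e' ▸ h1) (e' ▸ h2) e.symm
  f_cov := h.g_cov
  g_cov := h.f_cov
  f_zero := h.f_zero.symm
  bot_cov z hz := h.f_zero ▸ h.bot_cov z hz

theorem IsGluing.finite {P ι κ : Type*} [PartialOrder P] [Fintype ι] [Fintype κ] [DecidableEq ι]
    [DecidableEq κ] {r : P → ℕ} {D : ℕ} {c : ι → ℕ} {c' : κ → ℕ} {f : (ι → ℕ) → P}
    {g : (κ → ℕ) → P} (h : IsGluing r D c c' f g) : Finite P := by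
  rw [← Set.finite_univ_iff]
  refine (((Set.finite_Iic c).image f).union ((Set.finite_Iic c').image g)).subset ?_
  rintro z -
  exact h.surj z

end Gluing

section SumExponents

variable {ι κ : Type*} [Fintype ι] [Fintype κ] [DecidableEq ι] [DecidableEq κ]

/-- The exponent vector supported on the left variables. -/
noncomputable def leftExp (x : ι → ℕ) : ι ⊕ κ →₀ ℕ := Finsupp.equivFunOnFinite.symm (Sum.elim x 0)

/-- The exponent vector supported on the right variables. -/
noncomputable def rightExp (y : κ → ℕ) : ι ⊕ κ →₀ ℕ := Finsupp.equivFunOnFinite.symm (Sum.elim 0 y)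

omit [DecidableEq ι] [DecidableEq κ]

@[simp] theorem leftExp_inl (x : ι → ℕ) (i : ι) : (leftExp x : ι ⊕ κ →₀ ℕ) (Sum.inl i) = x i := rfl

@[simp] theorem leftExp_inr (x : ι → ℕ) (j : κ) : (leftExp x : ι ⊕ κ →₀ ℕ) (Sum.inr j) = 0 := rfl

@[simp] theorem rightExp_inl (y : κ → ℕ) (i : ι) : (rightExp y : ι ⊕ κ →₀ ℕ) (Sum.inl i) = 0 := rfl

@[simp] theorem rightExp_inr (y : κ → ℕ) (j : κ) : (rightExp y : ι ⊕ κ →₀ ℕ) (Sum.inr j) = y j :=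
  rfl

theorem leftExp_injective : Function.Injective (leftExp : (ι → ℕ) → ι ⊕ κ →₀ ℕ) := by
  intro x x' h
  funext i
  simpa using DFunLike.congr_fun h (Sum.inl i)

theorem rightExp_injective : Function.Injective (rightExp : (κ → ℕ) → ι ⊕ κ →₀ ℕ) := by
  intro x x' h
  funext i
  simpa using DFunLike.congr_fun h (Sum.inr i)

theorem degree_leftExp (x : ι → ℕ) : (leftExp x : ι ⊕ κ →₀ ℕ).degree = ∑ i, x i := by
  simp [Finsupp.degree_eq_sum]

theorem degree_rightExp (y : κ → ℕ) : (rightExp y : ι ⊕ κ →₀ ℕ).degree = ∑ j, y j := by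
  simp [Finsupp.degree_eq_sum]

@[simp] theorem leftExp_zero : (leftExp 0 : ι ⊕ κ →₀ ℕ) = 0 := by
  ext (i | j) <;> simp

@[simp] theorem rightExp_zero : (rightExp 0 : ι ⊕ κ →₀ ℕ) = 0 := by
  ext (i | j) <;> simp

theorem leftExp_add_single [DecidableEq ι] (x : ι → ℕ) (i : ι) :
    (leftExp x : ι ⊕ κ →₀ ℕ) + Finsupp.single (Sum.inl i) 1 = leftExp (x + Pi.single i 1) := by
  classical
  ext (i' | j)
  · simp [Finsupp.single_apply, Pi.single_apply, eq_comm]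
  · simp

theorem rightExp_add_single [DecidableEq κ] (y : κ → ℕ) (j : κ) :
    (rightExp y : ι ⊕ κ →₀ ℕ) + Finsupp.single (Sum.inr j) 1 = rightExp (y + Pi.single j 1) := by
  classical
  ext (i | j')
  · simp
  · simp [Finsupp.single_apply, Pi.single_apply, eq_comm]

/-- The exponents of the monomials in the wedge of two boxes. -/
def IsWedgeExp (c : ι → ℕ) (c' : κ → ℕ) (u : ι ⊕ κ →₀ ℕ) : Prop :=
  (∃ x ≤ c, u = leftExp x) ∨ ∃ y ≤ c', u = rightExp y

end SumExponents

/-! ### From an ideal to a gluing of boxes. -/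

section GluingOfIdeal

attribute [local instance] MvPolynomial.gradedAlgebra

variable {ι κ : Type*} [Fintype ι] [Fintype κ] [DecidableEq ι] [DecidableEq κ]

theorem eq_of_le_of_sum_eq {τ : Type*} [Fintype τ] {e : τ → ℕ} {D : ℕ} (he : ∑ i, e i ≤ D)
    (x : τ → ℕ) (hx : x ≤ e) (hxD : ∑ i, x i = D) : x = e := by
  have h1 : ∑ i, x i ≤ ∑ i, e i := Finset.sum_le_sum fun i _ => hx i
  funext i
  exact (Finset.sum_eq_sum_iff_of_le fun i _ => hx i).1 (by omega) i (Finset.mem_univ i)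

/-- Two facts about the ideal suffice: which monomials survive, and that distinct surviving
monomials can become equal only in degree `D`. In that degree each box contains at most its maximum,
so both boxes still embed. -/
theorem isGluing_of_ideal {K : Type*} [Field K] {I : Ideal (MvPolynomial (ι ⊕ κ) K)}
    (hI : I.IsHomogeneous (homogeneousSubmodule (ι ⊕ κ) K)) (h0 : monomial 0 (1 : K) ∉ I)
    {c : ι → ℕ} {c' : κ → ℕ} {D : ℕ}
    (hmem : ∀ u, monomial u (1 : K) ∉ I ↔ IsWedgeExp c c' u)
    (hsub : ∀ u v, IsWedgeExp c c' u → IsWedgeExp c c' v → u ≠ v →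
      monomial u (1 : K) - monomial v 1 ∈ I → u.degree = D)
    (hc : ∑ i, c i ≤ D) (hc' : ∑ j, c' j ≤ D) :
    @IsGluing (MonomialPoset I) ι κ (monomialPartialOrder I hI) _ _ _ _ cosetDegree D c c'
      (fun x => monomialCoset h0 (leftExp x)) (fun y => monomialCoset h0 (rightExp y)) := by
  let _ := monomialPartialOrder I hI
  have hl : ∀ x ≤ c, monomial (leftExp x) (1 : K) ∉ I := fun x hx => (hmem _).2 (Or.inl ⟨x, hx, rfl⟩)
  have hr : ∀ y ≤ c', monomial (rightExp y) (1 : K) ∉ I :=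
    fun y hy => (hmem _).2 (Or.inr ⟨y, hy, rfl⟩)
  refine ⟨isRankFunction_cosetDegree hI h0, fun z => ?_, ?_, ?_, ?_, ?_, ?_, ?_, ?_, ?_, ?_⟩
  · obtain ⟨m, hm, rfl⟩ := exists_monomialCoset_eq h0 z
    rcases (hmem m).1 hm with ⟨x, hx, rfl⟩ | ⟨y, hy, rfl⟩
    · exact Or.inl ⟨x, hx, rfl⟩
    · exact Or.inr ⟨y, hy, rfl⟩
  · intro x hx x' hx' h
    by_contra hne
    have hne' : (leftExp x : ι ⊕ κ →₀ ℕ) ≠ leftExp x' := fun h => hne (leftExp_injective h)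
    have h1 := (monomialCoset_eq_iff h0 (hl x hx) (hl x' hx')).1 h
    have h2 := (monomialCoset_eq_iff h0 (hl x' hx') (hl x hx)).1 h.symm
    have h3 := hsub _ _ ((hmem _).1 (hl x hx)) ((hmem _).1 (hl x' hx')) hne' h1
    have h4 := hsub _ _ ((hmem _).1 (hl x' hx')) ((hmem _).1 (hl x hx)) hne'.symm h2
    rw [degree_leftExp] at h3 h4
    exact hne ((eq_of_le_of_sum_eq hc x hx h3).trans (eq_of_le_of_sum_eq hc x' hx' h4).symm)
  · intro x hx x' hx' h
    by_contra hne
    have hne' : (rightExp x : ι ⊕ κ →₀ ℕ) ≠ rightExp x' := fun h => hne (rightExp_injective h)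
    have h1 := (monomialCoset_eq_iff h0 (hr x hx) (hr x' hx')).1 h
    have h2 := (monomialCoset_eq_iff h0 (hr x' hx') (hr x hx)).1 h.symm
    have h3 := hsub _ _ ((hmem _).1 (hr x hx)) ((hmem _).1 (hr x' hx')) hne' h1
    have h4 := hsub _ _ ((hmem _).1 (hr x' hx')) ((hmem _).1 (hr x hx)) hne'.symm h2
    rw [degree_rightExp] at h3 h4
    exact hne ((eq_of_le_of_sum_eq hc' x hx h3).trans (eq_of_le_of_sum_eq hc' x' hx' h4).symm)
  · intro x hx
    rw [cosetDegree_monomialCoset hI h0 (hl x hx), degree_leftExp]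
  · intro y hy
    rw [cosetDegree_monomialCoset hI h0 (hr y hy), degree_rightExp]
  · intro x hx y hy hpos hlt h
    have hne : (leftExp x : ι ⊕ κ →₀ ℕ) ≠ rightExp y := by
      intro h
      have : ∑ i, x i = 0 := Finset.sum_eq_zero fun i _ => by
        simpa using DFunLike.congr_fun h (Sum.inl i)
      omega
    have h1 := hsub _ _ ((hmem _).1 (hl x hx)) ((hmem _).1 (hr y hy)) hne
      ((monomialCoset_eq_iff h0 (hl x hx) (hr y hy)).1 h)
    rw [degree_leftExp] at h1
    omega
  · intro x hx hx0 z
    rw [monomialCoset_covBy_iff hI h0 (hl x hx)]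
    constructor
    · rintro ⟨i | j, hi, rfl⟩
      · rw [leftExp_add_single] at hi ⊢
        refine ⟨i, ?_, rfl⟩
        rcases (hmem _).1 hi with ⟨x', hx', h⟩ | ⟨y, hy, h⟩
        · rwa [leftExp_injective h]
        · have := DFunLike.congr_fun h (Sum.inl i)
          simp at this
      · exfalso
        obtain ⟨k, hk⟩ := Function.ne_iff.1 hx0
        rcases (hmem _).1 hi with ⟨x', hx', h⟩ | ⟨y, hy, h⟩
        · have := DFunLike.congr_fun h (Sum.inr j)
          simp at this
        · have := DFunLike.congr_fun h (Sum.inl k)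
          simp at this
          exact hk this
    · rintro ⟨i, hi, rfl⟩
      exact ⟨Sum.inl i, by rw [leftExp_add_single]; exact hl _ hi, by rw [leftExp_add_single]⟩
  · intro y hy hy0 z
    rw [monomialCoset_covBy_iff hI h0 (hr y hy)]
    constructor
    · rintro ⟨i | j, hi, rfl⟩
      · exfalso
        obtain ⟨k, hk⟩ := Function.ne_iff.1 hy0
        rcases (hmem _).1 hi with ⟨x', hx', h⟩ | ⟨y, hy, h⟩
        · have := DFunLike.congr_fun h (Sum.inr k)
          simp at this
          exact hk this
        · have := DFunLike.congr_fun h (Sum.inl i)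
          simp at this
      · rw [rightExp_add_single] at hi ⊢
        refine ⟨j, ?_, rfl⟩
        rcases (hmem _).1 hi with ⟨x', hx', h⟩ | ⟨y, hy, h⟩
        · have := DFunLike.congr_fun h (Sum.inr j)
          simp at this
        · rwa [rightExp_injective h]
    · rintro ⟨i, hi, rfl⟩
      exact ⟨Sum.inr i, by rw [rightExp_add_single]; exact hr _ hi, by rw [rightExp_add_single]⟩
  · simp
  · intro z hz
    obtain ⟨m, hm, rfl⟩ := exists_monomialCoset_eq h0 z
    rw [cosetDegree_monomialCoset hI h0 hm] at hz
    obtain ⟨i, rfl⟩ : ∃ i, m = Finsupp.single i 1 := by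
      have hm0 : m ≠ 0 := by
        rintro rfl
        simp at hz
      obtain ⟨i, hi⟩ := Finsupp.support_nonempty_iff.2 hm0
      have hle : Finsupp.single i 1 ≤ m := by
        rw [Finsupp.single_le_iff]
        exact Nat.one_le_iff_ne_zero.2 (Finsupp.mem_support_iff.1 hi)
      obtain ⟨t, rfl⟩ := exists_add_of_le hle
      simp only [map_add, Finsupp.degree_single, Nat.add_eq_left] at hz
      exact ⟨i, by rw [(Finsupp.degree_eq_zero_iff t).1 hz, add_zero]⟩
    simp only [leftExp_zero]
    exact (monomialCoset_covBy_iff hI h0 h0 _).2 ⟨i, by rwa [zero_add], by rw [zero_add]⟩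

end GluingOfIdeal

/-! ### The wedge and diamond ideals. -/

section WedgeDiamond

attribute [local instance] MvPolynomial.gradedAlgebra

variable {K : Type*} [Field K] {n m : ℕ}

theorem mem_wedgeIdeal {a : Fin n → ℕ} {b : Fin m → ℕ} {p : MvPolynomial (Fin n ⊕ Fin m) K} :
    p ∈ wedgeIdeal K a b ↔ ∀ u ∈ p.support, (∃ i, a i ≤ u (Sum.inl i)) ∨
      (∃ j, b j ≤ u (Sum.inr j)) ∨ ∃ i j, 1 ≤ u (Sum.inl i) ∧ 1 ≤ u (Sum.inr j) := by
  have h : wedgeIdeal K a b = Ideal.span ((fun s => monomial s (1 : K)) ''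
      ((Set.range fun i => Finsupp.single (Sum.inl i) (a i)) ∪
        (Set.range fun j => Finsupp.single (Sum.inr j) (b j)) ∪
        Set.range fun q : Fin n × Fin m =>
          Finsupp.single (Sum.inl q.1) 1 + Finsupp.single (Sum.inr q.2) 1)) := by
    simp only [wedgeIdeal, Set.image_union, Ideal.span_union, ← Set.range_comp, Function.comp_def,
      X_pow_eq_monomial]
    simp only [X, monomial_mul, one_mul]
  rw [h, mem_ideal_span_monomial_image]
  refine forall₂_congr fun u _ => ?_
  constructor
  · rintro ⟨s, (⟨i, rfl⟩ | ⟨j, rfl⟩) | ⟨⟨i, j⟩, rfl⟩, hs⟩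
    · exact Or.inl ⟨i, by simpa using hs (Sum.inl i)⟩
    · exact Or.inr (Or.inl ⟨j, by simpa using hs (Sum.inr j)⟩)
    · exact Or.inr (Or.inr ⟨i, j, by simpa using hs (Sum.inl i), by simpa using hs (Sum.inr j)⟩)
  · rintro (⟨i, hi⟩ | ⟨j, hj⟩ | ⟨i, j, hi, hj⟩)
    · exact ⟨_, Or.inl (Or.inl ⟨i, rfl⟩), by simpa using hi⟩
    · exact ⟨_, Or.inl (Or.inr ⟨j, rfl⟩), by simpa using hj⟩
    · refine ⟨_, Or.inr ⟨(i, j), rfl⟩, ?_⟩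
      rintro (i' | j')
      · by_cases h : i = i'
        · subst h
          simpa using hi
        · simp [h]
      · by_cases h : j = j'
        · subst h
          simpa using hj
        · simp [h]

theorem isWedgeExp_iff {a : Fin n → ℕ} {b : Fin m → ℕ} (ha : ∀ i, 2 ≤ a i) (hb : ∀ j, 2 ≤ b j)
    (u : Fin n ⊕ Fin m →₀ ℕ) :
    IsWedgeExp (fun i => a i - 1) (fun j => b j - 1) u ↔ ¬ ((∃ i, a i ≤ u (Sum.inl i)) ∨
      (∃ j, b j ≤ u (Sum.inr j)) ∨ ∃ i j, 1 ≤ u (Sum.inl i) ∧ 1 ≤ u (Sum.inr j)) := by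
  constructor
  · rintro (⟨x, hx, rfl⟩ | ⟨x, hx, rfl⟩) (⟨i, h⟩ | ⟨i, h⟩ | ⟨i, j, h, h'⟩)
    · have h1 := hx i
      have h2 := ha i
      simp at h h1
      omega
    · have h2 := hb i
      simp at h
      omega
    · simp at h'
    · have h2 := ha i
      simp at h
      omega
    · have h1 := hx i
      have h2 := hb i
      simp at h h1
      omega
    · simp at h
  · intro h
    push Not at h
    obtain ⟨h1, h2, h3⟩ := h
    by_cases hex : ∃ i, 1 ≤ u (Sum.inl i)
    · obtain ⟨i, hi⟩ := hex
      refine Or.inl ⟨fun i => u (Sum.inl i), fun i => ?_, ?_⟩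
      · have := h1 i
        dsimp only
        omega
      · ext (i' | j)
        · rfl
        · have := h3 i j hi
          simp
          omega
    · push Not at hex
      refine Or.inr ⟨fun j => u (Sum.inr j), fun j => ?_, ?_⟩
      · have := h2 j
        dsimp only
        omega
      · ext (i | j)
        · have := hex i
          simp
          omega
        · rfl

theorem monomial_notMem_wedgeIdeal {a : Fin n → ℕ} {b : Fin m → ℕ} (ha : ∀ i, 2 ≤ a i)
    (hb : ∀ j, 2 ≤ b j) (u : Fin n ⊕ Fin m →₀ ℕ) : monomial u (1 : K) ∉ wedgeIdeal K a b ↔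
      IsWedgeExp (fun i => a i - 1) (fun j => b j - 1) u := by
  classical
  rw [isWedgeExp_iff ha hb, mem_wedgeIdeal, support_monomial, if_neg one_ne_zero]
  simp only [Finset.mem_singleton, forall_eq]

theorem isHomogeneous_span_of_forall {σ : Type*} {s : Set (MvPolynomial σ K)}
    (h : ∀ p ∈ s, ∃ d, p.IsHomogeneous d) :
    (Ideal.span s).IsHomogeneous (homogeneousSubmodule σ K) :=
  Ideal.homogeneous_span _ _ h

theorem isHomogeneous_wedgeIdeal (a : Fin n → ℕ) (b : Fin m → ℕ) :
    (wedgeIdeal K a b).IsHomogeneous (homogeneousSubmodule (Fin n ⊕ Fin m) K) := by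
  refine ((isHomogeneous_span_of_forall ?_).sup (isHomogeneous_span_of_forall ?_)).sup
    (isHomogeneous_span_of_forall ?_)
  · rintro _ ⟨i, rfl⟩
    exact ⟨_, isHomogeneous_X_pow _ _⟩
  · rintro _ ⟨i, rfl⟩
    exact ⟨_, isHomogeneous_X_pow _ _⟩
  · rintro _ ⟨i, rfl⟩
    exact ⟨_, (isHomogeneous_X _ _).mul (isHomogeneous_X _ _)⟩

theorem isWedgeExp_zero {ι κ : Type*} [Fintype ι] [Fintype κ] (c : ι → ℕ) (c' : κ → ℕ) :
    IsWedgeExp c c' 0 :=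
  Or.inl ⟨0, fun _ => Nat.zero_le _, leftExp_zero.symm⟩

theorem exists_isGluing_wedgeIdeal {a : Fin n → ℕ} {b : Fin m → ℕ} (ha : ∀ i, 2 ≤ a i)
    (hb : ∀ j, 2 ≤ b j) {D : ℕ} (hD : ∑ i, (a i - 1) ≤ D) (hD' : ∑ j, (b j - 1) ≤ D) :
    ∃ (r : MonomialPoset (wedgeIdeal K a b) → ℕ) (f : (Fin n → ℕ) → _) (g : (Fin m → ℕ) → _),
      @IsGluing _ _ _ (monomialPartialOrder _ (isHomogeneous_wedgeIdeal a b)) _ _ _ _ r D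
        (fun i => a i - 1) (fun j => b j - 1) f g := by
  have hmem := monomial_notMem_wedgeIdeal (K := K) ha hb
  refine ⟨_, _, _, isGluing_of_ideal (isHomogeneous_wedgeIdeal a b)
    ((hmem 0).2 (isWedgeExp_zero _ _)) hmem ?_ hD hD'⟩
  intro u v hu hv huv h
  exfalso
  rw [isWedgeExp_iff ha hb] at hu
  refine hu (mem_wedgeIdeal.1 h u ?_)
  simp [huv.symm, coeff_monomial]

theorem diamond_generator_eq (a : Fin n → ℕ) (b : Fin m → ℕ) :
    (∏ i, X (Sum.inl i) ^ (a i - 1)) - ∏ j, X (Sum.inr j) ^ (b j - 1) =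
      monomial (leftExp fun i => a i - 1) (1 : K) - monomial (rightExp fun j => b j - 1) 1 := by
  have h1 : ∀ u : Fin n ⊕ Fin m →₀ ℕ, monomial u (1 : K) = ∏ k, X k ^ u k := by
    intro u
    rw [monomial_eq, C_1, one_mul, Finsupp.prod_fintype _ _ fun _ => pow_zero _]
  rw [h1, h1, Fintype.prod_sum_type, Fintype.prod_sum_type]
  simp

theorem isHomogeneous_diamondIdeal {a : Fin n → ℕ} {b : Fin m → ℕ}
    (h : ∑ i, (a i - 1) = ∑ j, (b j - 1)) :
    (diamondIdeal K a b).IsHomogeneous (homogeneousSubmodule (Fin n ⊕ Fin m) K) := by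
  refine (isHomogeneous_wedgeIdeal a b).sup (isHomogeneous_span_of_forall ?_)
  rintro _ rfl
  refine ⟨∑ i, (a i - 1), ?_⟩
  rw [diamond_generator_eq]
  refine (isHomogeneous_monomial _ ?_).sub (isHomogeneous_monomial _ ?_)
  · rw [degree_leftExp]
  · rw [degree_rightExp, h]

/-- The wedge part contributes nothing at surviving exponents. In a multiple of the socle difference
only the constant term of the multiplier counts there, since the socle monomials divide no other
surviving monomial. So, seen on surviving monomials, the ideal is spanned by that single difference.
-/
theorem coeff_of_mem_diamondIdeal {a : Fin n → ℕ} {b : Fin m → ℕ} (ha : ∀ i, 2 ≤ a i)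
    (hb : ∀ j, 2 ≤ b j) (h : ∑ i, (a i - 1) = ∑ j, (b j - 1)) {p : MvPolynomial (Fin n ⊕ Fin m) K}
    (hp : p ∈ diamondIdeal K a b) :
    ∃ k : K, ∀ u, IsWedgeExp (fun i => a i - 1) (fun j => b j - 1) u →
      coeff u p = k * ((if u = leftExp (fun i => a i - 1) then 1 else 0) -
        (if u = rightExp (fun j => b j - 1) then 1 else 0)) := by
  rw [diamondIdeal, Submodule.mem_sup] at hp
  obtain ⟨w, hw, q, hq, rfl⟩ := hp
  rw [Ideal.mem_span_singleton', diamond_generator_eq] at hq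
  obtain ⟨t, rfl⟩ := hq
  refine ⟨coeff 0 t, fun u hu => ?_⟩
  have hw0 : coeff u w = 0 := by
    by_contra hne
    exact (isWedgeExp_iff ha hb u).1 hu (mem_wedgeIdeal.1 hw u (mem_support_iff.2 hne))
  have hzero : (n = 0 ∨ m = 0) → n = 0 ∧ m = 0 := by
    have hn : n ≤ ∑ i, (a i - 1) := by
      calc n = ∑ _i : Fin n, 1 := by simp
        _ ≤ _ := Finset.sum_le_sum fun i _ => by have := ha i; omega
    have hm : m ≤ ∑ j, (b j - 1) := by
      calc m = ∑ _i : Fin m, 1 := by simp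
        _ ≤ _ := Finset.sum_le_sum fun i _ => by have := hb i; omega
    rintro (rfl | rfl)
    · simp at h
      exact ⟨rfl, by simpa [← h] using hm⟩
    · simp at h
      exact ⟨by simpa [h] using hn, rfl⟩
  -- Without variables on one side the equality of socle degrees removes them on the other side too;
  -- both socle monomials are then `1` and the generator vanishes.
  by_cases hn : n = 0 ∨ m = 0
  · obtain ⟨rfl, rfl⟩ := hzero hn
    have : ∀ v : Fin 0 ⊕ Fin 0 →₀ ℕ, v = u := fun v => Subsingleton.elim _ _
    rw [coeff_add, hw0, this (leftExp _), this (rightExp _), sub_self, mul_zero]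
    simp
  push Not at hn
  have hleft : leftExp (fun i => a i - 1) ≤ u ↔ u = leftExp (fun i => a i - 1) := by
    refine ⟨fun hle => ?_, fun h => h.ge⟩
    have h1 := hle (Sum.inl ⟨0, Nat.pos_of_ne_zero hn.1⟩)
    have h2 := ha ⟨0, Nat.pos_of_ne_zero hn.1⟩
    rw [leftExp_inl] at h1
    rcases hu with ⟨x, hx, rfl⟩ | ⟨y, hy, rfl⟩
    · congr 1
      exact le_antisymm hx fun i => by simpa using hle (Sum.inl i)
    · rw [rightExp_inl] at h1
      omega
  have hright : rightExp (fun j => b j - 1) ≤ u ↔ u = rightExp (fun j => b j - 1) := by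
    refine ⟨fun hle => ?_, fun h => h.ge⟩
    have h1 := hle (Sum.inr ⟨0, Nat.pos_of_ne_zero hn.2⟩)
    have h2 := hb ⟨0, Nat.pos_of_ne_zero hn.2⟩
    rw [rightExp_inr] at h1
    rcases hu with ⟨x, hx, rfl⟩ | ⟨y, hy, rfl⟩
    · rw [leftExp_inr] at h1
      omega
    · congr 1
      exact le_antisymm hy fun i => by simpa using hle (Sum.inr i)
  rw [coeff_add, hw0, zero_add, mul_sub, coeff_sub, coeff_mul_monomial', coeff_mul_monomial',
    mul_sub]
  simp only [hleft, hright, mul_one]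
  congr 1
  · split_ifs with h1
    · rw [h1, tsub_self, mul_one]
    · rw [mul_zero]
  · split_ifs with h1
    · rw [h1, tsub_self, mul_one]
    · rw [mul_zero]

/-- A monomial, or a difference of two monomials, in the ideal must have coefficients proportional
to those of the socle difference on surviving exponents. Hence no further monomial dies, and only
the two socle monomials are identified. -/
theorem exists_isGluing_diamondIdeal {a : Fin n → ℕ} {b : Fin m → ℕ} (ha : ∀ i, 2 ≤ a i)
    (hb : ∀ j, 2 ≤ b j) (h : ∑ i, (a i - 1) = ∑ j, (b j - 1)) :
    ∃ (r : MonomialPoset (diamondIdeal K a b) → ℕ) (f : (Fin n → ℕ) → _) (g : (Fin m → ℕ) → _),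
      @IsGluing _ _ _ (monomialPartialOrder _ (isHomogeneous_diamondIdeal h)) _ _ _ _ r
        (∑ i, (a i - 1)) (fun i => a i - 1) (fun j => b j - 1) f g ∧
      f (fun i => a i - 1) = g (fun j => b j - 1) := by
  have hL : IsWedgeExp (fun i => a i - 1) (fun j => b j - 1) (leftExp fun i => a i - 1) :=
    Or.inl ⟨_, le_rfl, rfl⟩
  have hR : IsWedgeExp (fun i => a i - 1) (fun j => b j - 1) (rightExp fun j => b j - 1) :=
    Or.inr ⟨_, le_rfl, rfl⟩
  have hmem : ∀ u, monomial u (1 : K) ∉ diamondIdeal K a b ↔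
      IsWedgeExp (fun i => a i - 1) (fun j => b j - 1) u := by
    intro u
    constructor
    · intro hu
      rw [← monomial_notMem_wedgeIdeal (K := K) ha hb]
      exact fun hu' => hu (Ideal.mem_sup_left hu')
    · intro hu hu'
      obtain ⟨k, hk⟩ := coeff_of_mem_diamondIdeal ha hb h hu'
      have h1 := hk u hu
      have h2 := hk _ hL
      have h3 := hk _ hR
      simp only [coeff_monomial] at h1 h2 h3
      by_cases e1 : u = leftExp (fun i => a i - 1) <;>
        by_cases e2 : u = rightExp (fun j => b j - 1)
      · simp [← e1, ← e2] at h1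
      · simp only [← e1, e2, if_true, if_false, sub_zero, mul_one, Ne.symm e2, zero_sub] at h1 h3
        rw [← h1] at h3
        simp at h3
      · simp only [← e2, e1, if_true, if_false, sub_zero, mul_one, Ne.symm e1, zero_sub] at h1 h2
        rw [← h2] at h1
        simp at h1
      · simp [e1, e2] at h1
  have h0 := (hmem 0).2 (isWedgeExp_zero _ _)
  refine ⟨_, _, _, isGluing_of_ideal (isHomogeneous_diamondIdeal h) h0 hmem ?_ le_rfl h.ge, ?_⟩
  · intro u v hu hv huv hsub
    obtain ⟨k, hk⟩ := coeff_of_mem_diamondIdeal ha hb h hsub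
    have h1 := hk u hu
    simp only [coeff_sub, coeff_monomial, if_true, if_neg huv.symm] at h1
    by_cases e1 : u = leftExp (fun i => a i - 1)
    · rw [e1, degree_leftExp]
    · by_cases e2 : u = rightExp (fun j => b j - 1)
      · rw [e2, degree_rightExp, h]
      · simp [e1, e2] at h1
  · rw [monomialCoset_eq_iff h0 ((hmem _).2 hL) ((hmem _).2 hR), ← diamond_generator_eq]
    exact Ideal.mem_sup_right (Ideal.subset_span rfl)

end WedgeDiamond


/-! ### Sufficiency for the diamond: boxes with the same side lengths. -/

section GluingSufficiency

variable {P ι κ : Type*} [PartialOrder P] [Fintype ι] [Fintype κ] [DecidableEq ι]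
  [DecidableEq κ] {r : P → ℕ} {D : ℕ} {c : ι → ℕ} {c' : κ → ℕ} {f : (ι → ℕ) → P}
  {g : (κ → ℕ) → P}

/-- Extend functions on the two boxes to a function on their gluing. -/
noncomputable def gluingCode {β : Type*} (c : ι → ℕ) (c' : κ → ℕ) (f : (ι → ℕ) → P)
    (g : (κ → ℕ) → P) (α : (ι → ℕ) → β) (α' : (κ → ℕ) → β) (z : P) : β :=
  open Classical in
  if h : ∃ x ≤ c, f x = z then α h.choose else
    if h' : ∃ y ≤ c', g y = z then α' h'.choose else α 0

namespace IsGluing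

variable (h : IsGluing r D c c' f g)
include h

theorem code_f {β : Type*} (α : (ι → ℕ) → β) (α' : (κ → ℕ) → β) {x : ι → ℕ} (hx : x ≤ c) :
    gluingCode c c' f g α α' (f x) = α x := by
  have hex : ∃ x' ≤ c, f x' = f x := ⟨x, hx, rfl⟩
  rw [gluingCode, dif_pos hex, h.f_inj _ hex.choose_spec.1 x hx hex.choose_spec.2]

theorem code_g {β : Type*} (α : (ι → ℕ) → β) (α' : (κ → ℕ) → β) {y : κ → ℕ} (hy : y ≤ c')
    (h1 : 0 < ∑ j, y j) (h2 : ∑ j, y j < D) : gluingCode c c' f g α α' (g y) = α' y := by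
  have hex : ∃ y' ≤ c', g y' = g y := ⟨y, hy, rfl⟩
  have hnex : ¬ ∃ x ≤ c, f x = g y := by
    rintro ⟨x, hx, e⟩
    have := congrArg r e
    rw [h.f_rank x hx, h.g_rank y hy] at this
    exact h.disj x hx y hy (by omega) (by omega) e
  rw [gluingCode, dif_neg hnex, dif_pos hex, h.g_inj _ hex.choose_spec.1 y hy hex.choose_spec.2]

theorem full_zero {A : Set P} (hA : A ⊆ level r 0) (hne : A.Nonempty) :
    upperShadow A = level r (0 + 1) := by
  refine (upperShadow_subset_level h.rank hA).antisymm fun z hz => ?_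
  obtain ⟨a, ha⟩ := hne
  have hr : r a = 0 := hA ha
  refine ⟨a, ha, ?_⟩
  have : a = f 0 := by
    rcases h.surj a with ⟨x, hx, rfl⟩ | ⟨y, hy, rfl⟩
    · rw [h.f_rank x hx, Finset.sum_eq_zero_iff] at hr
      congr 1
      exact funext fun i => hr i (Finset.mem_univ i)
    · rw [h.g_rank y hy, Finset.sum_eq_zero_iff] at hr
      rw [h.f_zero]
      congr 1
      exact funext fun i => hr i (Finset.mem_univ i)
  rw [this]
  exact h.bot_cov z hz

theorem rank_le (hD : ∑ i, c i ≤ D) (hD' : ∑ j, c' j ≤ D) (z : P) : r z ≤ D := by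
  rcases h.surj z with ⟨x, hx, rfl⟩ | ⟨y, hy, rfl⟩
  · rw [h.f_rank x hx]
    exact (Finset.sum_le_sum fun i _ => hx i).trans hD
  · rw [h.g_rank y hy]
    exact (Finset.sum_le_sum fun i _ => hy i).trans hD'

theorem eq_top (hD : ∑ i, c i = D) (hD' : ∑ j, c' j = D) (htop : f c = g c') {z : P}
    (hz : r z = D) : z = f c := by
  rcases h.surj z with ⟨x, hx, rfl⟩ | ⟨y, hy, rfl⟩
  · rw [h.f_rank x hx] at hz
    rw [eq_of_le_of_sum_eq hD.le x hx hz]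
  · rw [h.g_rank y hy] at hz
    rw [eq_of_le_of_sum_eq hD'.le y hy hz, htop]

omit [DecidableEq ι] [DecidableEq κ] h [PartialOrder P] [Fintype κ] in
theorem _root_.exists_add_single_le [DecidableEq ι] {x c : ι → ℕ} (hx : x ≤ c)
    (hlt : ∑ i, x i < ∑ i, c i) :
    ∃ i, x + Pi.single i 1 ≤ c := by
  obtain ⟨i, -, hi⟩ := Finset.exists_lt_of_sum_lt hlt
  refine ⟨i, fun j => ?_⟩
  by_cases hj : j = i
  · subst hj
    simpa using hi
  · simpa [hj] using hx j

/-- The bottom is covered by all atoms, and the top covers every coatom. So outside the middle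
levels any nonempty set has full shadow. -/
theorem full_of_not_mid (hD : ∑ i, c i = D) (hD' : ∑ j, c' j = D) (htop : f c = g c') {d : ℕ}
    (hd : ¬ (0 < d ∧ d + 1 < D)) {A : Set P} (hA : A ⊆ level r d) (hne : A.Nonempty) :
    upperShadow A = level r (d + 1) := by
  rcases Nat.eq_zero_or_pos d with rfl | hpos
  · exact h.full_zero hA hne
  refine (upperShadow_subset_level h.rank hA).antisymm fun z hz => ?_
  have hzr : r z = d + 1 := hz
  have hle := h.rank_le hD.le hD'.le z
  have hdD : d + 1 = D := by omega
  rw [h.eq_top hD hD' htop (hzr.trans hdD)]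
  obtain ⟨a, ha⟩ := hne
  have har : r a = d := hA ha
  refine ⟨a, ha, ?_⟩
  rcases h.surj a with ⟨x, hx, rfl⟩ | ⟨y, hy, rfl⟩
  · have h1 := har
    rw [h.f_rank x hx] at h1
    have hx0 : x ≠ 0 := by
      rintro rfl
      simp at h1
      omega
    obtain ⟨i, hi⟩ := exists_add_single_le hx (by omega)
    have hcov := (h.f_cov x hx hx0 _).2 ⟨i, hi, rfl⟩
    rwa [h.eq_top hD hD' htop (z := f (x + Pi.single i 1))
      (by rw [h.rank.covBy _ _ hcov]; omega)] at hcov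
  · have h1 := har
    rw [h.g_rank y hy] at h1
    have hx0 : y ≠ 0 := by
      rintro rfl
      simp at h1
      omega
    obtain ⟨i, hi⟩ := exists_add_single_le hy (by omega)
    have hcov := (h.g_cov y hy hx0 _).2 ⟨i, hi, rfl⟩
    rwa [h.eq_top hD hD' htop (z := g (y + Pi.single i 1))
      (by rw [h.rank.covBy _ _ hcov]; omega)] at hcov

end IsGluing

section TwoCopies

variable {n : ℕ}

/-- The vector `(s, t, w)`. -/
def consTwo (s t : ℕ) (w : Fin n → ℕ) : Fin (n + 2) → ℕ := Fin.cons s (Fin.cons t w)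

@[simp] theorem consTwo_zero (s t : ℕ) (w : Fin n → ℕ) : consTwo s t w 0 = s := rfl

@[simp] theorem consTwo_one (s t : ℕ) (w : Fin n → ℕ) : consTwo s t w 1 = t := rfl

@[simp] theorem consTwo_succ (s t : ℕ) (w : Fin n → ℕ) (i : Fin n) :
    consTwo s t w i.succ.succ = w i := rfl

theorem forall_fin_add_two {p : Fin (n + 2) → Prop} :
    (∀ i, p i) ↔ p 0 ∧ p 1 ∧ ∀ i : Fin n, p i.succ.succ := by
  rw [Fin.forall_fin_succ, Fin.forall_fin_succ]
  rfl

theorem sum_consTwo (s t : ℕ) (w : Fin n → ℕ) : ∑ i, consTwo s t w i = s + (t + ∑ i, w i) := by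
  rw [Fin.sum_univ_succ, Fin.sum_univ_succ]
  rfl

theorem eq_consTwo (w : Fin (n + 2) → ℕ) : w = consTwo (w 0) (w 1) fun i => w i.succ.succ := by
  funext i
  revert i
  rw [forall_fin_add_two]
  exact ⟨rfl, rfl, fun _ => rfl⟩

theorem consTwo_injective {s t s' t' : ℕ} {w w' : Fin n → ℕ} (h : consTwo s t w = consTwo s' t' w') :
    s = s' ∧ t = t' ∧ w = w' :=
  ⟨congrFun h 0, congrFun h 1, funext fun i => congrFun h i.succ.succ⟩

theorem consTwo_add_single (s t : ℕ) (w : Fin n → ℕ) (i : Fin n) :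
    consTwo s t w + Pi.single i.succ.succ 1 = consTwo s t (w + Pi.single i 1) := by
  funext j
  revert j
  rw [forall_fin_add_two]
  refine ⟨?_, ?_, fun j => ?_⟩
  · simp [(Fin.succ_ne_zero _).symm]
  · have : (1 : Fin (n + 2)) ≠ i.succ.succ := by
      rw [← Fin.succ_zero_eq_one, Ne, Fin.succ_inj]
      exact (Fin.succ_ne_zero _).symm
    simp [this]
  · simp [Pi.single_apply]

/-- The elements `(1, 1, w)` of a level of the box below `(1, 1, k)`. -/
def topBlock (k : Fin n → ℕ) (d : ℕ) : Finset (Fin (n + 2) → ℕ) :=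
  (boxLevel 0 (consTwo 1 1 k) d).filter fun w => w 0 = 1 ∧ w 1 = 1

theorem mem_boxLevel_consTwo {k : Fin n → ℕ} {d s t : ℕ} {w : Fin n → ℕ} :
    consTwo s t w ∈ boxLevel 0 (consTwo 1 1 k) d ↔
      s ≤ 1 ∧ t ≤ 1 ∧ w ≤ k ∧ s + (t + ∑ i, w i) = d := by
  rw [mem_boxLevel, sum_consTwo, forall_fin_add_two]
  simp [Pi.le_def, and_assoc]

variable {m : ℕ} {r : P → ℕ} {D : ℕ} {c : Fin n → ℕ} {c' : Fin m → ℕ} {f : (Fin n → ℕ) → P}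
  {g : (Fin m → ℕ) → P}

/-- Two boxes with the same side lengths, glued at top and bottom, form a Macaulay poset. -/
theorem IsGluing.isMacaulayPoset_of_equiv (h : IsGluing r D c c' f g) (hD : ∑ i, c i = D)
    (htop : f c = g c') (hc : ∀ i, 1 ≤ c i) (e : Fin n ≃ Fin m) (he : ∀ i, c' (e i) = c i) :
    IsMacaulayPoset P := by
  classical
  have hfin := h.finite
  have := Fintype.ofFinite P
  have hD' : ∑ j, c' j = D := by
    rw [← hD, ← Equiv.sum_comp e]
    exact Finset.sum_congr rfl fun i _ => he i
  set σ := Tuple.sort c with hσ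
  set k := c ∘ σ with hk
  have hkmono : Monotone k := Tuple.monotone_sort c
  have hkc' : ∀ i, c' ((σ.trans e) i) = k i := fun i => he _
  -- The two binary coordinates record the box. Sorting by `σ` makes the widths increase, as
  -- Clements–Lindström requires; the binary coordinates have width one and may come first because
  -- all sides are at least one. The coordinate sum exceeds the rank by one.
  set φ : P → (Fin (n + 2) → ℕ) := gluingCode c c' f g (fun x => consTwo 1 0 (x ∘ σ))
    (fun y => consTwo 0 1 (y ∘ (σ.trans e))) with hφ
  have hφf : ∀ x ≤ c, φ (f x) = consTwo 1 0 (x ∘ σ) := fun x hx => h.code_f _ _ hx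
  have hφg : ∀ y ≤ c', 0 < ∑ j, y j → ∑ j, y j < D → φ (g y) = consTwo 0 1 (y ∘ (σ.trans e)) :=
    fun y hy h1 h2 => h.code_g _ _ hy h1 h2
  have hsumσ : ∀ x : Fin n → ℕ, ∑ i, (x ∘ σ) i = ∑ i, x i := fun x => Equiv.sum_comp σ x
  have hsumσ' : ∀ y : Fin m → ℕ, ∑ i, (y ∘ (σ.trans e)) i = ∑ i, y i :=
    fun y => Equiv.sum_comp (σ.trans e) y
  have hcase : ∀ z, 0 < r z → r z < D →
      (∃ x ≤ c, f x = z ∧ φ z = consTwo 1 0 (x ∘ σ) ∧ ∑ i, x i = r z) ∨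
      ∃ y ≤ c', g y = z ∧ φ z = consTwo 0 1 (y ∘ (σ.trans e)) ∧ ∑ j, y j = r z := by
    intro z h1 h2
    rcases h.surj z with ⟨x, hx, rfl⟩ | ⟨y, hy, rfl⟩
    · exact Or.inl ⟨x, hx, rfl, hφf x hx, (h.f_rank x hx).symm⟩
    · have hr := h.g_rank y hy
      exact Or.inr ⟨y, hy, rfl, hφg y hy (by omega) (by omega), hr.symm⟩
  have hφmem : ∀ z, 0 < r z → r z < D → φ z ∈ boxLevel 0 (consTwo 1 1 k) (r z + 1) ∧
      φ z 0 + φ z 1 = 1 := by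
    intro z h1 h2
    rcases hcase z h1 h2 with ⟨x, hx, -, h3, h4⟩ | ⟨y, hy, -, h3, h4⟩
    · rw [h3, mem_boxLevel_consTwo, hsumσ]
      refine ⟨⟨le_rfl, by omega, fun i => hx _, by omega⟩, by simp⟩
    · rw [h3, mem_boxLevel_consTwo, hsumσ']
      refine ⟨⟨by omega, le_rfl, fun i => ?_, by omega⟩, by simp⟩
      rw [← hkc']
      exact hy _
  have hφsurj : ∀ d, 0 < d → d < D → ∀ w ∈ boxLevel 0 (consTwo 1 1 k) (d + 1), w 0 + w 1 = 1 →
      ∃ z, r z = d ∧ φ z = w := by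
    intro d h1 h2 w hw hw1
    rw [eq_consTwo w, mem_boxLevel_consTwo] at hw
    obtain ⟨-, -, h5, h6⟩ := hw
    set v : Fin n → ℕ := fun i => w i.succ.succ with hv
    have h7 : w 0 + (w 1 + ∑ i, v i) = d + 1 := h6
    rcases (by omega : (w 0 = 1 ∧ w 1 = 0) ∨ (w 0 = 0 ∧ w 1 = 1)) with ⟨h3, h4⟩ | ⟨h3, h4⟩
    · have hle : v ∘ σ.symm ≤ c := fun i => by simpa [hk] using h5 (σ.symm i)
      have hs : ∑ i, (v ∘ σ.symm) i = d := (Equiv.sum_comp σ.symm v).trans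
        (show ∑ i, v i = d by omega)
      refine ⟨f (v ∘ σ.symm), by rw [h.f_rank _ hle, hs], ?_⟩
      rw [hφf _ hle, eq_consTwo w, h3, h4]
      congr 1
      funext i
      simp [hv]
    · have hle : v ∘ (σ.trans e).symm ≤ c' := fun i => by
        have := h5 ((σ.trans e).symm i)
        rwa [← hkc', Equiv.apply_symm_apply] at this
      have hs : ∑ i, (v ∘ (σ.trans e).symm) i = d :=
        (Equiv.sum_comp (σ.trans e).symm v).trans (show ∑ i, v i = d by omega)
      refine ⟨g (v ∘ (σ.trans e).symm), by rw [h.g_rank _ hle, hs], ?_⟩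
      rw [hφg _ hle (by omega) (by omega), eq_consTwo w, h3, h4]
      congr 1
      funext i
      simp [hv]
  have hφinj : ∀ z w, r z = r w → 0 < r z → r z < D → φ z = φ w → z = w := by
    intro z w hzw h1 h2 hφzw
    rcases hcase z h1 h2 with ⟨x, hx, rfl, h3, h4⟩ | ⟨x, hx, rfl, h3, h4⟩ <;>
      rcases hcase w (by omega) (by omega) with ⟨y, hy, rfl, h5, h6⟩ | ⟨y, hy, rfl, h5, h6⟩
    · rw [h3, h5] at hφzw
      have := (consTwo_injective hφzw).2.2
      rw [σ.surjective.injective_comp_right this]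
    · rw [h3, h5] at hφzw
      exact absurd (consTwo_injective hφzw).1 one_ne_zero
    · rw [h3, h5] at hφzw
      exact absurd (consTwo_injective hφzw).1 zero_ne_one
    · rw [h3, h5] at hφzw
      have := (consTwo_injective hφzw).2.2
      rw [(σ.trans e).surjective.injective_comp_right this]
  have hcov : ∀ z w, 0 < r z → r z + 1 < D → (z ⋖ w ↔ r w = r z + 1 ∧
      ∃ i, φ z + Pi.single i 1 = φ w) := by
    intro z w h1 h2
    constructor
    · intro hzw
      refine ⟨h.rank.covBy _ _ hzw, ?_⟩
      rcases hcase z h1 (by omega) with ⟨x, hx, rfl, h3, h4⟩ | ⟨x, hx, rfl, h3, h4⟩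
      · obtain ⟨i, hi, rfl⟩ := (h.f_cov x hx (by rintro rfl; simp at h4; omega) w).1 hzw
        refine ⟨(σ.symm i).succ.succ, ?_⟩
        rw [h3, hφf _ hi, consTwo_add_single]
        congr 1
        funext j
        simp [Pi.single_apply, Equiv.eq_symm_apply]
      · obtain ⟨i, hi, rfl⟩ := (h.g_cov x hx (by rintro rfl; simp at h4; omega) w).1 hzw
        refine ⟨((σ.trans e).symm i).succ.succ, ?_⟩
        have hs : ∑ j, (x + Pi.single i 1 : Fin m → ℕ) j = r (g x) + 1 := by
          rw [sum_add_single, h4]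
        rw [h3, hφg _ hi (by omega) (by omega), consTwo_add_single]
        congr 1
        funext j
        simp only [Pi.single_apply, Pi.add_apply, Function.comp_apply, Equiv.eq_symm_apply]
    · rintro ⟨hrw, i, hi⟩
      have hz1 := (hφmem z h1 (by omega)).2
      have hw1 := (hφmem w (by omega) (by omega)).2
      revert i
      rw [forall_fin_add_two]
      refine ⟨fun hi => ?_, fun hi => ?_, fun i hi => ?_⟩
      · rw [← hi] at hw1
        simp at hw1
        omega
      · rw [← hi] at hw1
        simp at hw1
        omega
      rcases hcase z h1 (by omega) with ⟨x, hx, rfl, h3, h4⟩ | ⟨x, hx, rfl, h3, h4⟩ <;>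
        rcases hcase w (by omega) (by omega) with ⟨y, hy, rfl, h5, h6⟩ | ⟨y, hy, rfl, h5, h6⟩
      · rw [h3, h5, consTwo_add_single] at hi
        have := (consTwo_injective hi).2.2
        refine (h.f_cov x hx (by rintro rfl; simp at h4; omega) _).2 ⟨σ i, ?_⟩
        have hy' : x + Pi.single (σ i) 1 = y := by
          apply σ.surjective.injective_comp_right
          change _ = y ∘ σ
          rw [← this]
          funext j
          simp [Pi.single_apply]
        rw [hy']
        exact ⟨hy, rfl⟩
      · rw [h3, h5, consTwo_add_single] at hi
        exact absurd (consTwo_injective hi).1 one_ne_zero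
      · rw [h3, h5, consTwo_add_single] at hi
        exact absurd (consTwo_injective hi).1 zero_ne_one
      · rw [h3, h5, consTwo_add_single] at hi
        have := (consTwo_injective hi).2.2
        refine (h.g_cov x hx (by rintro rfl; simp at h4; omega) _).2 ⟨(σ.trans e) i, ?_⟩
        have hy' : x + Pi.single ((σ.trans e) i) 1 = y := by
          apply (σ.trans e).surjective.injective_comp_right
          change _ = y ∘ (σ.trans e)
          rw [← this]
          funext j
          simp only [Pi.single_apply, Pi.add_apply, Function.comp_apply,
            (σ.trans e).injective.eq_iff]
        rw [hy']
        exact ⟨hy, rfl⟩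
  have hblock : ∀ d w, w ∈ topBlock k d ↔
      w ∈ boxLevel 0 (consTwo 1 1 k) d ∧ w 0 = 1 ∧ w 1 = 1 := fun d w => Finset.mem_filter
  have hle1 : ∀ d, ∀ w ∈ boxLevel 0 (consTwo 1 1 k) d, w 0 ≤ 1 ∧ w 1 ≤ 1 := by
    intro d w hw
    have := (mem_boxLevel.1 hw).1
    exact ⟨(this 0).2, (this 1).2⟩
  -- the set `(1, 1, *) ∪ φ(A)`
  let hat : ℕ → Set P → Finset (Fin (n + 2) → ℕ) :=
    fun d A => topBlock k (d + 1) ∪ A.toFinset.image φ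
  have hhat : ∀ d, 0 < d → d < D → ∀ A ⊆ level r d, hat d A ⊆ boxLevel 0 (consTwo 1 1 k) (d + 1) ∧
      (hat d A).card = (topBlock k (d + 1)).card + A.ncard := by
    intro d h1 h2 A hA
    have hr : ∀ z ∈ A, r z = d := fun z hz => hA hz
    constructor
    · intro w hw
      rcases Finset.mem_union.1 hw with hw | hw
      · exact ((hblock _ _).1 hw).1
      · obtain ⟨z, hz, rfl⟩ := Finset.mem_image.1 hw
        rw [Set.mem_toFinset] at hz
        have := (hφmem z (by rw [hr z hz]; exact h1) (by rw [hr z hz]; exact h2)).1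
        rwa [hr z hz] at this
    · rw [Finset.card_union_of_disjoint, Finset.card_image_of_injOn, Set.ncard_eq_toFinset_card']
      · intro z hz w hw hzw
        simp only [Set.coe_toFinset] at hz hw
        exact hφinj z w ((hr z hz).trans (hr w hw).symm) (by rw [hr z hz]; exact h1)
          (by rw [hr z hz]; exact h2) hzw
      · rw [Finset.disjoint_left]
        intro w hw hw'
        obtain ⟨z, hz, rfl⟩ := Finset.mem_image.1 hw'
        rw [Set.mem_toFinset] at hz
        have := (hφmem z (by rw [hr z hz]; exact h1) (by rw [hr z hz]; exact h2)).2
        have := ((hblock _ _).1 hw).2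
        omega
  -- Raising a binary coordinate of a code lands in the block `(1, 1, *)`, which is present anyway;
  -- raising any other coordinate is a covering relation in `P`. The block itself is the shadow of
  -- the block one level lower.
  have hshadow : ∀ d, 0 < d → d + 1 < D → ∀ A ⊆ level r d,
      boxShadow (consTwo 1 1 k) (hat d A) = hat (d + 1) (upperShadow A) := by
    intro d h1 h2 A hA
    have hr : ∀ z ∈ A, r z = d := fun z hz => hA hz
    have hL := (hhat d h1 (by omega) A hA).1
    ext y
    constructor
    · intro hy
      have hyL := boxShadow_subset hL hy
      have hy1 := hle1 _ y hyL
      obtain ⟨-, w, hw, i, rfl⟩ := mem_boxShadow.1 hy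
      have hge : ∀ j, w j ≤ (w + Pi.single i 1 : Fin (n + 2) → ℕ) j := fun j => by simp
      have hg0 := hge 0
      have hg1 := hge 1
      rcases Finset.mem_union.1 hw with hw | hw
      · have := ((hblock _ _).1 hw).2
        exact Finset.mem_union_left _ ((hblock _ _).2 ⟨hyL, by omega, by omega⟩)
      · obtain ⟨z, hz, rfl⟩ := Finset.mem_image.1 hw
        rw [Set.mem_toFinset] at hz
        have hz1 := (hφmem z (by rw [hr z hz]; exact h1) (by rw [hr z hz]; omega)).2
        by_cases hsum : (φ z + Pi.single i 1 : Fin (n + 2) → ℕ) 0 +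
            (φ z + Pi.single i 1 : Fin (n + 2) → ℕ) 1 = 1
        · obtain ⟨x, hx, hxφ⟩ := hφsurj (d + 1) (by omega) h2 _ hyL hsum
          refine Finset.mem_union_right _ (Finset.mem_image.2 ⟨x, ?_, hxφ⟩)
          rw [Set.mem_toFinset]
          exact ⟨z, hz, (hcov z x (by rw [hr z hz]; exact h1) (by rw [hr z hz]; exact h2)).2
            ⟨by rw [hx, hr z hz], i, hxφ.symm⟩⟩
        · exact Finset.mem_union_left _ ((hblock _ _).2 ⟨hyL, by omega, by omega⟩)
    · intro hy
      rcases Finset.mem_union.1 hy with hy | hy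
      · obtain ⟨hyL, hy0, hy1⟩ := (hblock _ _).1 hy
        rw [eq_consTwo y, hy0, hy1] at hyL ⊢
        set v : Fin n → ℕ := fun i => y i.succ.succ with hv
        have hv' := mem_boxLevel_consTwo.1 hyL
        have hvpos : ∃ j, v j ≠ 0 := by
          by_contra hcon
          push Not at hcon
          have : ∑ i, v i = 0 := Finset.sum_eq_zero fun i _ => hcon i
          omega
        obtain ⟨j, hj⟩ := hvpos
        obtain ⟨u, hu⟩ : ∃ u : Fin n → ℕ, u + Pi.single j 1 = v := by
          refine ⟨Function.update v j (v j - 1), funext fun i => ?_⟩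
          by_cases hij : i = j
          · subst hij
            simp
            omega
          · simp [hij]
        rw [← hu] at hv' ⊢
        rw [sum_add_single] at hv'
        refine mem_boxShadow.2 ⟨?_, consTwo 1 1 u, Finset.mem_union_left _
          ((hblock _ _).2 ⟨mem_boxLevel_consTwo.2 ⟨le_rfl, le_rfl, le_trans (fun i => ?_) hv'.2.2.1,
            by omega⟩, rfl, rfl⟩), j.succ.succ, consTwo_add_single _ _ _ _⟩
        · rw [hu]
          exact fun i => ((mem_boxLevel.1 hyL).1 i).2
        · simp
      · obtain ⟨x, hx, rfl⟩ := Finset.mem_image.1 hy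
        rw [Set.mem_toFinset] at hx
        obtain ⟨z, hz, hzx⟩ := hx
        obtain ⟨hrx, i, hi⟩ := (hcov z x (by rw [hr z hz]; exact h1)
          (by rw [hr z hz]; exact h2)).1 hzx
        rw [hr z hz] at hrx
        refine mem_boxShadow.2 ⟨fun i => ((mem_boxLevel.1
          (hφmem x (by omega) (by omega)).1).1 i).2, φ z, Finset.mem_union_right _
          (Finset.mem_image.2 ⟨z, Set.mem_toFinset.2 hz, rfl⟩), i, hi⟩
  have hseg : ∀ d, 0 < d → d < D → ∀ S ⊆ level r d,
      IsUpSegment r (fun z => toLex (φ z)) d S ↔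
        IsLexSeg (boxLevel 0 (consTwo 1 1 k) (d + 1)) (hat d S) := by
    intro d h1 h2 S hS
    have hr : ∀ z ∈ S, r z = d := fun z hz => hS hz
    constructor
    · rintro ⟨-, hup⟩
      refine ⟨(hhat d h1 h2 S hS).1, fun x hx y hy hxy => ?_⟩
      have hy1 := hle1 _ y hy
      have hx1 := hle1 _ x ((hhat d h1 h2 S hS).1 hx)
      by_cases hyb : y 0 = 1 ∧ y 1 = 1
      · exact Finset.mem_union_left _ ((hblock _ _).2 ⟨hy, hyb⟩)
      -- The first two coordinates of a lexicographically larger vector are not smaller, so nothing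
      -- of the shape `(0, 0, *)` can follow an element of `hat d S`: the segment condition involves
      -- codes and the block only.
      have hlow : (x 0 < y 0 ∨ x 0 = y 0 ∧ x 1 ≤ y 1) := by
        obtain ⟨i, hi, hi'⟩ := toLex_lt_iff.1 hxy
        revert i
        rw [forall_fin_add_two]
        refine ⟨fun _ h0 => Or.inl h0, fun h0 h1 => Or.inr ⟨h0 0 ?_, h1.le⟩,
          fun i h0 _ => Or.inr ⟨h0 0 ?_, (h0 1 ?_).le⟩⟩
        · exact Fin.zero_lt_one
        · exact Fin.succ_pos _
        · rw [← Fin.succ_zero_eq_one, Fin.succ_lt_succ_iff]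
          exact Fin.succ_pos _
      rcases Finset.mem_union.1 hx with hx | hx
      · have := ((hblock _ _).1 hx).2
        omega
      · obtain ⟨z, hz, rfl⟩ := Finset.mem_image.1 hx
        rw [Set.mem_toFinset] at hz
        have hz1 := (hφmem z (by rw [hr z hz]; exact h1) (by rw [hr z hz]; exact h2)).2
        obtain ⟨w, hw, rfl⟩ := hφsurj d h1 h2 y hy (by omega)
        exact Finset.mem_union_right _ (Finset.mem_image.2
          ⟨w, Set.mem_toFinset.2 (hup z hz w hw hxy), rfl⟩)
    · rintro ⟨-, hup⟩
      refine ⟨hS, fun x hx y hy hxy => ?_⟩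
      have hyr : r y = d := hy
      have hym := hφmem y (by omega) (by omega)
      rw [hyr] at hym
      rcases Finset.mem_union.1 (hup (φ x) (Finset.mem_union_right _
        (Finset.mem_image.2 ⟨x, Set.mem_toFinset.2 hx, rfl⟩)) (φ y) hym.1 hxy) with h3 | h3
      · have := ((hblock _ _).1 h3).2
        omega
      · obtain ⟨z, hz, hzy⟩ := Finset.mem_image.1 h3
        rw [Set.mem_toFinset] at hz
        rwa [← hφinj z y ((hr z hz).trans hyr.symm) (by rw [hr z hz]; exact h1)
          (by rw [hr z hz]; exact h2) hzy]
  have hsort : ∀ i j : Fin (n + 2), i < j → consTwo 1 1 k i ≤ consTwo 1 1 k j := by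
    have hk1 : ∀ i, 1 ≤ k i := fun i => hc _
    rw [forall_fin_add_two]
    refine ⟨?_, ?_, fun i => ?_⟩
    · rw [forall_fin_add_two]
      exact ⟨fun _ => le_rfl, fun _ => le_rfl, fun j _ => hk1 j⟩
    · rw [forall_fin_add_two]
      exact ⟨fun _ => le_rfl, fun _ => le_rfl, fun j _ => hk1 j⟩
    · rw [forall_fin_add_two]
      refine ⟨fun h => absurd h (Fin.not_lt_zero _), fun h => ?_, fun j h => ?_⟩
      · rw [← Fin.succ_zero_eq_one, Fin.succ_lt_succ_iff] at h
        exact absurd h (Fin.not_lt_zero _)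
      · rw [Fin.succ_lt_succ_iff, Fin.succ_lt_succ_iff] at h
        exact hkmono h.le
  refine isMacaulayPoset_of_key h.rank (fun z => toLex (φ z)) ?_ fun d => ?_
  · intro z w hzw hφzw
    rcases Nat.eq_zero_or_pos (r z) with h0 | h0
    · have key : ∀ z, r z = 0 → z = f 0 := by
        intro z hz
        rcases h.surj z with ⟨x, hx, rfl⟩ | ⟨y, hy, rfl⟩
        · rw [h.f_rank x hx, Finset.sum_eq_zero_iff] at hz
          congr 1
          exact funext fun i => hz i (Finset.mem_univ i)
        · rw [h.g_rank y hy, Finset.sum_eq_zero_iff] at hz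
          rw [h.f_zero]
          congr 1
          exact funext fun i => hz i (Finset.mem_univ i)
      rw [key z h0, key w (hzw ▸ h0)]
    · rcases (h.rank_le hD.le hD'.le z).lt_or_eq with h1 | h1
      · exact hφinj z w hzw h0 h1 (toLex.injective hφzw)
      · rw [h.eq_top hD hD' htop h1, h.eq_top hD hD' htop (z := w) (hzw ▸ h1)]
  · by_cases hd : 0 < d ∧ d + 1 < D
    · right
      intro A S hA hS hcard
      obtain ⟨h1, h2⟩ := hd
      have hSl := (hseg d h1 (by omega) S hS.1).1 hS
      have hshl : ∀ B ⊆ level r d, upperShadow B ⊆ level r (d + 1) :=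
        fun B hB => upperShadow_subset_level h.rank hB
      have hmin := lexSegMinimal 0 (consTwo 1 1 k) (d + 1)
        (fun i j hij _ _ => by simpa using hsort i j hij)
        (hat d A) (hat d S) (hhat d h1 (by omega) A hA).1 hSl
        (by rw [(hhat d h1 (by omega) A hA).2, (hhat d h1 (by omega) S hS.1).2, hcard])
      rw [hshadow d h1 h2 A hA, hshadow d h1 h2 S hS.1,
        (hhat (d + 1) (by omega) h2 _ (hshl A hA)).2,
        (hhat (d + 1) (by omega) h2 _ (hshl S hS.1)).2] at hmin
      refine ⟨by omega, (hseg (d + 1) (by omega) h2 _ (hshl S hS.1)).2 ?_⟩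
      rw [← hshadow d h1 h2 S hS.1]
      exact hSl.boxShadow
    · exact Or.inl fun A hA hne => h.full_of_not_mid hD hD' htop hd hA hne

end TwoCopies

end GluingSufficiency


/-! ### Sizes of box levels near the bottom and the top. -/

section LevelSizes

variable {n : ℕ}

theorem mem_boxLevel_zero {c : Fin n → ℕ} {d : ℕ} {x : Fin n → ℕ} :
    x ∈ boxLevel 0 c d ↔ x ≤ c ∧ ∑ i, x i = d := by
  rw [mem_boxLevel]
  simp [Pi.le_def]

theorem sum_tsub {c x : Fin n → ℕ} (hx : x ≤ c) : ∑ i, (c i - x i) = ∑ i, c i - ∑ i, x i :=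
  Finset.sum_tsub_distrib _ fun i _ => hx i

/-- The complement `x ↦ c - x` reverses the box. -/
theorem card_boxLevel_sub {c : Fin n → ℕ} {d : ℕ} (hd : d ≤ ∑ i, c i) :
    (boxLevel 0 c (∑ i, c i - d)).card = (boxLevel 0 c d).card := by
  refine Finset.card_bij' (fun x _ => c - x) (fun x _ => c - x) ?_ ?_ ?_ ?_
  · intro x hx
    rw [mem_boxLevel_zero] at hx ⊢
    refine ⟨tsub_le_self, ?_⟩
    rw [Finset.sum_congr rfl fun i _ => Pi.sub_apply c x i, sum_tsub hx.1, hx.2]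
    omega
  · intro x hx
    rw [mem_boxLevel_zero] at hx ⊢
    refine ⟨tsub_le_self, ?_⟩
    rw [Finset.sum_congr rfl fun i _ => Pi.sub_apply c x i, sum_tsub hx.1, hx.2]
  · intro x hx
    exact tsub_tsub_cancel_of_le (mem_boxLevel_zero.1 hx).1
  · intro x hx
    exact tsub_tsub_cancel_of_le (mem_boxLevel_zero.1 hx).1

theorem eq_add_single_of_sum {x y : Fin n → ℕ} (hxy : x ≤ y) (hs : ∑ i, y i = ∑ i, x i + 1) :
    ∃ i, x + Pi.single i 1 = y := by
  obtain ⟨i, hi⟩ := exists_add_single_le hxy (by omega)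
  exact ⟨i, eq_of_le_of_sum_eq hs.le _ hi (by rw [sum_add_single])⟩

theorem card_boxLevel_one {c : Fin n → ℕ} (hc : ∀ i, 1 ≤ c i) : (boxLevel 0 c 1).card = n := by
  have : boxLevel 0 c 1 = Finset.univ.image fun i : Fin n => (Pi.single i 1 : Fin n → ℕ) := by
    ext x
    rw [mem_boxLevel_zero, Finset.mem_image]
    constructor
    · rintro ⟨-, hx⟩
      obtain ⟨i, hi⟩ := eq_add_single_of_sum (x := 0) (y := x) (fun _ => Nat.zero_le _)
        (by simpa using hx)
      exact ⟨i, Finset.mem_univ _, by rw [← hi, zero_add]⟩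
    · rintro ⟨i, -, rfl⟩
      refine ⟨fun j => ?_, by simp⟩
      by_cases hj : j = i
      · subst hj
        simpa using hc j
      · simp [hj]
  rw [this, Finset.card_image_of_injective, Finset.card_univ, Fintype.card_fin]
  intro i j hij
  by_contra hne
  have := congrFun hij i
  simp [hne] at this

/-- A vector of degree two is either the indicator of a pair of coordinates or twice a unit vector.
-/
theorem card_boxLevel_two (c : Fin n → ℕ) : (boxLevel 0 c 2).card =
    (Finset.univ.filter fun i => 1 ≤ c i).card.choose 2 +
      (Finset.univ.filter fun i => 2 ≤ c i).card := by
  have hsplit : boxLevel 0 c 2 =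
      ((Finset.univ.filter fun i => 1 ≤ c i).powersetCard 2).image
        (fun s i => if i ∈ s then 1 else 0) ∪
      (Finset.univ.filter fun i => 2 ≤ c i).image fun i => (Pi.single i 2 : Fin n → ℕ) := by
    ext x
    simp only [mem_boxLevel_zero, Finset.mem_union, Finset.mem_image, Finset.mem_powersetCard,
      Finset.mem_filter, Finset.mem_univ, true_and]
    constructor
    · rintro ⟨hxc, hx⟩
      by_cases hex : ∃ i, 2 ≤ x i
      · obtain ⟨i, hi⟩ := hex
        refine Or.inr ⟨i, hi.trans (hxc i), (eq_of_le_of_sum_eq hx.le _ (fun j => ?_) (by simp))⟩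
        by_cases hj : j = i
        · subst hj
          simpa using hi
        · simp [hj]
      · push Not at hex
        have hxi : ∀ i, x i = if i ∈ Finset.univ.filter (fun i => x i ≠ 0) then 1 else 0 := by
          intro i
          have := hex i
          by_cases h : x i = 0
          · simp [h]
          · rw [if_pos (by simp [h])]
            omega
        refine Or.inl ⟨Finset.univ.filter fun i => x i ≠ 0, ⟨fun i hi => ?_, ?_⟩, ?_⟩
        · simp only [Finset.mem_filter, Finset.mem_univ, true_and] at hi ⊢
          have h1 : x i ≤ c i := hxc i
          omega
        · rw [Finset.card_eq_sum_ones, Finset.sum_filter, ← hx]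
          exact Finset.sum_congr rfl fun i _ => by rw [hxi i]; simp
        · exact funext fun i => (hxi i).symm
    · rintro (⟨s, ⟨hs, hcard⟩, rfl⟩ | ⟨i, hi, rfl⟩)
      · refine ⟨fun i => ?_, by simp [hcard]⟩
        by_cases h : i ∈ s
        · simpa [h] using hs h
        · simp [h]
      · refine ⟨fun j => ?_, by simp⟩
        by_cases hj : j = i
        · subst hj
          simpa using hi
        · simp [hj]
  rw [hsplit, Finset.card_union_of_disjoint, Finset.card_image_of_injective,
    Finset.card_powersetCard, Finset.card_image_of_injective]
  · intro i j hij
    by_contra hne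
    have := congrFun hij i
    simp [hne] at this
  · intro s t hst
    ext i
    have := congrFun hst i
    by_cases h1 : i ∈ s <;> by_cases h2 : i ∈ t <;> simp [h1, h2] at this ⊢
  · rw [Finset.disjoint_left]
    intro x hx hx'
    obtain ⟨s, -, rfl⟩ := Finset.mem_image.1 hx
    obtain ⟨i, -, hi⟩ := Finset.mem_image.1 hx'
    have := congrFun hi i
    simp only [Pi.single_eq_same] at this
    split_ifs at this
    all_goals omega

/-- The number of vectors of degree two below `c` that are supported on `T`. -/
theorem card_boxLevel_two_restrict {c : Fin n → ℕ} (hc : ∀ i, 1 ≤ c i) (T : Finset (Fin n)) :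
    (boxLevel 0 (fun i => if i ∈ T then c i else 0) 2).card =
      T.card.choose 2 + (T.filter fun i => 2 ≤ c i).card := by
  rw [card_boxLevel_two]
  have h1 : (Finset.univ.filter fun i => 1 ≤ if i ∈ T then c i else 0) = T := by
    ext i
    by_cases h : i ∈ T <;> simp [h, hc i]
  have h2 : (Finset.univ.filter fun i => 2 ≤ if i ∈ T then c i else 0) =
      T.filter fun i => 2 ≤ c i := by
    ext i
    by_cases h : i ∈ T <;> simp [h]
  rw [h1, h2]

end LevelSizes

/-! ### Recovering the side lengths from the level sizes. -/

section Recover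

open scoped Polynomial

/-- A primitive `M`-th root of unity kills the left product, hence some factor `X ^ b - 1` on the
right. Then `M` divides `b`, and `b ≤ M` forces equality. -/
theorem mem_of_prod_eq {s t : Multiset ℕ} (ht : ∀ b ∈ t, 1 ≤ b) {M : ℕ} (hM : 1 ≤ M)
    (hMs : M ∈ s) (hle : ∀ b ∈ t, b ≤ M)
    (h : (s.map fun a => (Polynomial.X ^ a - 1 : ℂ[X])).prod = (t.map fun a => (Polynomial.X ^ a - 1 : ℂ[X])).prod) :
    M ∈ t := by
  have hζ := Complex.isPrimitiveRoot_exp M (by omega)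
  set ζ := Complex.exp (2 * Real.pi * Complex.I / M)
  have h1 : ((s.map fun a => (Polynomial.X ^ a - 1 : ℂ[X])).prod).eval ζ = 0 := by
    rw [Polynomial.eval_multiset_prod, Multiset.map_map]
    refine Multiset.prod_eq_zero (Multiset.mem_map.2 ⟨M, hMs, ?_⟩)
    simp [hζ.pow_eq_one]
  rw [h, Polynomial.eval_multiset_prod, Multiset.map_map, Multiset.prod_eq_zero_iff] at h1
  obtain ⟨b, hb, hb0⟩ := Multiset.mem_map.1 h1
  simp only [Function.comp_apply, Polynomial.eval_sub, Polynomial.eval_pow, Polynomial.eval_X, Polynomial.eval_one, sub_eq_zero] at hb0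
  have hdvd := hζ.dvd_of_pow_eq_one b hb0
  have := Nat.le_of_dvd (ht b hb) hdvd
  rwa [le_antisymm this (hle b hb)]

/-- The largest exponent occurs on both sides; cancel its factor and induct. -/
theorem multiset_eq_of_prod_eq (s t : Multiset ℕ) (hs : ∀ a ∈ s, 1 ≤ a) (ht : ∀ b ∈ t, 1 ≤ b)
    (h : (s.map fun a => (Polynomial.X ^ a - 1 : ℂ[X])).prod = (t.map fun a => (Polynomial.X ^ a - 1 : ℂ[X])).prod) :
    s = t := by
  induction hN : (s + t).card using Nat.strong_induction_on generalizing s t with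
  | _ N ih =>
  subst hN
  by_cases h0 : s + t = 0
  · obtain ⟨rfl, rfl⟩ := add_eq_zero.1 h0
    rfl
  obtain ⟨M, hM, hmax⟩ : ∃ M ∈ s + t, ∀ b ∈ s + t, b ≤ M := by
    have hne : (s + t).toFinset.Nonempty := by
      rwa [Finset.nonempty_iff_ne_empty, Ne, Multiset.toFinset_eq_empty]
    obtain ⟨M, hM, hmax⟩ := Finset.exists_max_image (s + t).toFinset id hne
    exact ⟨M, Multiset.mem_toFinset.1 hM, fun b hb => hmax b (Multiset.mem_toFinset.2 hb)⟩
  have hsle : ∀ b ∈ s, b ≤ M := fun b hb => hmax b (Multiset.mem_add.2 (Or.inl hb))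
  have htle : ∀ b ∈ t, b ≤ M := fun b hb => hmax b (Multiset.mem_add.2 (Or.inr hb))
  have hboth : M ∈ s ∧ M ∈ t := by
    rcases Multiset.mem_add.1 hM with h1 | h1
    · exact ⟨h1, mem_of_prod_eq ht (hs M h1) h1 htle h⟩
    · exact ⟨mem_of_prod_eq hs (ht M h1) h1 hsle h.symm, h1⟩
  obtain ⟨s', rfl⟩ := Multiset.exists_cons_of_mem hboth.1
  obtain ⟨t', rfl⟩ := Multiset.exists_cons_of_mem hboth.2
  rw [Multiset.map_cons, Multiset.map_cons, Multiset.prod_cons, Multiset.prod_cons] at h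
  have hMne : (Polynomial.X ^ M - 1 : ℂ[X]) ≠ 0 :=
    by simpa using Polynomial.X_pow_sub_C_ne_zero (R := ℂ) (hs M hboth.1) 1
  congr 1
  refine ih _ ?_ s' t' (fun a ha => hs a (Multiset.mem_cons_of_mem ha))
    (fun a ha => ht a (Multiset.mem_cons_of_mem ha)) (mul_left_cancel₀ hMne h) rfl
  simp only [Multiset.card_add, Multiset.card_cons]
  omega

/-- Expanding the product chooses one exponent per coordinate, that is, a vector of the box.
Collecting by degree gives the generating function of the level sizes. -/
theorem prod_geom_sum_eq {n : ℕ} (c : Fin n → ℕ) :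
    ∏ i, ∑ k ∈ Finset.range (c i + 1), (Polynomial.X ^ k : ℂ[X]) =
      ∑ d ∈ Finset.range (∑ i, c i + 1), ((boxLevel 0 c d).card : ℂ[X]) * Polynomial.X ^ d := by
  rw [Finset.prod_univ_sum]
  have h1 : ∀ x : Fin n → ℕ, ∏ i, (Polynomial.X ^ x i : ℂ[X]) = Polynomial.X ^ ∑ i, x i :=
    fun x => Finset.prod_pow_eq_pow_sum _ _ _
  simp only [h1]
  rw [← Finset.sum_fiberwise_of_maps_to (t := Finset.range (∑ i, c i + 1))
    (g := fun x : Fin n → ℕ => ∑ i, x i)]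
  · refine Finset.sum_congr rfl fun d _ => ?_
    have : (Fintype.piFinset fun i => Finset.range (c i + 1)).filter (fun x => ∑ i, x i = d) =
        boxLevel 0 c d := by
      ext x
      simp [mem_boxLevel_zero, Pi.le_def]
    rw [this, Finset.sum_congr rfl (g := fun _ => (Polynomial.X ^ d : ℂ[X]))]
    · rw [Finset.sum_const, nsmul_eq_mul]
    · intro x hx
      rw [(mem_boxLevel_zero.1 hx).2]
  · intro x hx
    rw [Fintype.mem_piFinset] at hx
    rw [Finset.mem_range, Nat.lt_succ_iff]
    exact Finset.sum_le_sum fun i _ => by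
      have := Finset.mem_range.1 (hx i)
      omega

/-- The level sizes of a box determine its side lengths. -/
theorem exists_equiv_of_card_boxLevel_eq {n : ℕ} {c c' : Fin n → ℕ} (hsum : ∑ i, c i = ∑ i, c' i)
    (h : ∀ d ≤ ∑ i, c i, (boxLevel 0 c d).card = (boxLevel 0 c' d).card) :
    ∃ e : Fin n ≃ Fin n, ∀ i, c' (e i) = c i := by
  have h1 : ∏ i, ∑ k ∈ Finset.range (c i + 1), (Polynomial.X ^ k : ℂ[X]) =
      ∏ i, ∑ k ∈ Finset.range (c' i + 1), (Polynomial.X ^ k : ℂ[X]) := by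
    rw [prod_geom_sum_eq, prod_geom_sum_eq, ← hsum]
    refine Finset.sum_congr rfl fun d hd => ?_
    rw [h d (by have := Finset.mem_range.1 hd; omega)]
  have h2 : ∏ i, (Polynomial.X ^ (c i + 1) - 1 : ℂ[X]) = ∏ i, (Polynomial.X ^ (c' i + 1) - 1 : ℂ[X]) := by
    simp only [← geom_sum_mul]
    rw [Finset.prod_mul_distrib, Finset.prod_mul_distrib, h1]
  have h3 := multiset_eq_of_prod_eq (Finset.univ.val.map fun i => c i + 1)
    (Finset.univ.val.map fun i => c' i + 1) (by simp) (by simp)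
    (by rw [Multiset.map_map, Multiset.map_map]; exact h2)
  have h4 : Finset.univ.val.map c = Finset.univ.val.map c' := by
    have := congrArg (Multiset.map fun a => a - 1) h3
    simpa [Multiset.map_map, Function.comp_def] using this
  have h5 : ∀ a, Nonempty ({i // c i = a} ≃ {i // c' i = a}) := fun a => by
    refine ⟨Fintype.equivOfCardEq ?_⟩
    have := congrArg (Multiset.count a) h4
    rw [Multiset.count_map, Multiset.count_map] at this
    rw [Fintype.card_subtype, Fintype.card_subtype]
    simpa [Finset.card_def, eq_comm] using this
  refine ⟨(Equiv.sigmaFiberEquiv c).symm.trans ((Equiv.sigmaCongrRight fun a => (h5 a).some).trans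
    (Equiv.sigmaFiberEquiv c')), fun i => ?_⟩
  exact ((h5 (c i)).some ⟨i, rfl⟩).2

end Recover


/-! ### Levels and shadows in a gluing, and the numerical core. -/

section GluingLevels

variable {P : Type*} [PartialOrder P] {n m : ℕ} {r : P → ℕ} {D : ℕ} {c : Fin n → ℕ}
  {c' : Fin m → ℕ} {f : (Fin n → ℕ) → P} {g : (Fin m → ℕ) → P}

theorem exists_eq_add_single {n : ℕ} {x : Fin n → ℕ} {i : Fin n} (hi : 0 < x i) :
    ∃ y : Fin n → ℕ, y + Pi.single i 1 = x := by
  refine ⟨x - Pi.single i 1, tsub_add_cancel_of_le fun j => ?_⟩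
  by_cases hj : j = i
  · subst hj
    simpa [Nat.succ_le_iff] using hi
  · simp [hj]

theorem exists_add_single_mem_boxLevel {n : ℕ} {c : Fin n → ℕ} {d : ℕ} (hd : d < ∑ i, c i)
    {x : Fin n → ℕ} (hx : x ∈ boxLevel 0 c d) : ∃ i, x + Pi.single i 1 ∈ boxLevel 0 c (d + 1) := by
  rw [mem_boxLevel_zero] at hx
  obtain ⟨i, hi⟩ := exists_add_single_le hx.1 (by omega)
  exact ⟨i, mem_boxLevel_zero.2 ⟨hi, by rw [sum_add_single, hx.2]⟩⟩

namespace IsGluing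

variable (h : IsGluing r D c c' f g)
include h

theorem mem_level {d : ℕ} {z : P} (hz : z ∈ level r d) :
    (∃ x ∈ boxLevel 0 c d, f x = z) ∨ ∃ y ∈ boxLevel 0 c' d, g y = z := by
  have hr : r z = d := hz
  rcases h.surj z with ⟨x, hx, rfl⟩ | ⟨y, hy, rfl⟩
  · exact Or.inl ⟨x, mem_boxLevel_zero.2 ⟨hx, (h.f_rank x hx).symm.trans hr⟩, rfl⟩
  · exact Or.inr ⟨y, mem_boxLevel_zero.2 ⟨hy, (h.g_rank y hy).symm.trans hr⟩, rfl⟩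

theorem image_subset_level (d : ℕ) : f '' (boxLevel 0 c d : Set (Fin n → ℕ)) ⊆ level r d := by
  rintro _ ⟨x, hx, rfl⟩
  obtain ⟨h1, h2⟩ := mem_boxLevel_zero.1 (Finset.mem_coe.1 hx)
  exact (h.f_rank x h1).trans h2

theorem ncard_image {d : ℕ} {s : Finset (Fin n → ℕ)} (hs : s ⊆ boxLevel 0 c d) :
    (f '' (s : Set (Fin n → ℕ))).ncard = s.card := by
  rw [Set.InjOn.ncard_image, Set.ncard_coe_finset]
  intro x hx y hy
  exact h.f_inj x (mem_boxLevel_zero.1 (hs hx)).1 y (mem_boxLevel_zero.1 (hs hy)).1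

theorem ne_of_mem {d : ℕ} (h0 : 0 < d) (hd : d < D) {x : Fin n → ℕ} {y : Fin m → ℕ}
    (hx : x ∈ boxLevel 0 c d) (hy : y ∈ boxLevel 0 c' d) : f x ≠ g y := by
  rw [mem_boxLevel_zero] at hx hy
  exact h.disj x hx.1 y hy.1 (by omega) (by omega)

open Classical in
theorem ncard_eq {d : ℕ} (h0 : 0 < d) (hd : d < D) {S : Set P} (hS : S ⊆ level r d) :
    S.ncard = ((boxLevel 0 c d).filter fun x => f x ∈ S).card +
      ((boxLevel 0 c' d).filter fun y => g y ∈ S).card := by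
  rw [← h.ncard_image (Finset.filter_subset _ _), ← h.symm.ncard_image (Finset.filter_subset _ _),
    ← Set.ncard_union_eq]
  · congr 1
    ext z
    constructor
    · intro hz
      rcases h.mem_level (hS hz) with ⟨x, hx, rfl⟩ | ⟨y, hy, rfl⟩
      · exact Or.inl ⟨x, by simpa using ⟨hx, hz⟩, rfl⟩
      · exact Or.inr ⟨y, by simpa using ⟨hy, hz⟩, rfl⟩
    · rintro (⟨x, hx, rfl⟩ | ⟨x, hx, rfl⟩)
      · exact (Finset.mem_filter.1 hx).2
      · exact (Finset.mem_filter.1 hx).2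
  · rw [Set.disjoint_left]
    rintro _ ⟨x, hx, rfl⟩ ⟨y, hy, he⟩
    exact h.ne_of_mem h0 hd (Finset.mem_filter.1 hx).1 (Finset.mem_filter.1 hy).1 he.symm

theorem covBy_image {d : ℕ} (h0 : 0 < d) {x : Fin n → ℕ} (hx : x ∈ boxLevel 0 c d) {z : P} :
    f x ⋖ z ↔ ∃ i, x + Pi.single i 1 ∈ boxLevel 0 c (d + 1) ∧ z = f (x + Pi.single i 1) := by
  rw [mem_boxLevel_zero] at hx
  rw [h.f_cov x hx.1 (by rintro rfl; simp at hx; omega)]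
  simp only [mem_boxLevel_zero, sum_add_single, hx.2, and_true]

theorem upperShadow_image {d : ℕ} (h0 : 0 < d) :
    upperShadow (f '' (boxLevel 0 c d : Set (Fin n → ℕ))) =
      f '' (boxLevel 0 c (d + 1) : Set (Fin n → ℕ)) := by
  ext z
  constructor
  · rintro ⟨_, ⟨x, hx, rfl⟩, hz⟩
    obtain ⟨i, hi, rfl⟩ := (h.covBy_image h0 (Finset.mem_coe.1 hx)).1 hz
    exact ⟨_, hi, rfl⟩
  · rintro ⟨y, hy, rfl⟩
    have hy' := mem_boxLevel_zero.1 (Finset.mem_coe.1 hy)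
    obtain ⟨i, hi⟩ : ∃ i, 0 < y i := by
      by_contra hcon
      push Not at hcon
      have : ∑ i, y i = 0 := Finset.sum_eq_zero fun i _ => Nat.le_zero.1 (hcon i)
      omega
    obtain ⟨x, rfl⟩ := exists_eq_add_single hi
    have hx : x ∈ boxLevel 0 c d := by
      rw [sum_add_single] at hy'
      exact mem_boxLevel_zero.2 ⟨le_self_add.trans hy'.1, by omega⟩
    exact ⟨f x, ⟨x, hx, rfl⟩, (h.covBy_image h0 hx).2 ⟨i, hy, rfl⟩⟩

/-- Above the bottom and below the top, a set whose shadow lies in the first box lies there. -/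
theorem subset_image_of_upperShadow {d : ℕ} (h0 : 0 < d) (hd : d + 1 < D) (hD' : ∑ j, c' j = D)
    {S : Set P} (hS : S ⊆ level r d)
    (hsh : upperShadow S ⊆ f '' (boxLevel 0 c (d + 1) : Set (Fin n → ℕ))) :
    S ⊆ f '' (boxLevel 0 c d : Set (Fin n → ℕ)) := by
  intro z hz
  rcases h.mem_level (hS hz) with ⟨x, hx, rfl⟩ | ⟨y, hy, rfl⟩
  · exact ⟨x, hx, rfl⟩
  · obtain ⟨j, hj⟩ := exists_add_single_mem_boxLevel (by omega) hy
    obtain ⟨x, hx, he⟩ := hsh ⟨_, hz, (h.symm.covBy_image h0 hy).2 ⟨j, hj, rfl⟩⟩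
    exact absurd he (h.ne_of_mem (Nat.succ_pos _) hd hx hj)

end IsGluing

section Counting

theorem card_filter_single_eq {n : ℕ} {c : Fin n → ℕ} (hc : ∀ i, 1 ≤ c i)
    (p : (Fin n → ℕ) → Prop) [DecidablePred p] :
    ((boxLevel 0 c 1).filter p).card =
      (Finset.univ.filter fun i : Fin n => p (Pi.single i 1)).card := by
  symm
  refine Finset.card_bij (fun i _ => (Pi.single i 1 : Fin n → ℕ)) ?_ ?_ ?_
  · intro i hi
    refine Finset.mem_filter.2 ⟨mem_boxLevel_zero.2 ⟨fun j => ?_, by simp⟩,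
      (Finset.mem_filter.1 hi).2⟩
    by_cases hj : j = i
    · subst hj
      simpa using hc j
    · simp [hj]
  · intro i _ j _ hij
    by_contra hne
    have := congrFun hij i
    simp [hne] at this
  · intro x hx
    obtain ⟨hx1, hx2⟩ := Finset.mem_filter.1 hx
    obtain ⟨i, hi⟩ := eq_add_single_of_sum (x := 0) (y := x) (fun _ => Nat.zero_le _)
      (by simpa using (mem_boxLevel_zero.1 hx1).2)
    rw [zero_add] at hi
    exact ⟨i, by simpa [hi] using hx2, hi⟩

theorem choose_two_add (a b : ℕ) : (a + b).choose 2 = a.choose 2 + b.choose 2 + a * b := by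
  induction b with
  | zero => simp
  | succ b ih =>
    rw [← add_assoc, Nat.choose_succ_succ' (a + b) 1, Nat.choose_succ_succ' b 1, ih]
    simp only [Nat.choose_one_right]
    ring

/-- Here `k₁`, `l₁` count coatom directions of the segment in the two boxes, `k₂` its atoms in the
first box, and `sP`, `sQ`, `t`, `u` count sides of length at least two. After splitting the binomial
coefficients, mixed products are bounded by linear terms, which leaves finitely many shapes. -/
theorem gluing_numerics {D n m sP sQ k₁ l₁ t₁ u₁ k₂ t₂ u₂ : ℕ} (hnP : n + sP ≤ D)
    (hQ : sQ = 0 → m = D) (hk₁ : 1 ≤ k₁) (hk₁n : k₁ ≤ n) (hkl : k₁ + l₁ ≤ m) (ht₁k : t₁ ≤ k₁)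
    (ht₁P : t₁ ≤ sP) (hu₁l : u₁ ≤ l₁) (hu₁Q : u₁ ≤ sQ)
    (htop : m.choose 2 + sQ ≤ k₁.choose 2 + t₁ + (l₁.choose 2 + u₁)) (hk₂ : 1 ≤ k₂)
    (hk₂n : k₂ ≤ n) (hk₂m : k₂ ≤ m) (ht₂ : t₂ ≤ n - k₂) (ht₂P : t₂ ≤ sP) (hu₂ : u₂ ≤ k₂)
    (hu₂Q : u₂ ≤ sQ)
    (hbot : n.choose 2 + sP ≤ (n - k₂).choose 2 + t₂ + (k₂.choose 2 + u₂)) :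
    (n = 1 ∧ m = 2 ∧ sQ ≤ 1) ∨ (n = 2 ∧ m = 1 ∧ sP ≤ 1) ∨ (n = m ∧ k₁ = n ∧ l₁ = 0) ∨
      (n = 2 ∧ m = 2 ∧ sP = 1 ∧ sQ = 1) := by
  obtain ⟨w, rfl⟩ := Nat.exists_eq_add_of_le hkl
  obtain ⟨v, rfl⟩ := Nat.exists_eq_add_of_le hk₂n
  rw [Nat.add_sub_cancel_left] at ht₂ hbot
  rw [choose_two_add] at hbot
  rw [choose_two_add, choose_two_add, add_mul] at htop
  -- In `hbot` the squares cancel: the mixed term `k₂ * v` plus `sP` is at most `t₂ + u₂ ≤ sP + k₂`.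
  have hv : k₂ * v ≤ k₂ * 1 := by omega
  have hv1 : v ≤ 1 := Nat.le_of_mul_le_mul_left hv hk₂
  -- Likewise in `htop`, with the bound `t₁ + u₁ ≤ k₁ + sQ`.
  have hw : k₁ * (l₁ + w) ≤ k₁ * 1 := by
    rw [mul_add]
    omega
  have hw1 : l₁ + w ≤ 1 := Nat.le_of_mul_le_mul_left hw hk₁
  obtain ⟨rfl, rfl⟩ | ⟨rfl, rfl⟩ | ⟨rfl, rfl⟩ :
    (l₁ = 0 ∧ w = 0) ∨ (l₁ = 1 ∧ w = 0) ∨ (l₁ = 0 ∧ w = 1) := by omega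
  all_goals
    obtain rfl | rfl : v = 0 ∨ v = 1 := by omega
    all_goals
      simp at htop hbot
      omega

end Counting

end GluingLevels


/-! ### Counting elements next to the top and next to the bottom. -/

section GluingNecessity

variable {P : Type*} [PartialOrder P] {n m : ℕ} {r : P → ℕ} {D : ℕ} {c : Fin n → ℕ}
  {c' : Fin m → ℕ} {f : (Fin n → ℕ) → P} {g : (Fin m → ℕ) → P}

open Classical in
/-- The variables `i` for which `S` contains the coatom of the box `c` missing one step in
direction `i`. -/
noncomputable def coatomDirections (c : Fin n → ℕ) (f : (Fin n → ℕ) → P) (S : Set P) :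
    Finset (Fin n) :=
  Finset.univ.filter fun i => ∃ y, y + Pi.single i 1 = c ∧ f y ∈ S

omit [PartialOrder P] in
theorem mem_coatomDirections {S : Set P} {i : Fin n} :
    i ∈ coatomDirections c f S ↔ ∃ y, y + Pi.single i 1 = c ∧ f y ∈ S := by
  simp [coatomDirections]

namespace IsGluing

variable (h : IsGluing r D c c' f g)
include h

open Classical in
/-- The elements of rank `D - 2` in the first box whose shadow is contained in a given set are
counted by the coatoms in that set. -/
theorem card_filter_le_of_upperShadow {d : ℕ} (h0 : 0 < d) (hD : ∑ i, c i = d + 2)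
    (hc : ∀ i, 1 ≤ c i) (S : Set P) :
    ((boxLevel 0 c d).filter fun x => f x ∈ S).card ≤
      (coatomDirections c f (upperShadow S)).card.choose 2 +
      ((coatomDirections c f (upperShadow S)).filter fun i => 2 ≤ c i).card := by
  rw [← card_boxLevel_two_restrict hc]
  -- Two levels below the top `c - x` has degree two. Each coordinate in its support is a direction
  -- still missing from a coatom above `x`, so the support consists of coatom directions of the
  -- shadow.
  refine Finset.card_le_card_of_injOn (fun x => c - x) ?_ ?_
  · intro x hx
    obtain ⟨hx, hxS⟩ := Finset.mem_filter.1 (Finset.mem_coe.1 hx)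
    have hx' := mem_boxLevel_zero.1 hx
    refine Finset.mem_coe.2 (mem_boxLevel_zero.2 ⟨fun i => ?_, ?_⟩)
    · beta_reduce
      split_ifs with hi
      · exact tsub_le_self
      · by_contra hlt
        apply hi
        have hlt' : 0 < c i - x i := not_le.1 hlt
        have hle : x + Pi.single i 1 ≤ c := fun j => by
          by_cases hj : j = i
          · subst hj
            simp
            omega
          · simpa [hj] using hx'.1 j
        obtain ⟨j, hj⟩ := eq_add_single_of_sum hle (by rw [sum_add_single, hx'.2, hD])
        have hmem : x + Pi.single j 1 ∈ boxLevel 0 c (d + 1) := by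
          refine mem_boxLevel_zero.2 ⟨?_, by rw [sum_add_single, hx'.2]⟩
          rw [← hj, add_right_comm]
          exact le_self_add
        exact mem_coatomDirections.2 ⟨_, by rw [add_right_comm, hj],
          f x, hxS, (h.covBy_image h0 hx).2 ⟨j, hmem, rfl⟩⟩
    · rw [Finset.sum_congr rfl fun i _ => Pi.sub_apply c x i, sum_tsub hx'.1, hx'.2, hD]
      omega
  · intro x hx y hy hxy
    have h1 := (mem_boxLevel_zero.1 (Finset.mem_filter.1 (Finset.mem_coe.1 hx)).1).1
    have h2 := (mem_boxLevel_zero.1 (Finset.mem_filter.1 (Finset.mem_coe.1 hy)).1).1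
    rw [← tsub_tsub_cancel_of_le h1, ← tsub_tsub_cancel_of_le h2]
    exact congrArg (c - ·) hxy

omit [PartialOrder P] h in
open Classical in
theorem _root_.card_coatomDirections_le {d : ℕ} (hD : ∑ i, c i = d + 1) (S : Set P) :
    (coatomDirections c f S).card ≤ ((boxLevel 0 c d).filter fun x => f x ∈ S).card := by
  refine Finset.card_le_card_of_injOn (fun i => c - Pi.single i 1) ?_ ?_
  · intro i hi
    obtain ⟨y, hyc, hyS⟩ := mem_coatomDirections.1 (Finset.mem_coe.1 hi)
    have hy : y ∈ boxLevel 0 c d := by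
      refine mem_boxLevel_zero.2 ⟨hyc ▸ le_self_add, ?_⟩
      rw [← hyc, sum_add_single] at hD
      omega
    have : c - Pi.single i 1 = y := by rw [← hyc, add_tsub_cancel_right]
    exact Finset.mem_coe.2 (Finset.mem_filter.2 (by beta_reduce; rw [this]; exact ⟨hy, hyS⟩))
  · intro i hi j hj hij
    obtain ⟨y, hyc, -⟩ := mem_coatomDirections.1 (Finset.mem_coe.1 hi)
    obtain ⟨y', hyc', -⟩ := mem_coatomDirections.1 (Finset.mem_coe.1 hj)
    have h1 : c - Pi.single i 1 = y := by rw [← hyc, add_tsub_cancel_right]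
    have h2 : c - Pi.single j 1 = y' := by rw [← hyc', add_tsub_cancel_right]
    have h3 : y = y' := by rw [← h1, ← h2]; exact hij
    have h4 : (Pi.single i 1 : Fin n → ℕ) = Pi.single j 1 :=
      add_left_cancel (hyc.trans (h3 ▸ hyc'.symm))
    by_contra hne
    have := congrFun h4 i
    simp [hne] at this

open Classical in
/-- The shadow of a set of atoms inside the first box misses exactly the vectors supported on the
complementary set of variables. -/
theorem card_filter_upperShadow_one (hc : ∀ i, 1 ≤ c i) (S : Set P) :
    (boxLevel 0 c 2).card ≤ ((boxLevel 0 c 2).filter fun x => f x ∈ upperShadow S).card +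
      ((Finset.univ.filter fun i => f (Pi.single i 1) ∈ S)ᶜ.card.choose 2 +
      ((Finset.univ.filter fun i => f (Pi.single i 1) ∈ S)ᶜ.filter fun i => 2 ≤ c i).card) := by
  rw [← card_boxLevel_two_restrict hc,
    ← Finset.card_filter_add_card_filter_not (s := boxLevel 0 c 2) fun x => f x ∈ upperShadow S]
  refine Nat.add_le_add_left (Finset.card_le_card fun x hx => ?_) _
  obtain ⟨hx, hxS⟩ := Finset.mem_filter.1 hx
  have hx' := mem_boxLevel_zero.1 hx
  refine mem_boxLevel_zero.2 ⟨fun i => ?_, hx'.2⟩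
  beta_reduce
  split_ifs with hi
  · exact hx'.1 i
  · by_contra hlt
    apply hxS
    have hiS : f (Pi.single i 1) ∈ S := by simpa using hi
    obtain ⟨y, rfl⟩ := exists_eq_add_single (not_le.1 hlt)
    have hy := hx'.2
    rw [sum_add_single] at hy
    obtain ⟨j, hj⟩ := eq_add_single_of_sum (x := 0) (y := y) (fun _ => Nat.zero_le _)
      (by simpa using hy)
    have hsi : (Pi.single i 1 : Fin n → ℕ) ∈ boxLevel 0 c 1 :=
      mem_boxLevel_zero.2 ⟨le_add_self.trans hx'.1, by simp⟩
    refine ⟨_, hiS, (h.covBy_image one_pos hsi).2 ⟨j, ?_, ?_⟩⟩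
    · rw [zero_add] at hj
      rw [hj, add_comm _ y]
      exact hx
    · rw [zero_add] at hj
      rw [hj, add_comm]

end IsGluing

end GluingNecessity


/-! ### Necessity for the diamond. -/

section DiamondNecessity

variable {P : Type*} [PartialOrder P] {n m : ℕ} {r : P → ℕ} {D : ℕ} {c : Fin n → ℕ}
  {c' : Fin m → ℕ} {f : (Fin n → ℕ) → P} {g : (Fin m → ℕ) → P}

/-- The initial segments of a Macaulay order. -/
structure IsSegFamily (r : P → ℕ) (seg : ℕ → ℕ → Set P) : Prop where
  subset : ∀ d q, seg d q ⊆ level r d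
  mono : ∀ d, Monotone (seg d)
  card : ∀ d q, q ≤ (level r d).ncard → (seg d q).ncard = q
  shadow : ∀ d A, A ⊆ level r d →
    (upperShadow (seg d A.ncard)).ncard ≤ (upperShadow A).ncard ∧
    upperShadow (seg d A.ncard) = seg (d + 1) (upperShadow (seg d A.ncard)).ncard

theorem IsMacaulayPoset.exists_isSegFamily [Finite P] (h : IsMacaulayPoset P)
    (hr : IsRankFunction r) : ∃ seg : ℕ → ℕ → Set P, IsSegFamily r seg := by
  obtain ⟨seg, h1, h2, h3, h4⟩ := h.exists_seg hr
  exact ⟨seg, h1, h2, h3, h4⟩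

namespace IsSegFamily

variable {seg : ℕ → ℕ → Set P} (hseg : IsSegFamily r seg)
include hseg

theorem ncard_seg_one [Finite P] {d : ℕ} (hd : (level r d).Nonempty) : (seg d 1).ncard = 1 :=
  hseg.card d 1 ((Set.ncard_pos).2 hd)

theorem ncard_seg [Finite P] {d : ℕ} {A : Set P} (hA : A ⊆ level r d) :
    (seg d A.ncard).ncard = A.ncard :=
  hseg.card d _ (Set.ncard_le_ncard hA)

theorem subset_upperShadow {d q k : ℕ} (hq : (seg d q).ncard = q)
    (hk : k ≤ (upperShadow (seg d q)).ncard) : seg (d + 1) k ⊆ upperShadow (seg d q) := by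
  have h2 := (hseg.shadow d (seg d q) (hseg.subset d q)).2
  rw [hq] at h2
  rw [h2]
  exact hseg.mono _ hk

/-- The shadow of an initial segment that is as large as `A` is contained in every initial segment
that is as large as the shadow of `A`. -/
theorem upperShadow_subset {d k : ℕ} {A : Set P} (hA : A ⊆ level r d)
    (hk : (upperShadow A).ncard ≤ k) : upperShadow (seg d A.ncard) ⊆ seg (d + 1) k := by
  obtain ⟨h1, h2⟩ := hseg.shadow d A hA
  rw [h2]
  exact hseg.mono _ (h1.trans hk)

end IsSegFamily

theorem boxLevel_nonempty {n : ℕ} {c : Fin n → ℕ} {d : ℕ} (hd : d ≤ ∑ i, c i) :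
    (boxLevel 0 c d).Nonempty := by
  induction d with
  | zero => exact ⟨0, mem_boxLevel_zero.2 ⟨fun _ => Nat.zero_le _, by simp⟩⟩
  | succ d ih =>
    obtain ⟨x, hx⟩ := ih (by omega)
    obtain ⟨i, hi⟩ := exists_add_single_mem_boxLevel (by omega) hx
    exact ⟨_, hi⟩

/-- At most one side exceeds one, so both pairs consist of `1` and the sum minus one. This closes
the exceptional outcome of `gluing_numerics`. -/
theorem exists_equiv_of_two {c c' : Fin 2 → ℕ} (hc : ∀ i, 1 ≤ c i) (hc' : ∀ i, 1 ≤ c' i)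
    (hs : ∑ i, c i = ∑ i, c' i) (h1 : (Finset.univ.filter fun i => 2 ≤ c i).card ≤ 1)
    (h1' : (Finset.univ.filter fun i => 2 ≤ c' i).card ≤ 1) :
    ∃ e : Fin 2 ≃ Fin 2, ∀ i, c' (e i) = c i := by
  rw [Finset.card_filter, Fin.sum_univ_two] at h1 h1'
  rw [Fin.sum_univ_two, Fin.sum_univ_two] at hs
  have := hc 0
  have := hc 1
  have := hc' 0
  have := hc' 1
  by_cases h : c' 0 = c 0
  · exact ⟨Equiv.refl _, by rw [Fin.forall_fin_two]; exact ⟨h, by simp; omega⟩⟩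
  · refine ⟨Equiv.swap 0 1, ?_⟩
    rw [Fin.forall_fin_two, Equiv.swap_apply_left, Equiv.swap_apply_right]
    split_ifs at h1 h1' <;> omega

theorem add_card_filter_two_le {n : ℕ} {c : Fin n → ℕ} (hc : ∀ i, 1 ≤ c i) :
    n + (Finset.univ.filter fun i => 2 ≤ c i).card ≤ ∑ i, c i := by
  have h1 : n = ∑ _i : Fin n, 1 := by simp
  rw [Finset.card_filter]
  nth_rw 1 [h1]
  rw [← Finset.sum_add_distrib]
  refine Finset.sum_le_sum fun i _ => ?_
  have := hc i
  split_ifs <;> omega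

theorem eq_sum_of_card_filter_two {n : ℕ} {c : Fin n → ℕ} (hc : ∀ i, 1 ≤ c i)
    (h0 : (Finset.univ.filter fun i => 2 ≤ c i).card = 0) : n = ∑ i, c i := by
  rw [Finset.card_eq_zero, Finset.filter_eq_empty_iff] at h0
  have h1 : n = ∑ _i : Fin n, 1 := by simp
  nth_rw 1 [h1]
  refine Finset.sum_congr rfl fun i hi => ?_
  have := hc i
  have := h0 hi
  omega

namespace IsGluing

variable (h : IsGluing r D c c' f g)
include h

theorem level_nonempty {d : ℕ} (hd : d ≤ ∑ i, c i) : (level r d).Nonempty := by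
  obtain ⟨x, hx⟩ := boxLevel_nonempty hd
  exact ⟨f x, h.image_subset_level d ⟨x, hx, rfl⟩⟩

/-- If the first element of a level lies in the first box, then so does the first element of every
higher level, up to the rank of that box. -/
theorem seg_one_subset {seg : ℕ → ℕ → Set P} (hseg : IsSegFamily r seg) {d₀ d : ℕ} (h0 : 0 < d₀)
    (h1 : seg d₀ 1 ⊆ f '' (boxLevel 0 c d₀ : Set (Fin n → ℕ))) (hle : d₀ ≤ d) (hd : d ≤ ∑ i, c i) :
    seg d 1 ⊆ f '' (boxLevel 0 c d : Set (Fin n → ℕ)) := by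
  have hfin := h.finite
  induction d, hle using Nat.le_induction with
  | base => exact h1
  | succ d hd0 ih =>
    have ih := ih (by omega)
    have hd0' : 0 < d := by omega
    have hs1 := hseg.ncard_seg_one (h.level_nonempty (d := d) (by omega))
    obtain ⟨z, hz⟩ := Set.ncard_eq_one.1 hs1
    have hzs : z ∈ seg d 1 := by rw [hz]; rfl
    obtain ⟨x, hx, rfl⟩ := ih hzs
    obtain ⟨i, hi⟩ := exists_add_single_mem_boxLevel (c := c) (by omega) hx
    have hsh : f (x + Pi.single i 1) ∈ upperShadow (seg d 1) :=
      ⟨f x, hzs, (h.covBy_image hd0' hx).2 ⟨i, hi, rfl⟩⟩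
    have hpos : 1 ≤ (upperShadow (seg d 1)).ncard := (Set.ncard_pos).2 ⟨_, hsh⟩
    calc seg (d + 1) 1 ⊆ upperShadow (seg d 1) := hseg.subset_upperShadow hs1 hpos
      _ ⊆ upperShadow (f '' (boxLevel 0 c d : Set (Fin n → ℕ))) := upperShadow_mono ih
      _ = _ := h.upperShadow_image hd0'

open Classical in
/-- Comparison of the second box with the initial segment of the same size two levels below the
top. -/
theorem top_estimate (hD : ∑ i, c i = D) (hD' : ∑ j, c' j = D) (hD3 : 3 ≤ D) (hc : ∀ i, 1 ≤ c i)
    (hc' : ∀ j, 1 ≤ c' j) {seg : ℕ → ℕ → Set P} (hseg : IsSegFamily r seg)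
    (h1 : seg 1 1 ⊆ f '' (boxLevel 0 c 1 : Set (Fin n → ℕ))) :
    ∃ T : Finset (Fin n), ∃ U : Finset (Fin m), 1 ≤ T.card ∧ T.card + U.card ≤ m ∧
      m.choose 2 + (Finset.univ.filter fun j => 2 ≤ c' j).card ≤
        T.card.choose 2 + (T.filter fun i => 2 ≤ c i).card +
        (U.card.choose 2 + (U.filter fun j => 2 ≤ c' j).card) ∧
      (T.card = m → U = ∅ → seg (D - 1) m ⊆ f '' (boxLevel 0 c (D - 1) : Set (Fin n → ℕ))) := by
  have hfin := h.finite
  obtain ⟨d, rfl⟩ : ∃ d, D = d + 2 := ⟨D - 2, by omega⟩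
  have hd0 : 0 < d := by omega
  set A := g '' (boxLevel 0 c' d : Set (Fin m → ℕ)) with hA
  have hAl : A ⊆ level r d := h.symm.image_subset_level d
  have hAc : A.ncard = m.choose 2 + (Finset.univ.filter fun j => 2 ≤ c' j).card := by
    rw [hA, h.symm.ncard_image (d := d) subset_rfl]
    have e1 := card_boxLevel_sub (c := c') (d := 2) (by omega)
    rw [hD', Nat.add_sub_cancel] at e1
    rw [e1, card_boxLevel_two]
    congr 2
    rw [Finset.filter_true_of_mem fun j _ => hc' j, Finset.card_univ, Fintype.card_fin]
  have hAs : (upperShadow A).ncard = m := by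
    rw [hA, h.symm.upperShadow_image hd0, h.symm.ncard_image (d := d + 1) subset_rfl]
    have e1 := card_boxLevel_sub (c := c') (d := 1) (by omega)
    rw [hD', show d + 2 - 1 = d + 1 from rfl] at e1
    rw [e1, card_boxLevel_one hc']
  set S := seg d A.ncard with hS
  have hSl : S ⊆ level r d := hseg.subset _ _
  have hSc : S.ncard = A.ncard := hseg.ncard_seg hAl
  obtain ⟨hs1, hs2⟩ := hseg.shadow d A hAl
  rw [← hS, hAs] at hs1
  rw [← hS] at hs2
  have hshl : upperShadow S ⊆ level r (d + 1) := upperShadow_subset_level h.rank hSl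
  have hsplit := h.ncard_eq (d := d + 1) (Nat.succ_pos d) (by omega) hshl
  have hsplitS := h.ncard_eq hd0 (by omega) hSl
  have hT := card_coatomDirections_le (f := f) hD (upperShadow S)
  have hU := card_coatomDirections_le (f := g) hD' (upperShadow S)
  have hT2 := h.card_filter_le_of_upperShadow hd0 hD hc S
  have hU2 := h.symm.card_filter_le_of_upperShadow hd0 hD' hc' S
  refine ⟨coatomDirections c f (upperShadow S), coatomDirections c' g (upperShadow S), ?_, by omega,
    by omega, ?_⟩
  -- The first element of this level inherits the box of the first atom. It lies in `S`, and a
  -- coatom above it provides a direction in the first box.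
  · obtain ⟨z, hz⟩ := Set.ncard_eq_one.1 (hseg.ncard_seg_one (h.level_nonempty (d := d) (by omega)))
    have hzs : z ∈ seg d 1 := by rw [hz]; rfl
    obtain ⟨x, hx, rfl⟩ := h.seg_one_subset hseg one_pos h1 hd0 (by omega) hzs
    have hzS : f x ∈ S := by
      refine hseg.mono d ?_ hzs
      refine (Set.ncard_pos).2 ?_
      obtain ⟨y, hy⟩ := boxLevel_nonempty (c := c') (d := d) (by omega)
      exact ⟨g y, y, hy, rfl⟩
    obtain ⟨i, hi⟩ := exists_add_single_mem_boxLevel (c := c) (by omega) hx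
    obtain ⟨j, hj⟩ := eq_add_single_of_sum (mem_boxLevel_zero.1 hi).1
      (by rw [(mem_boxLevel_zero.1 hi).2, hD])
    exact Finset.card_pos.2 ⟨j, mem_coatomDirections.2 ⟨_, hj, f x, hzS,
      (h.covBy_image hd0 hx).2 ⟨i, hi, rfl⟩⟩⟩
  · intro hTm hU0
    have hc : (upperShadow S).ncard = m := by omega
    rw [hc] at hs2
    rw [show d + 2 - 1 = d + 1 from rfl, ← hs2]
    intro z hz
    rcases h.mem_level (hshl hz) with ⟨x, hx, rfl⟩ | ⟨y, hy, rfl⟩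
    · exact ⟨x, hx, rfl⟩
    · have : 0 < ((boxLevel 0 c' (d + 1)).filter fun y => g y ∈ upperShadow S).card :=
        Finset.card_pos.2 ⟨y, Finset.mem_filter.2 ⟨hy, hz⟩⟩
      omega

open Classical in
/-- Comparison of the second box with the initial segment of the same size one level above the
bottom. -/
theorem bottom_estimate (hD3 : 3 ≤ D) (hc : ∀ i, 1 ≤ c i) (hD' : ∑ j, c' j = D)
    (hc' : ∀ j, 1 ≤ c' j) {seg : ℕ → ℕ → Set P} (hseg : IsSegFamily r seg)
    (h1 : seg 1 1 ⊆ f '' (boxLevel 0 c 1 : Set (Fin n → ℕ)))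
    (h1c : (seg 1 1).Nonempty) :
    ∃ T : Finset (Fin n), ∃ U : Finset (Fin m), 1 ≤ T.card ∧ T.card + U.card = m ∧
      n.choose 2 + (Finset.univ.filter fun i => 2 ≤ c i).card ≤
        Tᶜ.card.choose 2 + (Tᶜ.filter fun i => 2 ≤ c i).card +
        (Uᶜ.card.choose 2 + (Uᶜ.filter fun j => 2 ≤ c' j).card) := by
  have hfin := h.finite
  set A := g '' (boxLevel 0 c' 1 : Set (Fin m → ℕ)) with hA
  have hAl : A ⊆ level r 1 := h.symm.image_subset_level 1
  have hAc : A.ncard = m := by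
    rw [hA, h.symm.ncard_image (d := 1) subset_rfl, card_boxLevel_one hc']
  have hAs : (upperShadow A).ncard = (boxLevel 0 c' 2).card := by
    rw [hA, h.symm.upperShadow_image one_pos, h.symm.ncard_image (d := 2) subset_rfl]
  set S := seg 1 A.ncard with hS
  have hSl : S ⊆ level r 1 := hseg.subset _ _
  have hSc : S.ncard = A.ncard := hseg.ncard_seg hAl
  have hs1 := (hseg.shadow 1 A hAl).1
  rw [← hS, hAs] at hs1
  have hsplit := h.ncard_eq (d := 2) two_pos (by omega)
    (upperShadow_subset_level h.rank hSl)
  have hsplitS := h.ncard_eq one_pos (by omega) hSl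
  rw [card_filter_single_eq hc, card_filter_single_eq hc'] at hsplitS
  -- The shadow of `S` is at most the second box's level two. Hence what it misses in both boxes
  -- together is at least the first box's level two; the contribution of the second box cancels.
  have hT := h.card_filter_upperShadow_one hc S
  have hU := h.symm.card_filter_upperShadow_one hc' S
  have hn2 := card_boxLevel_two c
  rw [Finset.filter_true_of_mem fun i _ => hc i, Finset.card_univ, Fintype.card_fin] at hn2
  refine ⟨Finset.univ.filter fun i => f (Pi.single i 1) ∈ S,
    Finset.univ.filter fun j => g (Pi.single j 1) ∈ S, ?_, by omega, by omega⟩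
  obtain ⟨z, hz⟩ := h1c
  have hzS : z ∈ S := by
    refine hseg.mono 1 ?_ hz
    refine (Set.ncard_pos).2 ?_
    obtain ⟨y, hy⟩ := boxLevel_nonempty (c := c') (d := 1) (by omega)
    exact ⟨g y, y, hy, rfl⟩
  obtain ⟨x, hx, rfl⟩ := h1 hz
  have : 0 < ((boxLevel 0 c 1).filter fun x => f x ∈ S).card :=
    Finset.card_pos.2 ⟨x, Finset.mem_filter.2 ⟨hx, hzS⟩⟩
  rwa [card_filter_single_eq hc] at this

/-- If the initial segment of coatoms lies in the first box, then the level sizes agree. -/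
theorem card_boxLevel_eq (hD : ∑ i, c i = D) (hD' : ∑ j, c' j = D) (hc : ∀ i, 1 ≤ c i)
    (hc' : ∀ j, 1 ≤ c' j) (hnm : n = m) {seg : ℕ → ℕ → Set P} (hseg : IsSegFamily r seg)
    (hlast : seg (D - 1) m ⊆ f '' (boxLevel 0 c (D - 1) : Set (Fin n → ℕ))) {d : ℕ} (h0 : 0 < d)
    (hd : d < D) : (boxLevel 0 c d).card = (boxLevel 0 c' d).card := by
  have hfin := h.finite
  -- Downward from the coatoms: the segment as large as the second box's level has its shadow inside
  -- the segment one level higher, hence inside the first box, and elements of the second box have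
  -- successors only there.
  have hdesc : ∀ k d, 0 < d → d + k + 1 = D →
      seg d (boxLevel 0 c' d).card ⊆ f '' (boxLevel 0 c d : Set (Fin n → ℕ)) := by
    intro k
    induction k with
    | zero =>
      rintro d - rfl
      have e1 := card_boxLevel_sub (c := c') (d := 1) (by omega)
      rw [hD', card_boxLevel_one hc'] at e1
      rw [show d + 0 + 1 - 1 = d from rfl] at e1 hlast
      rw [e1]
      exact hlast
    | succ k ih =>
      intro d hd0 hdk
      have hA := h.symm.image_subset_level d
      have := hseg.upperShadow_subset hA (k := (boxLevel 0 c' (d + 1)).card) (by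
        rw [h.symm.upperShadow_image hd0, h.symm.ncard_image (d := d + 1) subset_rfl])
      rw [h.symm.ncard_image (d := d) subset_rfl] at this
      exact h.subset_image_of_upperShadow hd0 (by omega) hD' (hseg.subset _ _)
        (this.trans (ih (d + 1) (Nat.succ_pos _) (by omega)))
  have hq : ∀ d, (seg d (boxLevel 0 c' d).card).ncard = (boxLevel 0 c' d).card := fun d => by
    have := hseg.ncard_seg (h.symm.image_subset_level d)
    rwa [h.symm.ncard_image (d := d) subset_rfl] at this
  have hsub : ∀ d, 0 < d → d < D →
      seg d (boxLevel 0 c' d).card ⊆ f '' (boxLevel 0 c d : Set (Fin n → ℕ)) :=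
    fun d h0 hd => hdesc (D - d - 1) d h0 (by omega)
  have hle : ∀ d, 0 < d → d < D → (boxLevel 0 c' d).card ≤ (boxLevel 0 c d).card := by
    intro d h0 hd
    rw [← hq, ← h.ncard_image (d := d) subset_rfl]
    exact Set.ncard_le_ncard (hsub d h0 hd)
  -- Upward for the reverse inequality: once the sizes agree at `d`, the segment is the full level
  -- of the first box, and minimality of its shadow bounds the next level.
  induction d, Nat.succ_le_iff.2 h0 using Nat.le_induction with
  | base => rw [card_boxLevel_one hc, card_boxLevel_one hc', hnm]
  | succ d hd0 ih =>
    have ih := ih hd0 (by omega)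
    refine le_antisymm ?_ (hle _ h0 hd)
    have heq : seg d (boxLevel 0 c' d).card = f '' (boxLevel 0 c d : Set (Fin n → ℕ)) := by
      refine Set.eq_of_subset_of_ncard_le (hsub d hd0 (by omega)) ?_
      rw [hq, h.ncard_image (d := d) subset_rfl, ih]
    have := (hseg.shadow d _ (h.symm.image_subset_level d)).1
    rwa [h.symm.ncard_image (d := d) subset_rfl, heq, h.upperShadow_image hd0,
      h.symm.upperShadow_image hd0, h.ncard_image (d := d + 1) subset_rfl,
      h.symm.ncard_image (d := d + 1) subset_rfl] at this

/-- The shape of two boxes whose gluing at top and bottom is Macaulay, for an order whose first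
atom lies in the first box. -/
theorem classify_of_first_atom (hD : ∑ i, c i = D) (hD' : ∑ j, c' j = D) (hD3 : 3 ≤ D)
    (hc : ∀ i, 1 ≤ c i) (hc' : ∀ j, 1 ≤ c' j) {seg : ℕ → ℕ → Set P} (hseg : IsSegFamily r seg)
    (h1 : seg 1 1 ⊆ f '' (boxLevel 0 c 1 : Set (Fin n → ℕ))) :
    (n = 1 ∧ m = 2 ∧ (Finset.univ.filter fun j => 2 ≤ c' j).card ≤ 1) ∨
    (n = 2 ∧ m = 1 ∧ (Finset.univ.filter fun i => 2 ≤ c i).card ≤ 1) ∨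
    ∃ e : Fin n ≃ Fin m, ∀ i, c' (e i) = c i := by
  have hfin := h.finite
  have h1c : (seg 1 1).Nonempty := by
    rw [← Set.ncard_pos, hseg.ncard_seg_one (h.level_nonempty (d := 1) (by omega))]
    exact one_pos
  obtain ⟨T, U, hT, hTU, htop, hlast⟩ := h.top_estimate hD hD' hD3 hc hc' hseg h1
  obtain ⟨T', U', hT', hTU', hbot⟩ := h.bottom_estimate hD3 hc hD' hc' hseg h1 h1c
  have hf : ∀ {k : ℕ} (s : Finset (Fin k)) (b : Fin k → ℕ),
      (s.filter fun j => 2 ≤ b j).card ≤ (Finset.univ.filter fun j => 2 ≤ b j).card :=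
    fun s b => Finset.card_le_card (Finset.filter_subset_filter _ (Finset.subset_univ _))
  have hTn := T.card_le_univ
  have hTn' := T'.card_le_univ
  rw [Fintype.card_fin] at hTn hTn'
  have hUc : U'ᶜ.card = T'.card := by
    rw [Finset.card_compl, Fintype.card_fin]
    omega
  have hTc : T'ᶜ.card = n - T'.card := by rw [Finset.card_compl, Fintype.card_fin]
  have hu₂ := Finset.card_filter_le U'ᶜ fun j => 2 ≤ c' j
  have ht₂ := Finset.card_filter_le T'ᶜ fun j => 2 ≤ c j
  rw [hUc] at hu₂
  rw [hTc] at ht₂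
  rw [hUc, hTc] at hbot
  have hP := add_card_filter_two_le hc
  rw [hD] at hP
  rcases gluing_numerics (D := D) hP (fun h0 => (eq_sum_of_card_filter_two hc' h0).trans hD') hT hTn
    hTU (Finset.card_filter_le _ _) (hf T c) (Finset.card_filter_le _ _) (hf U c') htop hT' hTn'
    (by omega) ht₂ (hf _ c) hu₂ (hf _ c') hbot with h2 | h2 | ⟨h2, h3, h4⟩ | ⟨rfl, rfl, h4, h5⟩
  · exact Or.inl h2
  · exact Or.inr (Or.inl h2)
  · subst h2
    have hlast := hlast h3 (Finset.card_eq_zero.1 h4)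
    refine Or.inr (Or.inr (exists_equiv_of_card_boxLevel_eq (hD.trans hD'.symm) fun d hd => ?_))
    rcases Nat.eq_zero_or_pos d with rfl | h0
    · have e1 : ∀ b : Fin n → ℕ, boxLevel 0 b 0 = {0} := fun b => by
        ext x
        rw [mem_boxLevel_zero, Finset.mem_singleton]
        constructor
        · rintro ⟨-, hx⟩
          exact funext fun i => Finset.sum_eq_zero_iff.1 hx i (Finset.mem_univ i)
        · rintro rfl
          exact ⟨fun _ => Nat.zero_le _, by simp⟩
      rw [e1, e1]
    rcases hd.lt_or_eq with hd | rfl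
    · exact h.card_boxLevel_eq hD hD' hc hc' rfl hseg hlast h0 (by omega)
    · have e1 : ∀ b : Fin n → ℕ, ∑ i, b i = D → boxLevel 0 b D = {b} := fun b hb => by
        ext x
        rw [mem_boxLevel_zero, Finset.mem_singleton]
        constructor
        · rintro ⟨hx1, hx⟩
          exact eq_of_le_of_sum_eq hb.le x hx1 hx
        · rintro rfl
          exact ⟨le_rfl, hb⟩
      rw [hD, e1 c hD, e1 c' hD', Finset.card_singleton, Finset.card_singleton]
  · exact Or.inr (Or.inr (exists_equiv_of_two hc hc' (hD.trans hD'.symm) h4.le h5.le))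

/-- The shape of two boxes whose gluing at top and bottom is Macaulay. -/
theorem classify (hM : IsMacaulayPoset P) (hD : ∑ i, c i = D) (hD' : ∑ j, c' j = D) (hD3 : 3 ≤ D)
    (hc : ∀ i, 1 ≤ c i) (hc' : ∀ j, 1 ≤ c' j) :
    (n = 1 ∧ m = 2 ∧ (Finset.univ.filter fun j => 2 ≤ c' j).card ≤ 1) ∨
    (n = 2 ∧ m = 1 ∧ (Finset.univ.filter fun i => 2 ≤ c i).card ≤ 1) ∨
    ∃ e : Fin n ≃ Fin m, ∀ i, c' (e i) = c i := by
  have hfin := h.finite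
  obtain ⟨seg, hseg⟩ := hM.exists_isSegFamily h.rank
  obtain ⟨z, hz⟩ := Set.ncard_eq_one.1 (hseg.ncard_seg_one (h.level_nonempty (d := 1) (by omega)))
  have hzl : z ∈ level r 1 := hseg.subset 1 1 (by rw [hz]; rfl)
  rcases h.mem_level hzl with ⟨x, hx, rfl⟩ | ⟨y, hy, rfl⟩
  · refine h.classify_of_first_atom hD hD' hD3 hc hc' hseg ?_
    rw [hz, Set.singleton_subset_iff]
    exact ⟨x, hx, rfl⟩
  · rcases h.symm.classify_of_first_atom hD' hD hD3 hc' hc hseg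
      (by rw [hz, Set.singleton_subset_iff]; exact ⟨y, hy, rfl⟩) with h1 | h1 | ⟨e, he⟩
    · exact Or.inr (Or.inl ⟨h1.2.1, h1.1, h1.2.2⟩)
    · exact Or.inl ⟨h1.2.1, h1.1, h1.2.2⟩
    · exact Or.inr (Or.inr ⟨e.symm, fun i => by rw [← he, Equiv.apply_symm_apply]⟩)

end IsGluing

end DiamondNecessity


/-! ### Shadows of sets of integers in a strip. -/

section Strips

/-- The shadow of a set of integers under `t ↦ t, t + 1`, restricted to `W`. -/
def stripShadow (W X : Finset ℤ) : Finset ℤ := W.filter fun t => t ∈ X ∨ t - 1 ∈ X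

theorem mem_stripShadow {W X : Finset ℤ} {t : ℤ} :
    t ∈ stripShadow W X ↔ t ∈ W ∧ (t ∈ X ∨ t - 1 ∈ X) := Finset.mem_filter

/-- `S` is a subset of `V` that is closed under passing to larger values of `key`. -/
def IsUpIn (key : ℤ → ℤ) (V S : Finset ℤ) : Prop :=
  S ⊆ V ∧ ∀ x ∈ S, ∀ y ∈ V, key x < key y → y ∈ S

/-- The shadow from `V` to `V'` enlarges proper nonempty sets by at least `g`, with equality for
initial segments, and the whole of `V` by `h`. -/
structure HasGain (key : ℤ → ℤ) (V V' : Finset ℤ) (g h : ℤ) : Prop where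
  lower : ∀ X ⊆ V, X.Nonempty → X ≠ V → (X.card : ℤ) + g ≤ (stripShadow V' X).card
  full : stripShadow V' V = V'
  card_full : V.Nonempty → (V'.card : ℤ) = V.card + h
  seg : ∀ S, IsUpIn key V S → S.Nonempty → S ≠ V →
    ((stripShadow V' S).card : ℤ) = S.card + g ∧ IsUpIn key V' (stripShadow V' S)

theorem hasGain_empty (key : ℤ → ℤ) (g h : ℤ) : HasGain key ∅ ∅ g h where
  lower X hX hne := by
    rw [Finset.subset_empty] at hX
    simp [hX] at hne
  full := rfl
  card_full hne := by simp at hne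
  seg S hS hne := by
    rw [Finset.subset_empty.1 hS.1] at hne
    simp at hne

theorem IsUpIn.eq_Icc_of_mono {key : ℤ → ℤ} {p q : ℤ} {S : Finset ℤ}
    (hS : IsUpIn key (Finset.Icc p q) S) (hne : S.Nonempty)
    (hkey : StrictMonoOn key (Set.Icc p q)) : ∃ s, p ≤ s ∧ s ≤ q ∧ S = Finset.Icc s q := by
  obtain ⟨s, hs, hmin⟩ := Finset.exists_min_image S id hne
  have hs' := Finset.mem_Icc.1 (hS.1 hs)
  refine ⟨s, hs'.1, hs'.2, ?_⟩
  ext t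
  rw [Finset.mem_Icc]
  constructor
  · intro ht
    exact ⟨hmin t ht, (Finset.mem_Icc.1 (hS.1 ht)).2⟩
  · rintro ⟨h1, h2⟩
    rcases h1.eq_or_lt with rfl | h1
    · exact hs
    · exact hS.2 s hs t (Finset.mem_Icc.2 ⟨by omega, h2⟩) (hkey hs' ⟨by omega, h2⟩ h1)

theorem IsUpIn.eq_Icc_of_anti {key : ℤ → ℤ} {p q : ℤ} {S : Finset ℤ}
    (hS : IsUpIn key (Finset.Icc p q) S) (hne : S.Nonempty)
    (hkey : StrictAntiOn key (Set.Icc p q)) : ∃ s, p ≤ s ∧ s ≤ q ∧ S = Finset.Icc p s := by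
  obtain ⟨s, hs, hmax⟩ := Finset.exists_max_image S id hne
  have hs' := Finset.mem_Icc.1 (hS.1 hs)
  refine ⟨s, hs'.1, hs'.2, ?_⟩
  ext t
  rw [Finset.mem_Icc]
  constructor
  · intro ht
    exact ⟨(Finset.mem_Icc.1 (hS.1 ht)).1, hmax t ht⟩
  · rintro ⟨h1, h2⟩
    rcases h2.eq_or_lt with rfl | h2
    · exact hs
    · exact hS.2 s hs t (Finset.mem_Icc.2 ⟨h1, by omega⟩) (hkey ⟨h1, by omega⟩ hs' h2)

theorem isUpIn_Icc_of_mono {key : ℤ → ℤ} {p q s : ℤ} (hs : p ≤ s)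
    (hkey : StrictMonoOn key (Set.Icc p q)) : IsUpIn key (Finset.Icc p q) (Finset.Icc s q) := by
  refine ⟨Finset.Icc_subset_Icc_left hs, fun x hx y hy hxy => ?_⟩
  rw [Finset.mem_Icc] at hx hy ⊢
  have := (hkey.lt_iff_lt ⟨by omega, hx.2⟩ hy).1 hxy
  omega

theorem isUpIn_Icc_of_anti {key : ℤ → ℤ} {p q s : ℤ} (hs : s ≤ q)
    (hkey : StrictAntiOn key (Set.Icc p q)) : IsUpIn key (Finset.Icc p q) (Finset.Icc p s) := by
  refine ⟨Finset.Icc_subset_Icc_right hs, fun x hx y hy hxy => ?_⟩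
  rw [Finset.mem_Icc] at hx hy ⊢
  have := (hkey.lt_iff_gt ⟨hx.1, by omega⟩ hy).1 hxy
  omega

/-- The set itself survives, and the successor of its maximum is new. -/
theorem card_lt_stripShadow {V' X : Finset ℤ} (hX : X.Nonempty) (h0 : ∀ t ∈ X, t ∈ V')
    (h1 : ∀ t ∈ X, t + 1 ∈ V') : (X.card : ℤ) + 1 ≤ (stripShadow V' X).card := by
  obtain ⟨s, hs, hmax⟩ := Finset.exists_max_image X id hX
  have hs1 : s + 1 ∉ X := fun h => by
    have : s + 1 ≤ s := hmax _ h
    omega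
  have : insert (s + 1) X ⊆ stripShadow V' X := by
    intro t ht
    rw [mem_stripShadow]
    rcases Finset.mem_insert.1 ht with rfl | ht
    · exact ⟨h1 s hs, Or.inr (by simpa using hs)⟩
    · exact ⟨h0 t ht, Or.inl ht⟩
  have := Finset.card_le_card this
  rw [Finset.card_insert_of_notMem hs1] at this
  exact_mod_cast this

theorem card_le_stripShadow {V' X : Finset ℤ} (h0 : ∀ t ∈ X, t ∈ V') :
    (X.card : ℤ) ≤ (stripShadow V' X).card := by
  have : X ⊆ stripShadow V' X := fun t ht => mem_stripShadow.2 ⟨h0 t ht, Or.inl ht⟩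
  exact_mod_cast Finset.card_le_card this

theorem stripShadow_Icc {p q s t : ℤ} (hst : s ≤ t) :
    stripShadow (Finset.Icc p q) (Finset.Icc s t) = Finset.Icc (max p s) (min q (t + 1)) := by
  ext x
  simp only [mem_stripShadow, Finset.mem_Icc]
  omega

theorem card_Icc_int {p q : ℤ} (h : p ≤ q + 1) : ((Finset.Icc p q).card : ℤ) = q + 1 - p := by
  rw [Int.card_Icc]
  omega

theorem hasGain_grow {key : ℤ → ℤ} {p q : ℤ} (hpq : p ≤ q)
    (hkey : StrictMonoOn key (Set.Icc p (q + 1))) :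
    HasGain key (Finset.Icc p q) (Finset.Icc p (q + 1)) 1 1 where
  lower X hX hne _ := by
    refine card_lt_stripShadow hne (fun t ht => ?_) fun t ht => ?_
    all_goals
      have := Finset.mem_Icc.1 (hX ht)
      rw [Finset.mem_Icc]
      omega
  full := by rw [stripShadow_Icc hpq, max_self, min_self]
  card_full _ := by rw [card_Icc_int (by omega), card_Icc_int (by omega)]; omega
  seg S hS hne _ := by
    obtain ⟨s, h1, h2, rfl⟩ := hS.eq_Icc_of_mono hne
      (hkey.mono (Set.Icc_subset_Icc_right (by omega)))
    rw [stripShadow_Icc h2, max_eq_right h1, min_self]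
    exact ⟨by rw [card_Icc_int (by omega), card_Icc_int (by omega)]; omega,
      isUpIn_Icc_of_mono h1 hkey⟩

theorem hasGain_flat {key : ℤ → ℤ} {p q : ℤ} (hkey : StrictMonoOn key (Set.Icc p q)) :
    HasGain key (Finset.Icc p q) (Finset.Icc p q) 0 0 where
  lower X hX _ _ := by
    rw [add_zero]
    exact card_le_stripShadow hX
  full := by
    ext x
    simp only [mem_stripShadow, Finset.mem_Icc]
    omega
  card_full _ := by simp
  seg S hS hne _ := by
    obtain ⟨s, h1, h2, rfl⟩ := hS.eq_Icc_of_mono hne hkey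
    rw [stripShadow_Icc h2, max_eq_right h1, min_eq_left (by omega)]
    exact ⟨by simp, isUpIn_Icc_of_mono h1 hkey⟩

/-- Only `p` can be lost. If `p ∈ X`, then the smallest missing integer `t` has its predecessor in
`X` and replaces it. -/
theorem card_le_stripShadow_shrink {p q : ℤ} {X : Finset ℤ} (hX : X ⊆ Finset.Icc p q)
    (hne : X ≠ Finset.Icc p q) :
    (X.card : ℤ) ≤ (stripShadow (Finset.Icc (p + 1) q) X).card := by
  by_cases hp : p ∈ X
  · have hmiss : (Finset.Icc p q \ X).Nonempty := by
      rw [Finset.sdiff_nonempty]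
      exact fun h => hne (hX.antisymm h)
    obtain ⟨t, ht, hmin⟩ := Finset.exists_min_image _ id hmiss
    obtain ⟨ht1, ht2⟩ := Finset.mem_sdiff.1 ht
    rw [Finset.mem_Icc] at ht1
    have htp : t ≠ p := fun h => ht2 (h ▸ hp)
    have ht' : t - 1 ∈ X := by
      by_contra hcon
      have : t ≤ t - 1 := hmin (t - 1) (Finset.mem_sdiff.2 ⟨Finset.mem_Icc.2 (by omega), hcon⟩)
      omega
    have hsub : insert t (X.erase p) ⊆ stripShadow (Finset.Icc (p + 1) q) X := by
      intro x hx
      rw [mem_stripShadow, Finset.mem_Icc]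
      rcases Finset.mem_insert.1 hx with rfl | hx
      · exact ⟨by omega, Or.inr ht'⟩
      · obtain ⟨h1, h2⟩ := Finset.mem_erase.1 hx
        have := Finset.mem_Icc.1 (hX h2)
        exact ⟨by omega, Or.inl h2⟩
    have := Finset.card_le_card hsub
    rw [Finset.card_insert_of_notMem (fun h => ht2 (Finset.mem_of_mem_erase h)),
      Finset.card_erase_add_one hp] at this
    exact_mod_cast this
  · refine card_le_stripShadow fun t ht => ?_
    have := Finset.mem_Icc.1 (hX ht)
    have : t ≠ p := fun h => hp (h ▸ ht)
    rw [Finset.mem_Icc]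
    omega

theorem stripShadow_shrink_self (p q : ℤ) :
    stripShadow (Finset.Icc (p + 1) q) (Finset.Icc p q) = Finset.Icc (p + 1) q := by
  ext x
  simp only [mem_stripShadow, Finset.mem_Icc]
  omega

theorem card_shrink {p q : ℤ} (h : (Finset.Icc p q).Nonempty) :
    ((Finset.Icc (p + 1) q).card : ℤ) = (Finset.Icc p q).card + -1 := by
  rw [Finset.nonempty_Icc] at h
  rw [card_Icc_int (by omega), card_Icc_int (by omega)]
  omega

theorem hasGain_shrink_of_mono {key : ℤ → ℤ} {p q : ℤ} (hkey : StrictMonoOn key (Set.Icc p q)) :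
    HasGain key (Finset.Icc p q) (Finset.Icc (p + 1) q) 0 (-1) where
  lower X hX _ hX' := by
    rw [add_zero]
    exact card_le_stripShadow_shrink hX hX'
  full := stripShadow_shrink_self p q
  card_full := card_shrink
  seg S hS hne hS' := by
    obtain ⟨s, h1, h2, rfl⟩ := hS.eq_Icc_of_mono hne hkey
    have hsp : s ≠ p := by
      rintro rfl
      exact hS' rfl
    rw [stripShadow_Icc h2, max_eq_right (by omega), min_eq_left (by omega)]
    exact ⟨by simp, isUpIn_Icc_of_mono (by omega)
      (hkey.mono (Set.Icc_subset_Icc_left (by omega)))⟩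

theorem hasGain_shrink_of_anti {key : ℤ → ℤ} {p q : ℤ} (hkey : StrictAntiOn key (Set.Icc p q)) :
    HasGain key (Finset.Icc p q) (Finset.Icc (p + 1) q) 0 (-1) where
  lower X hX _ hX' := by
    rw [add_zero]
    exact card_le_stripShadow_shrink hX hX'
  full := stripShadow_shrink_self p q
  card_full := card_shrink
  seg S hS hne hS' := by
    obtain ⟨s, h1, h2, rfl⟩ := hS.eq_Icc_of_anti hne hkey
    have hsq : s ≠ q := by
      rintro rfl
      exact hS' rfl
    rw [stripShadow_Icc h1, max_eq_left (by omega), min_eq_right (by omega)]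
    exact ⟨by rw [card_Icc_int (by omega), card_Icc_int (by omega)]; omega,
      isUpIn_Icc_of_anti (by omega) (hkey.mono (Set.Icc_subset_Icc_left (by omega)))⟩

/-- Here segments must start at the lower end: `[p, s]` moves to `[p + 1, s + 1]` without growing,
whereas a proper segment at the upper end would gain one element. This is why a decreasing key is
needed. -/
theorem hasGain_shift {key : ℤ → ℤ} {p q : ℤ} (hpq : p ≤ q)
    (hkey : StrictAntiOn key (Set.Icc p (q + 1))) :
    HasGain key (Finset.Icc p q) (Finset.Icc (p + 1) (q + 1)) 0 0 where
  lower X hX _ _ := by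
    rw [add_zero, ← Finset.card_map (addRightEmbedding 1)]
    have : X.map (addRightEmbedding 1) ⊆ stripShadow (Finset.Icc (p + 1) (q + 1)) X := by
      intro x hx
      obtain ⟨t, ht, rfl⟩ := Finset.mem_map.1 hx
      have := Finset.mem_Icc.1 (hX ht)
      rw [mem_stripShadow, Finset.mem_Icc]
      simp only [addRightEmbedding_apply]
      exact ⟨by omega, Or.inr (by simpa using ht)⟩
    exact_mod_cast Finset.card_le_card this
  full := by rw [stripShadow_Icc hpq, max_eq_left (by omega), min_self]
  card_full _ := by rw [card_Icc_int (by omega), card_Icc_int (by omega)]; omega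
  seg S hS hne _ := by
    obtain ⟨s, h1, h2, rfl⟩ := hS.eq_Icc_of_anti hne
      (hkey.mono (Set.Icc_subset_Icc_right (by omega)))
    rw [stripShadow_Icc h1, max_eq_left (by omega), min_eq_right (by omega)]
    exact ⟨by rw [card_Icc_int (by omega), card_Icc_int (by omega)]; omega,
      isUpIn_Icc_of_anti (by omega) (hkey.mono (Set.Icc_subset_Icc_left (by omega)))⟩

/-- The key that lists the integers from `k` on increasingly, followed by the smaller ones
decreasingly. -/
def bitonicKey (k N t : ℤ) : ℤ := if k ≤ t then N - t else t

theorem strictMonoOn_bitonicKey {k N p q : ℤ} (hq : q < k) :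
    StrictMonoOn (bitonicKey k N) (Set.Icc p q) := by
  rintro x ⟨hx1, hx2⟩ y ⟨hy1, hy2⟩ hxy
  unfold bitonicKey
  split_ifs <;> omega

theorem strictAntiOn_bitonicKey {k N p q : ℤ} (hp : k ≤ p) :
    StrictAntiOn (bitonicKey k N) (Set.Icc p q) := by
  rintro x ⟨hx1, hx2⟩ y ⟨hy1, hy2⟩ hxy
  unfold bitonicKey
  split_ifs <;> omega

/-- Segments of the bitonic key are still intervals, so each gains exactly one element. The bound on
`N` places every integer from `k` to `d + 1` before the smaller ones. -/
theorem hasGain_bitonic {k N d : ℤ} (hk : 0 ≤ k) (hd : 0 ≤ d) (hN : k + (d + 1) ≤ N) :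
    HasGain (bitonicKey k N) (Finset.Icc 0 d) (Finset.Icc 0 (d + 1)) 1 1 where
  lower X hX hne _ := by
    refine card_lt_stripShadow hne (fun t ht => ?_) fun t ht => ?_
    all_goals
      have := Finset.mem_Icc.1 (hX ht)
      rw [Finset.mem_Icc]
      omega
  full := by rw [stripShadow_Icc hd, max_self, min_self]
  card_full _ := by rw [card_Icc_int (by omega), card_Icc_int (by omega)]; omega
  seg S hS hne _ := by
    obtain ⟨s, hs, hmin⟩ := Finset.exists_min_image S id hne
    obtain ⟨e, he, hmax⟩ := Finset.exists_max_image S id hne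
    have hs' := Finset.mem_Icc.1 (hS.1 hs)
    have he' := Finset.mem_Icc.1 (hS.1 he)
    have hSe : S = Finset.Icc s e := by
      ext t
      rw [Finset.mem_Icc]
      refine ⟨fun ht => ⟨hmin t ht, hmax t ht⟩, fun ⟨h1, h2⟩ => ?_⟩
      have ht : t ∈ Finset.Icc 0 d := Finset.mem_Icc.2 (by omega)
      by_contra hcon
      have h3 : t ≠ s := fun h => hcon (h ▸ hs)
      have h4 : t ≠ e := fun h => hcon (h ▸ he)
      have h5 := mt (hS.2 s hs t ht) hcon
      have h6 := mt (hS.2 e he t ht) hcon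
      unfold bitonicKey at h5 h6
      split_ifs at h5 h6 <;> omega
    have hse : s ≤ e := hmin e he
    -- Either the segment has used up everything from `k` on and extends downward, or it starts at
    -- `k` and extends upward; the shadow `[s, e + 1]` has the same shape one level higher.
    have hshape : s < k ∧ e = d ∨ s = k := by
      rcases lt_or_ge s k with hsk | hsk
      · refine Or.inl ⟨hsk, ?_⟩
        by_contra hed
        have h1 : d ≤ e := hmax d (hS.2 s hs d (Finset.mem_Icc.2 (by omega)) (by
          unfold bitonicKey
          split_ifs <;> omega))
        omega
      · refine Or.inr ?_
        by_contra hsk'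
        have h1 : s ≤ k := hmin k (hS.2 s hs k (Finset.mem_Icc.2 (by omega)) (by
          unfold bitonicKey
          split_ifs <;> omega))
        omega
    rw [hSe, stripShadow_Icc hse, max_eq_right hs'.1, min_eq_right (by omega)]
    refine ⟨by rw [card_Icc_int (by omega), card_Icc_int (by omega)]; omega,
      Finset.Icc_subset_Icc hs'.1 (by omega), fun x hx y hy hxy => ?_⟩
    rw [Finset.mem_Icc] at hx hy ⊢
    unfold bitonicKey at hxy
    split_ifs at hxy <;> omega

end Strips

/-! ### Levels with two components that do not interact. -/

section TwoComponents

/-- The Macaulay condition for a single level of a strip. -/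
def IsStripOptimal (key : ℤ → ℤ) (V V' : Finset ℤ) : Prop :=
  ∀ A S, A ⊆ V → IsUpIn key V S → S.card = A.card →
    (stripShadow V' S).card ≤ (stripShadow V' A).card ∧ IsUpIn key V' (stripShadow V' S)

/-- The separation hypotheses say that no step of length `0` or `1` leads from one component to the
other, so the shadow splits. -/
theorem stripShadow_union {T F T' F' X : Finset ℤ} (hX : X ⊆ T ∪ F)
    (hT : ∀ t ∈ T', t ∉ F ∧ t - 1 ∉ F) (hF : ∀ t ∈ F', t ∉ T ∧ t - 1 ∉ T) :
    stripShadow (T' ∪ F') X = stripShadow T' (X ∩ T) ∪ stripShadow F' (X ∩ F) := by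
  ext t
  have h1 : t ∈ X → t ∈ T ∨ t ∈ F := fun h => Finset.mem_union.1 (hX h)
  have h2 : t - 1 ∈ X → t - 1 ∈ T ∨ t - 1 ∈ F := fun h => Finset.mem_union.1 (hX h)
  have h3 := hT t
  have h4 := hF t
  simp only [mem_stripShadow, Finset.mem_union, Finset.mem_inter]
  tauto

theorem card_stripShadow_union {T F T' F' X : Finset ℤ} (hX : X ⊆ T ∪ F)
    (hT : ∀ t ∈ T', t ∉ F ∧ t - 1 ∉ F) (hF : ∀ t ∈ F', t ∉ T ∧ t - 1 ∉ T)
    (hd : Disjoint T' F') : (stripShadow (T' ∪ F') X).card =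
      (stripShadow T' (X ∩ T)).card + (stripShadow F' (X ∩ F)).card := by
  rw [stripShadow_union hX hT hF, Finset.card_union_of_disjoint]
  exact hd.mono (Finset.filter_subset _ _) (Finset.filter_subset _ _)

theorem stripShadow_empty (W : Finset ℤ) : stripShadow W ∅ = ∅ := by
  ext t
  simp [mem_stripShadow]

/-- Each part is empty, full or proper, with change `0`, `h` or at least `g`. The conditions compare
filling `T` first with every alternative. For instance `c3` handles a proper part of `T` against all
of `F`, `c6` the two ways of having one part full and the other proper, and `c7` a segment spilling
into `F` against a set inside `F`. -/
theorem two_component_numerics {T F gT hT gF hF xT xF sT sF yT yF uT uF : ℤ} (hx : xT + xF = yT + yF)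
    (hyT : 0 ≤ yT ∧ yT ≤ T) (hyF : 0 ≤ yF ∧ yF ≤ F) (hfirst : 0 < xF → xT = T)
    (hxT : xT = 0 ∧ sT = 0 ∨ xT = T ∧ 0 < xT ∧ sT = xT + hT ∨ 0 < xT ∧ xT < T ∧ sT = xT + gT)
    (hxF : xF = 0 ∧ sF = 0 ∨ xF = F ∧ 0 < xF ∧ sF = xF + hF ∨ 0 < xF ∧ xF < F ∧ sF = xF + gF)
    (hAT : yT = 0 ∧ uT = 0 ∨ yT = T ∧ 0 < yT ∧ uT = yT + hT ∨ 0 < yT ∧ yT < T ∧ yT + gT ≤ uT)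
    (hAF : yF = 0 ∧ uF = 0 ∨ yF = F ∧ 0 < yF ∧ uF = yF + hF ∨ 0 < yF ∧ yF < F ∧ yF + gF ≤ uF)
    (c1 : 0 ≤ gT) (c2 : gT ≤ gF) (c3 : gT ≤ hF ∨ T ≤ F) (c4 : hT ≤ hF) (c5 : hT ≤ gT)
    (c6 : gF - hF ≤ gT - hT) (c7 : gT = 0 ∨ F ≤ T) : sT + sF ≤ uT + uF := by
  rcases hxT with h1 | h1 | h1 <;> rcases hxF with h2 | h2 | h2 <;>
    rcases hAT with h3 | h3 | h3 <;> rcases hAF with h4 | h4 | h4 <;> omega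

/-- A level with two components that do not interact, the first of which precedes the second. -/
theorem isStripOptimal_union {key : ℤ → ℤ} {T F T' F' : Finset ℤ} {gT hT gF hF : ℤ}
    (hgT : HasGain key T T' gT hT) (hgF : HasGain key F F' gF hF)
    (hsT : ∀ t ∈ T', t ∉ F ∧ t - 1 ∉ F) (hsF : ∀ t ∈ F', t ∉ T ∧ t - 1 ∉ T)
    (hkey : ∀ t ∈ T, ∀ u ∈ F, key u < key t) (hkey' : ∀ t ∈ T', ∀ u ∈ F', key u < key t)
    (c1 : 0 ≤ gT) (c2 : gT ≤ gF) (c3 : gT ≤ hF ∨ T.card ≤ F.card) (c4 : hT ≤ hF) (c5 : hT ≤ gT)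
    (c6 : gF - hF ≤ gT - hT) (c7 : gT = 0 ∨ F.card ≤ T.card) :
    IsStripOptimal key (T ∪ F) (T' ∪ F') := by
  have hd : Disjoint T F := Finset.disjoint_left.2 fun t h1 h2 => (hkey t h1 t h2).false
  have hd' : Disjoint T' F' := Finset.disjoint_left.2 fun t h1 h2 => (hkey' t h1 t h2).false
  have hTT' : T = ∅ → T' = ∅ := fun h => by
    rw [← hgT.full, h, stripShadow_empty]
  have hFF' : F = ∅ → F' = ∅ := fun h => by
    rw [← hgF.full, h, stripShadow_empty]
  have hlow : ∀ {V V' : Finset ℤ} {g h : ℤ}, HasGain key V V' g h → ∀ X ⊆ V,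
      (X.card : ℤ) = 0 ∧ ((stripShadow V' X).card : ℤ) = 0 ∨
      (X.card : ℤ) = V.card ∧ 0 < (X.card : ℤ) ∧ ((stripShadow V' X).card : ℤ) = X.card + h ∨
      0 < (X.card : ℤ) ∧ (X.card : ℤ) < V.card ∧ (X.card : ℤ) + g ≤ (stripShadow V' X).card := by
    intro V V' g h hg X hX
    rcases X.eq_empty_or_nonempty with rfl | hne
    · exact Or.inl ⟨by simp, by simp [stripShadow_empty]⟩
    have hpos : 0 < (X.card : ℤ) := by exact_mod_cast Finset.card_pos.2 hne
    by_cases h1 : X = V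
    · subst h1
      exact Or.inr (Or.inl ⟨rfl, hpos, by rw [hg.full, hg.card_full hne]⟩)
    · exact Or.inr (Or.inr ⟨hpos,
        by exact_mod_cast Finset.card_lt_card (hX.ssubset_of_ne h1), hg.lower X hX hne h1⟩)
  have hseg : ∀ {V V' : Finset ℤ} {g h : ℤ}, HasGain key V V' g h → ∀ X, IsUpIn key V X →
      (X.card : ℤ) = 0 ∧ ((stripShadow V' X).card : ℤ) = 0 ∨
      (X.card : ℤ) = V.card ∧ 0 < (X.card : ℤ) ∧ ((stripShadow V' X).card : ℤ) = X.card + h ∨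
      0 < (X.card : ℤ) ∧ (X.card : ℤ) < V.card ∧
        ((stripShadow V' X).card : ℤ) = X.card + g := by
    intro V V' g h hg X hX
    rcases hlow hg X hX.1 with h1 | h1 | h1
    · exact Or.inl h1
    · exact Or.inr (Or.inl h1)
    · refine Or.inr (Or.inr ⟨h1.1, h1.2.1, (hg.seg X hX ?_ ?_).1⟩)
      · exact Finset.card_pos.1 (by exact_mod_cast h1.1)
      · rintro rfl
        exact h1.2.1.false
  have hsplit : ∀ X ⊆ T ∪ F, (X.card : ℤ) = (X ∩ T).card + (X ∩ F).card := by
    intro X hX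
    rw [← Nat.cast_add, ← Finset.card_union_of_disjoint
      (hd.mono Finset.inter_subset_right Finset.inter_subset_right), ← Finset.inter_union_distrib_left,
      Finset.inter_eq_left.2 hX]
  intro A S hA hS hcard
  have hTup : IsUpIn key T (S ∩ T) := ⟨Finset.inter_subset_right, fun x hx y hy hxy =>
    Finset.mem_inter.2 ⟨hS.2 x (Finset.mem_inter.1 hx).1 y (Finset.mem_union_left _ hy) hxy, hy⟩⟩
  have hFup : IsUpIn key F (S ∩ F) := ⟨Finset.inter_subset_right, fun x hx y hy hxy =>
    Finset.mem_inter.2 ⟨hS.2 x (Finset.mem_inter.1 hx).1 y (Finset.mem_union_right _ hy) hxy, hy⟩⟩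
  have hfirst : S ∩ F ≠ ∅ → S ∩ T = T := by
    intro h
    obtain ⟨u, hu⟩ := Finset.nonempty_iff_ne_empty.2 h
    obtain ⟨hu1, hu2⟩ := Finset.mem_inter.1 hu
    exact Finset.inter_eq_right.2 fun t ht =>
      hS.2 u hu1 t (Finset.mem_union_left _ ht) (hkey t ht u hu2)
  have hSc := hsplit S hS.1
  have hAc := hsplit A hA
  rw [hcard, hAc] at hSc
  constructor
  · rw [card_stripShadow_union hS.1 hsT hsF hd', card_stripShadow_union hA hsT hsF hd']
    zify at c3 c7 ⊢
    refine two_component_numerics hSc.symm ⟨by omega, ?_⟩ ⟨by omega, ?_⟩ (fun h => ?_)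
      (hseg hgT _ hTup) (hseg hgF _ hFup) (hlow hgT _ Finset.inter_subset_right)
      (hlow hgF _ Finset.inter_subset_right) c1 c2 c3 c4 c5 c6 c7
    · exact_mod_cast Finset.card_le_card Finset.inter_subset_right
    · exact_mod_cast Finset.card_le_card Finset.inter_subset_right
    · rw [hfirst]
      exact Finset.nonempty_iff_ne_empty.1 (Finset.card_pos.1 (by exact_mod_cast h))
  · rw [stripShadow_union hS.1 hsT hsF]
    have hu1 : IsUpIn key T' (stripShadow T' (S ∩ T)) := by
      by_cases h0 : S ∩ T = ∅
      · rw [h0, stripShadow_empty]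
        exact ⟨Finset.empty_subset _, by simp⟩
      by_cases h1 : S ∩ T = T
      · rw [h1, hgT.full]
        exact ⟨subset_rfl, fun _ _ y hy _ => hy⟩
      · exact (hgT.seg _ hTup (Finset.nonempty_iff_ne_empty.2 h0) h1).2
    have hu2 : IsUpIn key F' (stripShadow F' (S ∩ F)) := by
      by_cases h0 : S ∩ F = ∅
      · rw [h0, stripShadow_empty]
        exact ⟨Finset.empty_subset _, by simp⟩
      by_cases h1 : S ∩ F = F
      · rw [h1, hgF.full]
        exact ⟨subset_rfl, fun _ _ y hy _ => hy⟩
      · exact (hgF.seg _ hFup (Finset.nonempty_iff_ne_empty.2 h0) h1).2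
    refine ⟨Finset.union_subset_union hu1.1 hu2.1, fun x hx y hy hxy => ?_⟩
    rcases Finset.mem_union.1 hy with hy | hy
    · rcases Finset.mem_union.1 hx with hx | hx
      · exact Finset.mem_union_left _ (hu1.2 x hx y hy hxy)
      · have hne : S ∩ F ≠ ∅ := by
          intro h
          rw [h, stripShadow_empty] at hx
          simp at hx
        rw [hfirst hne, hgT.full]
        exact Finset.mem_union_left _ hy
    · rcases Finset.mem_union.1 hx with hx | hx
      · exact absurd (hkey' x (hu1.1 hx) y hy) hxy.not_gt
      · exact Finset.mem_union_right _ (hu2.2 x hx y hy hxy)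

end TwoComponents

/-- A single component is the case of an empty first one, whose constants are free to choose; `0`
and `-1` meet all side conditions. -/
theorem HasGain.isStripOptimal {key : ℤ → ℤ} {V V' : Finset ℤ} {g h : ℤ} (hg : HasGain key V V' g h)
    (h0 : 0 ≤ g) (h1 : -1 ≤ h) (h2 : g - h ≤ 1) : IsStripOptimal key V V' := by
  have := isStripOptimal_union (hasGain_empty key 0 (-1)) hg (by simp) (by simp) (by simp) (by simp)
    le_rfl h0 (Or.inr (by simp)) h1 (by simp) (by simpa using h2) (Or.inl rfl)
  rwa [Finset.empty_union, Finset.empty_union] at this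


/-! ### Coding poset levels by integers. -/

section StripLevels

variable {P : Type*} [PartialOrder P]

/-- The levels `d` and `d + 1` of a poset, coded by the sets of integers `V` and `V'` such that
covering relations correspond to steps of length `0` and `1`. -/
structure IsStripLevel (r : P → ℕ) (τ : P → ℤ) (d : ℕ) (V V' : Finset ℤ) : Prop where
  inj : ∀ x y, r x = d → r y = d → τ x = τ y → x = y
  inj' : ∀ x y, r x = d + 1 → r y = d + 1 → τ x = τ y → x = y
  mem : ∀ t, t ∈ V ↔ ∃ x, r x = d ∧ τ x = t
  mem' : ∀ t, t ∈ V' ↔ ∃ x, r x = d + 1 ∧ τ x = t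
  cov : ∀ x z, r x = d → (x ⋖ z ↔ r z = d + 1 ∧ (τ z = τ x ∨ τ z = τ x + 1))

namespace IsStripLevel

variable {r : P → ℕ} {τ : P → ℤ} {d : ℕ} {V V' : Finset ℤ}

/-- Transport of a set in level `d` and its shadow to sets of integers. -/
theorem exists_code [Finite P] (h : IsStripLevel r τ d V V') {A : Set P} (hA : A ⊆ level r d) :
    ∃ X ⊆ V, X.card = A.ncard ∧ (∀ x, r x = d → (τ x ∈ X ↔ x ∈ A)) ∧
      (stripShadow V' X).card = (upperShadow A).ncard ∧
      ∀ z, τ z ∈ stripShadow V' X ∧ r z = d + 1 ↔ z ∈ upperShadow A := by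
  classical
  have := Fintype.ofFinite P
  have hr : ∀ x ∈ A, r x = d := fun x hx => hA hx
  have hmem : ∀ x, r x = d → (τ x ∈ A.toFinset.image τ ↔ x ∈ A) := by
    intro x hx
    rw [Finset.mem_image]
    constructor
    · rintro ⟨y, hy, hxy⟩
      rw [Set.mem_toFinset] at hy
      rwa [← h.inj y x (hr y hy) hx hxy]
    · exact fun hxA => ⟨x, Set.mem_toFinset.2 hxA, rfl⟩
  have hsh : ∀ z, τ z ∈ stripShadow V' (A.toFinset.image τ) ∧ r z = d + 1 ↔ z ∈ upperShadow A := by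
    intro z
    rw [mem_stripShadow]
    constructor
    · rintro ⟨⟨-, hz⟩, hrz⟩
      rcases hz with hz | hz
      all_goals
        obtain ⟨x, hx, hxz⟩ := Finset.mem_image.1 hz
        rw [Set.mem_toFinset] at hx
        refine ⟨x, hx, (h.cov x z (hr x hx)).2 ⟨hrz, by omega⟩⟩
    · rintro ⟨x, hx, hxz⟩
      obtain ⟨h1, h2⟩ := (h.cov x z (hr x hx)).1 hxz
      refine ⟨⟨(h.mem' _).2 ⟨z, h1, rfl⟩, ?_⟩, h1⟩
      have hx' := (hmem x (hr x hx)).2 hx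
      rcases h2 with h2 | h2
      · exact Or.inl (h2 ▸ hx')
      · exact Or.inr (by rwa [h2, add_sub_cancel_right])
  refine ⟨A.toFinset.image τ, ?_, ?_, hmem, ?_, hsh⟩
  · intro t ht
    obtain ⟨x, hx, rfl⟩ := Finset.mem_image.1 ht
    exact (h.mem _).2 ⟨x, hr x (Set.mem_toFinset.1 hx), rfl⟩
  · rw [Finset.card_image_of_injOn, Set.ncard_eq_toFinset_card']
    intro x hx y hy
    simp only [Set.coe_toFinset] at hx hy
    exact h.inj x y (hr x hx) (hr y hy)
  · have : stripShadow V' (A.toFinset.image τ) = (upperShadow A).toFinset.image τ := by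
      ext t
      rw [Finset.mem_image]
      constructor
      · intro ht
        obtain ⟨z, hz, rfl⟩ := (h.mem' t).1 (mem_stripShadow.1 ht).1
        exact ⟨z, Set.mem_toFinset.2 ((hsh z).1 ⟨ht, hz⟩), rfl⟩
      · rintro ⟨z, hz, rfl⟩
        exact ((hsh z).2 (Set.mem_toFinset.1 hz)).1
    rw [this, Finset.card_image_of_injOn, Set.ncard_eq_toFinset_card']
    intro x hx y hy
    simp only [Set.coe_toFinset] at hx hy
    exact h.inj' x y ((hsh x).2 hx).2 ((hsh y).2 hy).2

theorem isUpIn_code (h : IsStripLevel r τ d V V') {key : ℤ → ℤ} {S : Set P}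
    (hS : IsUpSegment r (fun x => key (τ x)) d S) {X : Finset ℤ} (hX : X ⊆ V)
    (hmem : ∀ x, r x = d → (τ x ∈ X ↔ x ∈ S)) : IsUpIn key V X := by
  refine ⟨hX, fun s hs t ht hst => ?_⟩
  obtain ⟨x, hx, rfl⟩ := (h.mem s).1 (hX hs)
  obtain ⟨y, hy, rfl⟩ := (h.mem t).1 ht
  exact (hmem y hy).2 (hS.2 x ((hmem x hx).1 hs) y hy hst)

theorem macaulay_of_isStripOptimal [Finite P] (h : IsStripLevel r τ d V V') {key : ℤ → ℤ}
    (hopt : IsStripOptimal key V V') (A S : Set P) (hA : A ⊆ level r d)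
    (hS : IsUpSegment r (fun x => key (τ x)) d S) (hSA : S.ncard = A.ncard) :
    (upperShadow S).ncard ≤ (upperShadow A).ncard ∧
      IsUpSegment r (fun x => key (τ x)) (d + 1) (upperShadow S) := by
  obtain ⟨X, hXV, hX1, hX2, hX3, hX4⟩ := h.exists_code hA
  obtain ⟨Y, hYV, hY1, hY2, hY3, hY4⟩ := h.exists_code hS.1
  obtain ⟨h1, h2⟩ := hopt X Y hXV (h.isUpIn_code hS hYV hY2) (by rw [hX1, hY1, hSA])
  refine ⟨by rwa [← hX3, ← hY3], fun z hz => ((hY4 z).2 hz).2, fun x hx y hy hxy => ?_⟩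
  exact (hY4 y).1 ⟨h2.2 _ ((hY4 x).2 hx).1 _ ((h.mem' _).2 ⟨y, hy, rfl⟩) hxy, hy⟩

end IsStripLevel

end StripLevels

/-! ### Coding boxes in one or two variables and their gluings. -/

section StripBoxes

/-- The levels `d` and `d + 1` of a box, coded by sets of integers. -/
structure IsStripBox {n : ℕ} (c : Fin n → ℕ) (α : (Fin n → ℕ) → ℤ) (d : ℕ) (V V' : Finset ℤ) :
    Prop where
  inj : ∀ x ∈ boxLevel 0 c d, ∀ y ∈ boxLevel 0 c d, α x = α y → x = y
  inj' : ∀ x ∈ boxLevel 0 c (d + 1), ∀ y ∈ boxLevel 0 c (d + 1), α x = α y → x = y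
  mem : ∀ t, t ∈ V ↔ ∃ x ∈ boxLevel 0 c d, α x = t
  mem' : ∀ t, t ∈ V' ↔ ∃ x ∈ boxLevel 0 c (d + 1), α x = t
  cov : ∀ x ∈ boxLevel 0 c d, ∀ y ∈ boxLevel 0 c (d + 1),
    (∃ i, x + Pi.single i 1 = y) ↔ α y = α x ∨ α y = α x + 1

/-- On a level, coordinate `i` determines the vector. Raising `i` is a step of length one, raising
`j` a step of length zero. -/
theorem isStripBox_two {c : Fin 2 → ℕ} {i j : Fin 2} (hij : i ≠ j) (k : ℤ) (d : ℕ) :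
    IsStripBox c (fun x => (x i : ℤ) + k) d
      (Finset.Icc (max 0 ((d : ℤ) - c j) + k) (min (c i : ℤ) d + k))
      (Finset.Icc (max 0 ((d + 1 : ℤ) - c j) + k) (min (c i : ℤ) (d + 1) + k)) := by
  have hcase : ∀ l : Fin 2, l = i ∨ l = j := by omega
  have hsum : ∀ x : Fin 2 → ℕ, ∑ l, x l = x i + x j := by
    intro x
    rw [Fin.sum_univ_two]
    rcases hcase 0 with h0 | h0 <;> rcases hcase 1 with h1 | h1
    · exact absurd (h0.trans h1.symm) zero_ne_one
    · rw [← h0, ← h1]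
    · rw [← h0, ← h1, add_comm]
    · exact absurd (h0.trans h1.symm) zero_ne_one
  have hext : ∀ x y : Fin 2 → ℕ, x i = y i → x j = y j → x = y := by
    intro x y h1 h2
    funext l
    rcases hcase l with rfl | rfl
    · exact h1
    · exact h2
  have hlev : ∀ e (x : Fin 2 → ℕ), x ∈ boxLevel 0 c e ↔ x i ≤ c i ∧ x j ≤ c j ∧ x i + x j = e := by
    intro e x
    rw [mem_boxLevel_zero, hsum, ← and_assoc]
    refine and_congr_left fun _ => ⟨fun h => ⟨h i, h j⟩, fun h l => ?_⟩
    rcases hcase l with rfl | rfl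
    · exact h.1
    · exact h.2
  have hinj : ∀ e, ∀ x ∈ boxLevel 0 c e, ∀ y ∈ boxLevel 0 c e, (x i : ℤ) + k = y i + k → x = y := by
    intro e x hx y hy hxy
    rw [hlev] at hx hy
    exact hext x y (by omega) (by omega)
  have hmem : ∀ (e : ℕ) t, t ∈ Finset.Icc (max 0 ((e : ℤ) - c j) + k) (min (c i : ℤ) e + k) ↔
      ∃ x ∈ boxLevel 0 c e, (x i : ℤ) + k = t := by
    intro e t
    rw [Finset.mem_Icc]
    constructor
    · rintro ⟨h1, h2⟩
      refine ⟨fun l => if l = i then (t - k).toNat else e - (t - k).toNat, ?_, ?_⟩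
      · rw [hlev]
        simp only [if_true, if_neg hij.symm]
        omega
      · simp only [if_true]
        omega
    · rintro ⟨x, hx, rfl⟩
      rw [hlev] at hx
      omega
  refine ⟨hinj d, hinj (d + 1), hmem d, by exact_mod_cast hmem (d + 1), fun x hx y hy => ?_⟩
  rw [hlev] at hx hy
  have hji := hij.symm
  constructor
  · rintro ⟨l, rfl⟩
    rcases hcase l with rfl | rfl
    · right
      simp
      ring
    · left
      simp [hij]
  · rintro (h1 | h1)
    · refine ⟨j, hext _ _ ?_ ?_⟩ <;> simp [hij]
      · omega
      · omega
    · refine ⟨i, hext _ _ ?_ ?_⟩ <;> simp [hji]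
      · omega
      · omega

theorem isStripBox_one {c : Fin 1 → ℕ} (k : ℤ) {d : ℕ} (hd : d < c 0) :
    IsStripBox c (fun _ => k) d (Finset.Icc k k) (Finset.Icc k k) := by
  have hlev : ∀ e (x : Fin 1 → ℕ), x ∈ boxLevel 0 c e ↔ x 0 ≤ c 0 ∧ x 0 = e := by
    intro e x
    rw [mem_boxLevel_zero, Fin.sum_univ_one]
    simp [Pi.le_def]
  have hinj : ∀ e, ∀ x ∈ boxLevel 0 c e, ∀ y ∈ boxLevel 0 c e, k = k → x = y := by
    intro e x hx y hy _
    rw [hlev] at hx hy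
    funext l
    rw [Subsingleton.elim l 0]
    omega
  have hmem : ∀ e ≤ c 0, ∀ t, t ∈ Finset.Icc k k ↔ ∃ x ∈ boxLevel 0 c e, k = t := by
    intro e he t
    rw [Finset.Icc_self, Finset.mem_singleton]
    constructor
    · rintro rfl
      exact ⟨fun _ => e, (hlev _ _).2 ⟨he, rfl⟩, rfl⟩
    · rintro ⟨x, -, rfl⟩
      rfl
  refine ⟨hinj d, hinj (d + 1), hmem d hd.le, hmem (d + 1) hd, fun x hx y hy => ?_⟩
  rw [hlev] at hx hy
  refine ⟨fun _ => Or.inl rfl, fun _ => ⟨0, ?_⟩⟩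
  funext l
  rw [Subsingleton.elim l 0]
  simp
  omega

/-- The code of a gluing is injective on a level between the bottom and the top. -/
theorem IsGluing.code_injective {P : Type*} [PartialOrder P] {n m : ℕ} {r : P → ℕ} {D : ℕ}
    {c : Fin n → ℕ} {c' : Fin m → ℕ} {f : (Fin n → ℕ) → P} {g : (Fin m → ℕ) → P}
    (h : IsGluing r D c c' f g) {α : (Fin n → ℕ) → ℤ} {β : (Fin m → ℕ) → ℤ} {e : ℕ} (h0 : 0 < e)
    (hD : e < D) (h1 : ∀ x ∈ boxLevel 0 c e, ∀ y ∈ boxLevel 0 c e, α x = α y → x = y)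
    (h2 : ∀ x ∈ boxLevel 0 c' e, ∀ y ∈ boxLevel 0 c' e, β x = β y → x = y)
    (h3 : ∀ x ∈ boxLevel 0 c e, ∀ y ∈ boxLevel 0 c' e, α x ≠ β y) {x y : P} (hrx : r x = e)
    (hry : r y = e) (hxy : gluingCode c c' f g α β x = gluingCode c c' f g α β y) : x = y := by
  have hcf : ∀ {x}, x ∈ boxLevel 0 c e → gluingCode c c' f g α β (f x) = α x :=
    fun hx => h.code_f _ _ (mem_boxLevel_zero.1 hx).1
  have hcg : ∀ {y}, y ∈ boxLevel 0 c' e → gluingCode c c' f g α β (g y) = β y := by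
    intro y hy
    rw [mem_boxLevel_zero] at hy
    exact h.code_g _ _ hy.1 (by omega) (by omega)
  rcases h.mem_level hrx with ⟨x, hx, rfl⟩ | ⟨x, hx, rfl⟩ <;>
    rcases h.mem_level hry with ⟨y, hy, rfl⟩ | ⟨y, hy, rfl⟩
  · rw [hcf hx, hcf hy] at hxy
    rw [h1 x hx y hy hxy]
  · rw [hcf hx, hcg hy] at hxy
    exact absurd hxy (h3 x hx y hy)
  · rw [hcf hy, hcg hx] at hxy
    exact absurd hxy.symm (h3 y hy x hx)
  · rw [hcg hx, hcg hy] at hxy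
    rw [h2 x hx y hy hxy]

/-- A level of a gluing of two boxes is coded by the union of the codes of the boxes. -/
theorem IsGluing.isStripLevel {P : Type*} [PartialOrder P] {n m : ℕ} {r : P → ℕ} {D : ℕ}
    {c : Fin n → ℕ} {c' : Fin m → ℕ} {f : (Fin n → ℕ) → P} {g : (Fin m → ℕ) → P}
    (h : IsGluing r D c c' f g) {α : (Fin n → ℕ) → ℤ} {β : (Fin m → ℕ) → ℤ} {d : ℕ}
    {T T' F F' : Finset ℤ} (hd : 0 < d) (hdD : d + 1 < D) (hα : IsStripBox c α d T T')
    (hβ : IsStripBox c' β d F F') (hsT : ∀ t ∈ T', t ∉ F ∧ t - 1 ∉ F)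
    (hsF : ∀ t ∈ F', t ∉ T ∧ t - 1 ∉ T) (hTF : Disjoint T F) (hTF' : Disjoint T' F') :
    IsStripLevel r (gluingCode c c' f g α β) d (T ∪ F) (T' ∪ F') := by
  have hcf : ∀ {e x}, x ∈ boxLevel 0 c e → gluingCode c c' f g α β (f x) = α x :=
    fun hx => h.code_f _ _ (mem_boxLevel_zero.1 hx).1
  have hcg : ∀ {e y}, 0 < e → e < D → y ∈ boxLevel 0 c' e →
      gluingCode c c' f g α β (g y) = β y := by
    intro e y h0 hD hy
    rw [mem_boxLevel_zero] at hy
    exact h.code_g _ _ hy.1 (by omega) (by omega)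
  have hrf : ∀ {e x}, x ∈ boxLevel 0 c e → r (f x) = e :=
    fun hx => h.image_subset_level _ ⟨_, hx, rfl⟩
  have hrg : ∀ {e y}, y ∈ boxLevel 0 c' e → r (g y) = e :=
    fun hy => h.symm.image_subset_level _ ⟨_, hy, rfl⟩
  have hne : ∀ {e : ℕ} {T F : Finset ℤ}, (∀ t, t ∈ T ↔ ∃ x ∈ boxLevel 0 c e, α x = t) →
      (∀ t, t ∈ F ↔ ∃ x ∈ boxLevel 0 c' e, β x = t) → Disjoint T F →
      ∀ x ∈ boxLevel 0 c e, ∀ y ∈ boxLevel 0 c' e, α x ≠ β y := by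
    intro e T F h3 h4 h5 x hx y hy hxy
    exact Finset.disjoint_left.1 h5 ((h3 _).2 ⟨x, hx, hxy⟩) ((h4 _).2 ⟨y, hy, rfl⟩)
  have hmem : ∀ {e : ℕ} {T F : Finset ℤ}, 0 < e → e < D →
      (∀ t, t ∈ T ↔ ∃ x ∈ boxLevel 0 c e, α x = t) →
      (∀ t, t ∈ F ↔ ∃ x ∈ boxLevel 0 c' e, β x = t) →
      ∀ t, t ∈ T ∪ F ↔ ∃ x, r x = e ∧ gluingCode c c' f g α β x = t := by
    intro e T F h0 hD h1 h2 t
    rw [Finset.mem_union, h1, h2]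
    constructor
    · rintro (⟨x, hx, rfl⟩ | ⟨x, hx, rfl⟩)
      · exact ⟨f x, hrf hx, hcf hx⟩
      · exact ⟨g x, hrg hx, hcg h0 hD hx⟩
    · rintro ⟨z, hz, rfl⟩
      rcases h.mem_level hz with ⟨x, hx, rfl⟩ | ⟨x, hx, rfl⟩
      · exact Or.inl ⟨x, hx, (hcf hx).symm⟩
      · exact Or.inr ⟨x, hx, (hcg h0 hD hx).symm⟩
  refine ⟨fun x y => h.code_injective hd (by omega) hα.inj hβ.inj (hne hα.mem hβ.mem hTF),
    fun x y => h.code_injective (Nat.succ_pos d) hdD hα.inj' hβ.inj' (hne hα.mem' hβ.mem' hTF'), hmem hd (by omega) hα.mem hβ.mem,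
    hmem (Nat.succ_pos d) hdD hα.mem' hβ.mem', fun x z hrx => ?_⟩
  rcases h.mem_level hrx with ⟨x, hx, rfl⟩ | ⟨x, hx, rfl⟩
  · rw [h.covBy_image hd hx]
    constructor
    · rintro ⟨i, hi, rfl⟩
      refine ⟨hrf hi, ?_⟩
      rw [hcf hx, hcf hi]
      exact (hα.cov x hx _ hi).1 ⟨i, rfl⟩
    · rintro ⟨hz, hxz⟩
      rw [hcf hx] at hxz
      rcases h.mem_level hz with ⟨y, hy, rfl⟩ | ⟨y, hy, rfl⟩
      · rw [hcf hy] at hxz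
        obtain ⟨i, rfl⟩ := (hα.cov x hx y hy).2 hxz
        exact ⟨i, hy, rfl⟩
      · rw [hcg (Nat.succ_pos d) hdD hy] at hxz
        obtain ⟨h1, h2⟩ := hsF _ ((hβ.mem' _).2 ⟨y, hy, rfl⟩)
        have hxT := (hα.mem _).2 ⟨x, hx, rfl⟩
        rcases hxz with hxz | hxz
        · exact absurd (hxz ▸ hxT) h1
        · exact absurd (by rwa [hxz, add_sub_cancel_right]) h2
  · rw [h.symm.covBy_image hd hx]
    constructor
    · rintro ⟨i, hi, rfl⟩
      refine ⟨hrg hi, ?_⟩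
      rw [hcg hd (by omega) hx, hcg (Nat.succ_pos d) hdD hi]
      exact (hβ.cov x hx _ hi).1 ⟨i, rfl⟩
    · rintro ⟨hz, hxz⟩
      rw [hcg hd (by omega) hx] at hxz
      rcases h.mem_level hz with ⟨y, hy, rfl⟩ | ⟨y, hy, rfl⟩
      · rw [hcf hy] at hxz
        obtain ⟨h1, h2⟩ := hsT _ ((hα.mem' _).2 ⟨y, hy, rfl⟩)
        have hxT := (hβ.mem _).2 ⟨x, hx, rfl⟩
        rcases hxz with hxz | hxz
        · exact absurd (hxz ▸ hxT) h1
        · exact absurd (by rwa [hxz, add_sub_cancel_right]) h2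
      · rw [hcg (Nat.succ_pos d) hdD hy] at hxz
        obtain ⟨i, rfl⟩ := (hβ.cov x hx y hy).2 hxz
        exact ⟨i, hy, rfl⟩

theorem IsStripBox.card_eq {n : ℕ} {c : Fin n → ℕ} {α : (Fin n → ℕ) → ℤ} {d : ℕ} {V V' : Finset ℤ}
    (h : IsStripBox c α d V V') : V.card = (boxLevel 0 c d).card := by
  have : V = (boxLevel 0 c d).image α := by
    ext t
    rw [h.mem, Finset.mem_image]
  rw [this, Finset.card_image_of_injOn]
  exact fun x hx y hy => h.inj x hx y hy

theorem IsStripBox.card_eq' {n : ℕ} {c : Fin n → ℕ} {α : (Fin n → ℕ) → ℤ} {d : ℕ} {V V' : Finset ℤ}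
    (h : IsStripBox c α d V V') : V'.card = (boxLevel 0 c (d + 1)).card := by
  have : V' = (boxLevel 0 c (d + 1)).image α := by
    ext t
    rw [h.mem', Finset.mem_image]
  rw [this, Finset.card_image_of_injOn]
  exact fun x hx y hy => h.inj' x hx y hy

end StripBoxes


/-! ### The wedge of two boxes in two variables. -/

section TwoBoxes

/-- The code of level `d` of the box with side lengths `p` and `q`, shifted by `k`. -/
noncomputable def boxCode (p q k d : ℤ) : Finset ℤ := Finset.Icc (max 0 (d - q) + k) (min p d + k)

theorem mem_boxCode {p q k d t : ℤ} :
    t ∈ boxCode p q k d ↔ max 0 (d - q) + k ≤ t ∧ t ≤ min p d + k := Finset.mem_Icc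

/-- A box passes through three phases: its levels grow below the short side, stay flat up to the
long side, and shrink afterwards. The sizes are recorded only for the growing and shrinking phases,
where two boxes in the same phase must be compared. -/
theorem exists_hasGain_boxCode {p q d : ℤ} (k : ℤ) (hpq : p ≤ q) (hd : 0 ≤ d) :
    ∃ g h, HasGain id (boxCode p q k d) (boxCode p q k (d + 1)) g h ∧
      (d < p ∧ g = 1 ∧ h = 1 ∧ (boxCode p q k d).card = d + 1 ∨
        p ≤ d ∧ d < q ∧ g = 0 ∧ h = 0 ∨
        q ≤ d ∧ g = 0 ∧ h = -1 ∧ (boxCode p q k d).card = (p + q + 1 - d).toNat) := by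
  have hid : ∀ s : Set ℤ, StrictMonoOn id s := fun s => strictMonoOn_id
  unfold boxCode
  rcases lt_or_ge d p with h1 | h1
  · rw [show max 0 (d - q) + k = k by omega, show max 0 (d + 1 - q) + k = k by omega,
      show min p d + k = d + k by omega, show min p (d + 1) + k = d + k + 1 by omega]
    exact ⟨1, 1, hasGain_grow (by omega) (hid _), Or.inl ⟨h1, rfl, rfl, by
      rw [card_Icc_int (by omega)]
      omega⟩⟩
  rcases lt_or_ge d q with h2 | h2
  · rw [show max 0 (d - q) + k = k by omega, show max 0 (d + 1 - q) + k = k by omega,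
      show min p d + k = p + k by omega, show min p (d + 1) + k = p + k by omega]
    exact ⟨0, 0, hasGain_flat (hid _), Or.inr (Or.inl ⟨h1, h2, rfl, rfl⟩)⟩
  · rw [show max 0 (d - q) + k = d - q + k by omega,
      show max 0 (d + 1 - q) + k = d - q + k + 1 by omega,
      show min p d + k = p + k by omega, show min p (d + 1) + k = p + k by omega]
    refine ⟨0, -1, hasGain_shrink_of_mono (hid _), Or.inr (Or.inr ⟨h2, rfl, rfl, ?_⟩)⟩
    rw [Int.card_Icc]
    congr 1
    omega

variable {P : Type*} [PartialOrder P] {r : P → ℕ} {D : ℕ} {c c' : Fin 2 → ℕ}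
  {f g : (Fin 2 → ℕ) → P}

/-- The strip coordinate on the gluing of two boxes in two variables. -/
noncomputable def twoBoxCode (c c' : Fin 2 → ℕ) (f g : (Fin 2 → ℕ) → P) : P → ℤ :=
  gluingCode c c' f g (fun x => (x 0 : ℤ) + 0) fun y => (y 0 : ℤ) + -(c' 0 + 2)

omit [PartialOrder P] in
theorem isStripBox_boxCode (c : Fin 2 → ℕ) (k : ℤ) (d : ℕ) : IsStripBox c (fun x => (x 0 : ℤ) + k) d
    (boxCode (c 0) (c 1) k d) (boxCode (c 0) (c 1) k (d + 1)) :=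
  isStripBox_two zero_ne_one k d

/-- Codes of the first box are nonnegative. The shift `-(p' + 2)` puts those of the second at most
at `-2`, so even a step of length one does not reach the first. -/
theorem boxCode_separated {p q p' q' d d' : ℤ} : ∀ t ∈ boxCode p q 0 d,
    t ∉ boxCode p' q' (-(p' + 2)) d' ∧ t - 1 ∉ boxCode p' q' (-(p' + 2)) d' := by
  intro t ht
  rw [mem_boxCode] at ht
  simp only [mem_boxCode]
  omega

theorem boxCode_separated' {p q p' q' d d' : ℤ} :
    ∀ t ∈ boxCode p' q' (-(p' + 2)) d', t ∉ boxCode p q 0 d ∧ t - 1 ∉ boxCode p q 0 d := by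
  intro t ht
  rw [mem_boxCode] at ht
  simp only [mem_boxCode]
  omega

theorem IsGluing.isStripLevel_two (h : IsGluing r D c c' f g) {d : ℕ} (hd : 0 < d)
    (hdD : d + 1 < D) : IsStripLevel r (twoBoxCode c c' f g) d
      (boxCode (c 0) (c 1) 0 d ∪ boxCode (c' 0) (c' 1) (-(c' 0 + 2)) d)
      (boxCode (c 0) (c 1) 0 (d + 1) ∪ boxCode (c' 0) (c' 1) (-(c' 0 + 2)) (d + 1)) :=
  h.isStripLevel hd hdD (isStripBox_boxCode c 0 d) (isStripBox_boxCode c' _ d)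
    boxCode_separated boxCode_separated'
    (Finset.disjoint_left.2 fun t ht => (boxCode_separated t ht).1)
    (Finset.disjoint_left.2 fun t ht => (boxCode_separated t ht).1)

theorem IsGluing.eq_bot {n m : ℕ} {c : Fin n → ℕ} {c' : Fin m → ℕ} {f : (Fin n → ℕ) → P}
    {g : (Fin m → ℕ) → P} (h : IsGluing r D c c' f g) {z : P} (hz : r z = 0) : z = f 0 := by
  have hx0 : ∀ {k : ℕ} {b x : Fin k → ℕ}, x ∈ boxLevel 0 b 0 → x = 0 := fun hx =>
    funext fun i => Finset.sum_eq_zero_iff.1 (mem_boxLevel_zero.1 hx).2 i (Finset.mem_univ i)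
  rcases h.mem_level hz with ⟨x, hx, rfl⟩ | ⟨x, hx, rfl⟩
  · rw [hx0 hx]
  · rw [hx0 hx, h.f_zero]

/-- Two boxes in two variables, one contained in the other and glued at the bottom, form a Macaulay
poset. -/
theorem IsGluing.isMacaulayPoset_of_le (h : IsGluing r D c c' f g) (hD : ∑ i, c i + 1 < D)
    (hD' : ∑ j, c' j + 1 < D) (hc : c 0 ≤ c 1) (hc' : c' 0 ≤ c' 1) (h0 : c 0 ≤ c' 0)
    (h1 : c 1 ≤ c' 1) : IsMacaulayPoset P := by
  have hfin := h.finite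
  have hle : ∀ z, r z + 1 < D := fun z => by
    rcases h.surj z with ⟨x, hx, rfl⟩ | ⟨y, hy, rfl⟩
    · rw [h.f_rank x hx]
      exact lt_of_le_of_lt (Nat.succ_le_succ (Finset.sum_le_sum fun i _ => hx i)) hD
    · rw [h.g_rank y hy]
      exact lt_of_le_of_lt (Nat.succ_le_succ (Finset.sum_le_sum fun i _ => hy i)) hD'
  refine isMacaulayPoset_of_key h.rank (fun x => id (twoBoxCode c c' f g x)) ?_ fun d => ?_
  · intro x y hxy hk
    rcases Nat.eq_zero_or_pos (r x) with hx | hx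
    · rw [h.eq_bot hx, h.eq_bot (hxy.symm.trans hx)]
    · exact (h.isStripLevel_two hx (hle x)).inj x y rfl hxy.symm hk
  rcases Nat.eq_zero_or_pos d with rfl | hd
  · exact Or.inl fun A hA hne => h.full_zero hA hne
  by_cases hdD : d + 1 < D
  · refine Or.inr ((h.isStripLevel_two hd hdD).macaulay_of_isStripOptimal ?_)
    obtain ⟨gT, hT, hgT, hstT⟩ := exists_hasGain_boxCode (p := c 0) (q := c 1) (d := d) 0
      (by exact_mod_cast hc) (by omega)
    obtain ⟨gF, hF, hgF, hstF⟩ := exists_hasGain_boxCode (p := c' 0) (q := c' 1) (d := d)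
      (-(c' 0 + 2)) (by exact_mod_cast hc') (by omega)
    -- The smaller box is served first: it leaves each phase no later than the other, so its gains
    -- are never larger. While both grow, the levels have equal size; while both shrink, its level
    -- is the smaller one.
    refine isStripOptimal_union hgT hgF boxCode_separated
      boxCode_separated' ?_ ?_ (by omega) (by omega) (by omega) (by omega) (by omega)
      (by omega) (by omega)
    · intro t ht u hu
      rw [mem_boxCode] at ht hu
      simp only [id]
      omega
    · intro t ht u hu
      rw [mem_boxCode] at ht hu
      simp only [id]
      omega
  · refine Or.inl fun A hA hne => ?_
    obtain ⟨z, hz⟩ := hne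
    have hrz : r z = d := hA hz
    have := hle z
    omega

theorem HasGain.card_le {key : ℤ → ℤ} {V V' X : Finset ℤ} {g h : ℤ} (hg : HasGain key V V' g h)
    (hX : X ⊆ V) (h0 : 0 ≤ g) (h1 : X ≠ V ∨ 0 ≤ h) : X.card ≤ (stripShadow V' X).card := by
  rcases X.eq_empty_or_nonempty with rfl | hne
  · simp
  by_cases hXV : X = V
  · subst hXV
    have := hg.card_full hne
    rw [hg.full]
    rcases h1 with h1 | h1
    · exact absurd rfl h1
    · omega
  · have := hg.lower X hX hne hXV
    omega

theorem HasGain.card_lt {key : ℤ → ℤ} {V V' X : Finset ℤ} {g h : ℤ} (hg : HasGain key V V' g h)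
    (hX : X ⊆ V) (hne : X.Nonempty) (h0 : 1 ≤ g) (h1 : 1 ≤ h) :
    X.card < (stripShadow V' X).card := by
  by_cases hXV : X = V
  · subst hXV
    have := hg.card_full hne
    rw [hg.full]
    omega
  · have := hg.lower X hX hne hXV
    omega

theorem card_inter_add_card_inter {T F X : Finset ℤ} (hd : Disjoint T F) (hX : X ⊆ T ∪ F) :
    (X ∩ T).card + (X ∩ F).card = X.card := by
  rw [← Finset.card_union_of_disjoint
    (hd.mono Finset.inter_subset_right Finset.inter_subset_right), ← Finset.inter_union_distrib_left,
    Finset.inter_eq_left.2 hX]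

/-- The first box stops growing earlier, which forces every order to begin with it at level `c 0`;
but the second box starts shrinking earlier, and at level `c' 1` beginning with the second would be
strictly better. -/
theorem IsGluing.not_isMacaulayPoset (h : IsGluing r D c c' f g) (hD : ∑ i, c i + 1 < D)
    (hc : 0 < c 0) (h0 : c 0 < c' 0) (h1 : c' 0 ≤ c' 1)
    (h2 : c' 1 < c 1) : ¬ IsMacaulayPoset P := by
  intro hM
  have hfin := h.finite
  obtain ⟨seg, hseg⟩ := hM.exists_isSegFamily h.rank
  rw [Fin.sum_univ_two] at hD
  -- At level `c 0` the whole level of the first box keeps its size under the shadow. A segment of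
  -- that size meeting the still growing second box would gain.
  have hstep1 : seg (c 0) 1 ⊆ f '' (boxLevel 0 c (c 0) : Set (Fin 2 → ℕ)) := by
    intro z hz
    rcases h.mem_level (hseg.subset _ _ hz) with ⟨x, hx, rfl⟩ | ⟨y, hy, rfl⟩
    · exact ⟨x, hx, rfl⟩
    exfalso
    have hst := h.isStripLevel_two hc (by omega)
    obtain ⟨gT, hT, hgT, hstT⟩ := exists_hasGain_boxCode (p := c 0) (q := c 1) (d := c 0) 0
      (by omega) (by omega)
    obtain ⟨gF, hF, hgF, hstF⟩ := exists_hasGain_boxCode (p := c' 0) (q := c' 1) (d := c 0)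
      (-(c' 0 + 2)) (by omega) (by omega)
    have hA := h.image_subset_level (c 0)
    have hAc := h.ncard_image (d := c 0) subset_rfl
    have hAs : (upperShadow (f '' (boxLevel 0 c (c 0) : Set (Fin 2 → ℕ)))).ncard =
        (boxLevel 0 c (c 0 + 1)).card := by
      rw [h.upperShadow_image hc, h.ncard_image (d := c 0 + 1) subset_rfl]
    have hTc := (isStripBox_boxCode c 0 (c 0)).card_eq
    have hTc' := (isStripBox_boxCode c 0 (c 0)).card_eq'
    obtain ⟨x0, hx0⟩ := boxLevel_nonempty (c := c) (d := c 0) (by rw [Fin.sum_univ_two]; omega)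
    have hpos := Finset.card_pos.2 ⟨x0, hx0⟩
    have hTfull := hgT.card_full (Finset.card_pos.1 (hTc ▸ hpos))
    set S := seg (c 0) (f '' (boxLevel 0 c (c 0) : Set (Fin 2 → ℕ))).ncard with hS
    have hSl : S ⊆ level r (c 0) := hseg.subset _ _
    have hSc : S.ncard = _ := hseg.ncard_seg hA
    have hsh := (hseg.shadow _ _ hA).1
    rw [← hS] at hsh
    have hzS : g y ∈ S := hseg.mono _ (by omega) hz
    obtain ⟨Y, hYV, hY1, hY2, hY3, -⟩ := hst.exists_code hSl
    have hgy : twoBoxCode c c' f g (g y) ∈ Y ∩ boxCode (c' 0) (c' 1) (-(c' 0 + 2)) (c 0) := by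
      refine Finset.mem_inter.2 ⟨(hY2 _ (hseg.subset _ _ hz)).2 hzS, ?_⟩
      have hy' := mem_boxLevel_zero.1 hy
      refine ((isStripBox_boxCode c' (-(c' 0 + 2)) (c 0)).mem _).2 ⟨y, hy, ?_⟩
      rw [twoBoxCode, h.code_g _ _ hy'.1 (by omega) (by omega)]
    rw [card_stripShadow_union hYV boxCode_separated boxCode_separated'
      (Finset.disjoint_left.2 fun t ht => (boxCode_separated t ht).1)] at hY3
    have e1 := hgT.card_le (X := Y ∩ boxCode (c 0) (c 1) 0 (c 0)) Finset.inter_subset_right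
      (by omega) (Or.inr (by omega))
    have e2 := hgF.card_lt (X := Y ∩ boxCode (c' 0) (c' 1) (-(c' 0 + 2)) (c 0))
      Finset.inter_subset_right ⟨_, hgy⟩ (by omega) (by omega)
    have e3 := card_inter_add_card_inter
      (Finset.disjoint_left.2 fun t ht => (boxCode_separated t ht).1) hYV
    omega
  have hstep2 := h.seg_one_subset hseg hc hstep1 (d := c' 1) (by omega)
    (by rw [Fin.sum_univ_two]; omega)
  have hd0 : 0 < c' 1 := by omega
  have hst := h.isStripLevel_two hd0 (by omega)
  obtain ⟨gT, hT, hgT, hstT⟩ := exists_hasGain_boxCode (p := c 0) (q := c 1) (d := c' 1) 0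
    (by omega) (by omega)
  obtain ⟨gF, hF, hgF, hstF⟩ := exists_hasGain_boxCode (p := c' 0) (q := c' 1) (d := c' 1)
    (-(c' 0 + 2)) (by omega) (by omega)
  have hA := h.symm.image_subset_level (c' 1)
  have hAc := h.symm.ncard_image (d := c' 1) subset_rfl
  have hAs : (upperShadow (g '' (boxLevel 0 c' (c' 1) : Set (Fin 2 → ℕ)))).ncard =
      (boxLevel 0 c' (c' 1 + 1)).card := by
    rw [h.symm.upperShadow_image hd0, h.symm.ncard_image (d := c' 1 + 1) subset_rfl]
  have hFc := (isStripBox_boxCode c' (-(c' 0 + 2)) (c' 1)).card_eq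
  have hFc' := (isStripBox_boxCode c' (-(c' 0 + 2)) (c' 1)).card_eq'
  obtain ⟨x0, hx0⟩ := boxLevel_nonempty (c := c') (d := c' 1) (by rw [Fin.sum_univ_two]; omega)
  have hpos := Finset.card_pos.2 ⟨x0, hx0⟩
  have hFfull := hgF.card_full (Finset.card_pos.1 (hFc ▸ hpos))
  set S := seg (c' 1) (g '' (boxLevel 0 c' (c' 1) : Set (Fin 2 → ℕ))).ncard with hS
  have hSl : S ⊆ level r (c' 1) := hseg.subset _ _
  have hSc : S.ncard = _ := hseg.ncard_seg hA
  have hsh := (hseg.shadow _ _ hA).1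
  rw [← hS] at hsh
  obtain ⟨z, hz⟩ := Set.ncard_eq_one.1
    (hseg.ncard_seg_one (h.level_nonempty (d := c' 1) (by rw [Fin.sum_univ_two]; omega)))
  have hz1 : z ∈ seg (c' 1) 1 := by rw [hz]; rfl
  obtain ⟨x, hx, rfl⟩ := hstep2 hz1
  have hzS : f x ∈ S := hseg.mono _ (by omega) hz1
  obtain ⟨Y, hYV, hY1, hY2, hY3, -⟩ := hst.exists_code hSl
  have hfx : twoBoxCode c c' f g (f x) ∈ Y ∩ boxCode (c 0) (c 1) 0 (c' 1) := by
    refine Finset.mem_inter.2 ⟨(hY2 _ (hseg.subset _ _ hz1)).2 hzS, ?_⟩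
    refine ((isStripBox_boxCode c 0 (c' 1)).mem _).2 ⟨x, hx, ?_⟩
    rw [twoBoxCode, h.code_f _ _ (mem_boxLevel_zero.1 hx).1]
  rw [card_stripShadow_union hYV boxCode_separated boxCode_separated'
    (Finset.disjoint_left.2 fun t ht => (boxCode_separated t ht).1)] at hY3
  have e3 := card_inter_add_card_inter
    (Finset.disjoint_left.2 fun t ht => (boxCode_separated t ht).1) hYV
  have e4 := Finset.card_pos.2 ⟨_, hfx⟩
  have e1 := hgT.card_le (X := Y ∩ boxCode (c 0) (c 1) 0 (c' 1)) Finset.inter_subset_right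
    (by omega) (Or.inr (by omega))
  -- As the segment contains an element of the first box, it is too small to contain the whole level
  -- of the second, and only the whole level shrinks.
  have e2 := hgF.card_le (X := Y ∩ boxCode (c' 0) (c' 1) (-(c' 0 + 2)) (c' 1))
    Finset.inter_subset_right (by omega) (Or.inl fun he => by
      rw [he] at e3
      omega)
  omega

/-- The gluing at the bottom of two boxes in two variables is Macaulay if and only if one of the
boxes is contained in the other. -/
theorem IsGluing.isMacaulayPoset_iff_le (h : IsGluing r D c c' f g) (hD : ∑ i, c i + 1 < D)
    (hD' : ∑ j, c' j + 1 < D) (hc : c 0 ≤ c 1) (hc' : c' 0 ≤ c' 1) (hpos : 0 < c 0)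
    (hpos' : 0 < c' 0) :
    IsMacaulayPoset P ↔ (c 0 ≤ c' 0 ∧ c 1 ≤ c' 1) ∨ (c' 0 ≤ c 0 ∧ c' 1 ≤ c 1) := by
  constructor
  · intro hM
    by_contra hcon
    rcases lt_or_ge (c 0) (c' 0) with h0 | h0
    · exact h.not_isMacaulayPoset hD hpos h0 hc' (by omega) hM
    · exact h.symm.not_isMacaulayPoset hD' hpos' (by omega) hc (by omega) hM
  · rintro (⟨h0, h1⟩ | ⟨h0, h1⟩)
    · exact h.isMacaulayPoset_of_le hD hD' hc hc' h0 h1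
    · exact h.symm.isMacaulayPoset_of_le hD' hD hc' hc h0 h1

end TwoBoxes

/-! ### A chain glued to a box of width one. -/

section ChainAndStrip

variable {P : Type*} [PartialOrder P] {r : P → ℕ} {D : ℕ} {c : Fin 1 → ℕ} {c' : Fin 2 → ℕ}
  {f : (Fin 1 → ℕ) → P} {g : (Fin 2 → ℕ) → P}

/-- A chain and a box of width one, glued at top and bottom, form a Macaulay poset. -/
theorem IsGluing.isMacaulayPoset_of_chain (h : IsGluing r D c c' f g) (hD : ∑ i, c i = D)
    (hD' : ∑ j, c' j = D) (htop : f c = g c') (hpos : ∀ j, 1 ≤ c' j) {j : Fin 2} (hj : c' j = 1) :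
    IsMacaulayPoset P := by
  have hfin := h.finite
  obtain ⟨j', hjj'⟩ : ∃ j' : Fin 2, j ≠ j' := ⟨1 - j, by omega⟩
  have hsum : c' j + c' j' = D := by
    rw [← hD', Fin.sum_univ_two]
    rcases (by omega : j = 0 ∧ j' = 1 ∨ j = 1 ∧ j' = 0) with ⟨rfl, rfl⟩ | ⟨rfl, rfl⟩
    · rfl
    · rw [add_comm]
  have hc0 : c 0 = D := by rw [← hD, Fin.sum_univ_one]
  have hj' := hpos j'
  -- Every middle level of the box has two elements, coded `0` and `1`. The chain gets the code `3`,
  -- out of reach of a step from `1`.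
  have hmid : ∀ {d : ℕ}, 0 < d → d + 1 < D →
      IsStripBox c' (fun x => (x j : ℤ) + 0) d (Finset.Icc 0 1) (Finset.Icc 0 1) := by
    intro d h1 h2
    have := isStripBox_two (c := c') hjj' 0 d
    rwa [show max 0 ((d : ℤ) - c' j') + 0 = 0 by omega,
      show max 0 ((d : ℤ) + 1 - c' j') + 0 = 0 by omega,
      show min (c' j : ℤ) d + 0 = 1 by omega, show min (c' j : ℤ) (d + 1) + 0 = 1 by omega] at this
  have hinj : ∀ {x y : P}, 0 < r x → r x < D → r x = r y →
      gluingCode c c' f g (fun _ => 3) (fun x => (x j : ℤ) + 0) x =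
        gluingCode c c' f g (fun _ => 3) (fun x => (x j : ℤ) + 0) y → x = y := by
    intro x y h1 h2 hxy hk
    refine h.code_injective h1 h2 (isStripBox_one 3 (by omega)).inj
      (isStripBox_two (c := c') hjj' 0 (r x)).inj ?_ rfl hxy.symm hk
    intro _ _ y hy he
    have : y j ≤ c' j := (mem_boxLevel_zero.1 hy).1 j
    omega
  refine isMacaulayPoset_of_key h.rank
    (fun x => id (gluingCode c c' f g (fun _ => 3) (fun x => (x j : ℤ) + 0) x)) ?_ fun d => ?_
  · intro x y hxy hk
    rcases Nat.eq_zero_or_pos (r x) with hx | hx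
    · rw [h.eq_bot hx, h.eq_bot (hxy.symm.trans hx)]
    rcases (h.rank_le hD.le hD'.le x).eq_or_lt with hx' | hx'
    · rw [h.eq_top hD hD' htop hx', h.eq_top hD hD' htop (hxy.symm.trans hx')]
    · exact hinj hx hx' hxy hk
  by_cases hd : 0 < d ∧ d + 1 < D
  · have hT := hasGain_flat (p := 3) (q := 3) (strictMonoOn_id (s := Set.Icc 3 3))
    have hF := hasGain_flat (p := 0) (q := 1) (strictMonoOn_id (s := Set.Icc 0 1))
    have hs1 : ∀ t ∈ Finset.Icc (3 : ℤ) 3, t ∉ Finset.Icc (0 : ℤ) 1 ∧ t - 1 ∉ Finset.Icc (0 : ℤ) 1 := by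
      intro t
      simp only [Finset.mem_Icc]
      omega
    have hs2 : ∀ t ∈ Finset.Icc (0 : ℤ) 1, t ∉ Finset.Icc (3 : ℤ) 3 ∧ t - 1 ∉ Finset.Icc (3 : ℤ) 3 := by
      intro t
      simp only [Finset.mem_Icc]
      omega
    have hk : ∀ t ∈ Finset.Icc (3 : ℤ) 3, ∀ u ∈ Finset.Icc (0 : ℤ) 1, id u < id t := by
      intro t ht u hu
      rw [Finset.mem_Icc] at ht hu
      simp only [id]
      omega
    have hdisj := Finset.disjoint_left.2 fun t ht => (hs1 t ht).1
    exact Or.inr ((h.isStripLevel hd.1 hd.2 (isStripBox_one 3 (by omega)) (hmid hd.1 hd.2) hs1 hs2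
      hdisj hdisj).macaulay_of_isStripOptimal (isStripOptimal_union hT hF hs1 hs2 hk hk le_rfl le_rfl
        (Or.inl le_rfl) le_rfl le_rfl le_rfl (Or.inl rfl)))
  · exact Or.inl fun A hA hne => h.full_of_not_mid hD hD' htop hd hA hne

end ChainAndStrip


/-! ### Unions of two planar boxes: the heart. -/

section Regions

variable {P : Type*} [PartialOrder P]

/-- `P` is the poset of lattice points `(u, v)` in the region `R`, with unit steps as covering
relations. -/
structure IsRegion (r : P → ℕ) (R : ℕ → ℕ → Prop) (u v : P → ℕ) : Prop where
  rank : IsRankFunction r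
  mem : ∀ z, R (u z) (v z)
  surj : ∀ i j, R i j → ∃ z, u z = i ∧ v z = j
  inj : ∀ z w, u z = u w → v z = v w → z = w
  rank_eq : ∀ z, r z = u z + v z
  cov : ∀ z w, z ⋖ w ↔ (u w = u z + 1 ∧ v w = v z) ∨ (u w = u z ∧ v w = v z + 1)

/-- The region that is the union of two boxes with side lengths `a₀, a₁` and `b₀, b₁`. -/
def heartRegion (a₀ a₁ b₀ b₁ i j : ℕ) : Prop := (i < a₀ ∧ j < a₁) ∨ (i < b₀ ∧ j < b₁)

namespace IsRegion

variable {r : P → ℕ} {R : ℕ → ℕ → Prop} {u v : P → ℕ}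

theorem swap (h : IsRegion r R u v) : IsRegion r (fun i j => R j i) v u where
  rank := h.rank
  mem := h.mem
  surj i j hR := by
    obtain ⟨z, h1, h2⟩ := h.surj j i hR
    exact ⟨z, h2, h1⟩
  inj z w h1 h2 := h.inj z w h2 h1
  rank_eq z := by rw [h.rank_eq, add_comm]
  cov z w := by
    rw [h.cov]
    tauto

theorem congr (h : IsRegion r R u v) {R' : ℕ → ℕ → Prop} (hR : ∀ i j, R i j ↔ R' i j) :
    IsRegion r R' u v := by
  have : R = R' := funext fun i => funext fun j => propext (hR i j)
  exact this ▸ h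

theorem isStripLevel (h : IsRegion r R u v) {d : ℕ} {V V' : Finset ℤ}
    (hV : ∀ t, t ∈ V ↔ ∃ i j : ℕ, R i j ∧ i + j = d ∧ (j : ℤ) = t)
    (hV' : ∀ t, t ∈ V' ↔ ∃ i j : ℕ, R i j ∧ i + j = d + 1 ∧ (j : ℤ) = t) :
    IsStripLevel r (fun z => (v z : ℤ)) d V V' := by
  have hinj : ∀ e x y, r x = e → r y = e → (v x : ℤ) = v y → x = y := by
    intro e x y hx hy hxy
    rw [h.rank_eq] at hx hy
    exact h.inj x y (by omega) (by omega)
  have hmem : ∀ (e : ℕ) (t : ℤ), (∃ i j : ℕ, R i j ∧ i + j = e ∧ (j : ℤ) = t) ↔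
      ∃ x, r x = e ∧ (v x : ℤ) = t := by
    intro e t
    constructor
    · rintro ⟨i, j, hR, he, rfl⟩
      obtain ⟨z, rfl, rfl⟩ := h.surj i j hR
      exact ⟨z, by rw [h.rank_eq, he], rfl⟩
    · rintro ⟨z, hz, rfl⟩
      exact ⟨u z, v z, h.mem z, by rw [← h.rank_eq, hz], rfl⟩
  refine ⟨hinj d, hinj (d + 1), fun t => (hV t).trans (hmem d t),
    fun t => (hV' t).trans (hmem (d + 1) t), fun x z hx => ?_⟩
  rw [h.cov, h.rank_eq z]
  rw [h.rank_eq] at hx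
  omega

theorem finite {a₀ a₁ b₀ b₁ : ℕ} (h : IsRegion r (heartRegion a₀ a₁ b₀ b₁) u v) : Finite P := by
  refine Finite.of_injective (β := Fin (a₀ + b₀) × Fin (a₁ + b₁))
    (fun z => (⟨u z, ?_⟩, ⟨v z, ?_⟩)) fun z w hzw => ?_
  · rcases h.mem z with h1 | h1 <;> omega
  · rcases h.mem z with h1 | h1 <;> omega
  · simp only [Prod.mk.injEq, Fin.mk.injEq] at hzw
    exact h.inj z w hzw.1 hzw.2

/-- A region whose levels satisfy the Macaulay condition for a common key. -/
theorem isMacaulayPoset_of_key [Finite P] (h : IsRegion r R u v) {key : ℤ → ℤ}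
    (hinj : ∀ z w, key (v z) = key (v w) → v z = v w) {V : ℕ → Finset ℤ}
    (hV : ∀ d t, t ∈ V d ↔ ∃ i j : ℕ, R i j ∧ i + j = d ∧ (j : ℤ) = t)
    (hopt : ∀ d, IsStripOptimal key (V d) (V (d + 1))) : IsMacaulayPoset P := by
  refine _root_.isMacaulayPoset_of_key h.rank (fun z => key (v z)) (fun x y hxy hk => ?_) fun d =>
    Or.inr ((h.isStripLevel (hV d) (hV (d + 1))).macaulay_of_isStripOptimal (hopt d))
  rw [h.rank_eq, h.rank_eq] at hxy
  have := hinj x y hk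
  exact h.inj x y (by omega) this

end IsRegion

/-- The code of level `d` of the region `heartRegion a₀ a₁ b₀ b₁`. -/
noncomputable def heartLevel (a₀ a₁ b₀ b₁ d : ℕ) : Finset ℤ :=
  open Classical in
  ((Finset.range (d + 1)).filter fun j => heartRegion a₀ a₁ b₀ b₁ (d - j) j).map Nat.castEmbedding

theorem mem_heartLevel {a₀ a₁ b₀ b₁ d : ℕ} {t : ℤ} : t ∈ heartLevel a₀ a₁ b₀ b₁ d ↔
    0 ≤ t ∧ t ≤ d ∧ ((d - t < a₀ ∧ t < a₁) ∨ (d - t < b₀ ∧ t < b₁)) := by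
  classical
  rw [heartLevel, Finset.mem_map]
  constructor
  · rintro ⟨j, hj, rfl⟩
    obtain ⟨h1, h2⟩ := Finset.mem_filter.1 hj
    rw [Finset.mem_range] at h1
    unfold heartRegion at h2
    simp only [Nat.castEmbedding_apply]
    omega
  · intro h
    refine ⟨t.toNat, Finset.mem_filter.2 ⟨Finset.mem_range.2 (by omega), ?_⟩, ?_⟩
    · unfold heartRegion
      omega
    · simp only [Nat.castEmbedding_apply]
      omega

theorem mem_heartLevel_iff_exists {a₀ a₁ b₀ b₁ d : ℕ} {t : ℤ} : t ∈ heartLevel a₀ a₁ b₀ b₁ d ↔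
    ∃ i j : ℕ, heartRegion a₀ a₁ b₀ b₁ i j ∧ i + j = d ∧ (j : ℤ) = t := by
  rw [mem_heartLevel]
  unfold heartRegion
  constructor
  · intro h
    exact ⟨d - t.toNat, t.toNat, by omega, by omega, by omega⟩
  · rintro ⟨i, j, h1, h2, rfl⟩
    omega

variable {r : P → ℕ} {u v : P → ℕ} {a₀ a₁ b₀ b₁ : ℕ}

/-- A box that is at least as wide as it is high, with its lexicographic order. -/
theorem IsRegion.isMacaulayPoset_of_box (h : IsRegion r (heartRegion a₀ a₁ b₀ b₁) u v)
    (h0 : a₀ ≤ b₀) (h1 : a₁ ≤ b₁) (hb : b₁ ≤ b₀) : IsMacaulayPoset P := by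
  have hfin := h.finite
  refine h.isMacaulayPoset_of_key (key := id) (fun z w hzw => by simpa using hzw)
    (fun d t => mem_heartLevel_iff_exists) fun d => ?_
  have hid : ∀ s : Set ℤ, StrictMonoOn id s := fun s => strictMonoOn_id
  -- The box `a` is contained in the box `b`, so the region is a single box and each level a single
  -- interval.
  have hV : ∀ e : ℕ, heartLevel a₀ a₁ b₀ b₁ e =
      Finset.Icc (max 0 ((e : ℤ) + 1 - b₀)) (min ((b₁ : ℤ) - 1) e) := by
    intro e
    ext t
    rw [mem_heartLevel, Finset.mem_Icc]
    omega
  rw [hV d, hV (d + 1)]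
  push_cast
  rcases lt_or_ge (d + 1) b₁ with hd | hd
  · rw [show max 0 ((d : ℤ) + 1 - b₀) = 0 by omega, show max 0 ((d : ℤ) + 1 + 1 - b₀) = 0 by omega,
      show min ((b₁ : ℤ) - 1) d = d by omega, show min ((b₁ : ℤ) - 1) (d + 1) = d + 1 by omega]
    exact (hasGain_grow (by omega) (hid _)).isStripOptimal (by omega) (by omega) (by omega)
  rcases lt_or_ge (d + 1) b₀ with hd' | hd'
  · rw [show max 0 ((d : ℤ) + 1 - b₀) = 0 by omega, show max 0 ((d : ℤ) + 1 + 1 - b₀) = 0 by omega,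
      show min ((b₁ : ℤ) - 1) d = b₁ - 1 by omega,
      show min ((b₁ : ℤ) - 1) (d + 1) = b₁ - 1 by omega]
    exact (hasGain_flat (hid _)).isStripOptimal (by omega) (by omega) (by omega)
  · rw [show max 0 ((d : ℤ) + 1 - b₀) = d + 1 - b₀ by omega,
      show max 0 ((d : ℤ) + 1 + 1 - b₀) = d + 1 - b₀ + 1 by omega,
      show min ((b₁ : ℤ) - 1) d = b₁ - 1 by omega,
      show min ((b₁ : ℤ) - 1) (d + 1) = b₁ - 1 by omega]
    exact (hasGain_shrink_of_mono (hid _)).isStripOptimal (by omega) (by omega) (by omega)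

-- From this degree on, the antidiagonal passes outside the common part of the two boxes, and the
-- level falls into one interval for each.
omit [PartialOrder P] in
theorem heartLevel_eq_union {d : ℕ} (hd : a₁ + b₀ ≤ d + 1) :
    heartLevel a₀ a₁ b₀ b₁ d = Finset.Icc ((d : ℤ) + 1 - b₀) (min ((b₁ : ℤ) - 1) d) ∪
      Finset.Icc (max 0 ((d : ℤ) + 1 - a₀)) ((a₁ : ℤ) - 1) := by
  ext t
  rw [mem_heartLevel, Finset.mem_union, Finset.mem_Icc, Finset.mem_Icc]
  omega

/-- Where the two boxes of a region no longer interact, the lower one is flat or shrinks, and in the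
latter case it is at least as large as the upper one. -/
theorem isStripOptimal_heart {key : ℤ → ℤ} {d : ℕ} {hT q : ℤ} {T' : Finset ℤ}
    (hab : b₁ ≤ a₀) (hs : b₀ + b₁ ≤ a₀ + a₁) (hd : a₁ + b₀ ≤ d + 1)
    (hgT : HasGain key (Finset.Icc ((d : ℤ) + 1 - b₀) q) T' 0 hT)
    (hq : q = min ((b₁ : ℤ) - 1) d)
    (hT' : T' = Finset.Icc ((d : ℤ) + 1 + 1 - b₀) (min ((b₁ : ℤ) - 1) (d + 1)))
    (hhT : hT = -1 ∨ d + 1 < b₁ ∧ hT = 0)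
    (hmono : StrictMonoOn key (Set.Icc 0 ((a₁ : ℤ) - 1)))
    (hkey : ∀ s t : ℤ, a₁ ≤ t → t < b₁ → s < a₁ → key s < key t) :
    IsStripOptimal key (heartLevel a₀ a₁ b₀ b₁ d) (heartLevel a₀ a₁ b₀ b₁ (d + 1)) := by
  subst hq hT'
  obtain ⟨hF, hgF, hF'⟩ : ∃ hF, HasGain key (Finset.Icc (max 0 ((d : ℤ) + 1 - a₀)) ((a₁ : ℤ) - 1))
      (Finset.Icc (max 0 ((d : ℤ) + 1 + 1 - a₀)) ((a₁ : ℤ) - 1)) 0 hF ∧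
      (hF = 0 ∨ hF = -1 ∧ a₀ ≤ d + 1) := by
    rcases lt_or_ge (d + 1) a₀ with hd' | hd'
    · rw [show max 0 ((d : ℤ) + 1 - a₀) = 0 by omega,
        show max 0 ((d : ℤ) + 1 + 1 - a₀) = 0 by omega]
      exact ⟨0, hasGain_flat hmono, Or.inl rfl⟩
    · rw [show max 0 ((d : ℤ) + 1 - a₀) = d + 1 - a₀ by omega,
        show max 0 ((d : ℤ) + 1 + 1 - a₀) = d + 1 - a₀ + 1 by omega]
      exact ⟨-1, hasGain_shrink_of_mono (hmono.mono (Set.Icc_subset_Icc_left (by omega))),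
        Or.inr ⟨rfl, hd'⟩⟩
  rw [heartLevel_eq_union hd, heartLevel_eq_union (by omega)]
  push_cast
  refine isStripOptimal_union hgT hgF ?_ ?_ ?_ ?_ le_rfl le_rfl ?_ (by omega) (by omega) (by omega)
    (Or.inl rfl)
  · intro t ht
    simp only [Finset.mem_Icc] at ht ⊢
    omega
  · intro t ht
    simp only [Finset.mem_Icc] at ht ⊢
    omega
  · intro t ht s hs
    rw [Finset.mem_Icc] at ht hs
    exact hkey s t (by omega) (by omega) (by omega)
  · intro t ht s hs
    rw [Finset.mem_Icc] at ht hs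
    exact hkey s t (by omega) (by omega) (by omega)
  -- If the lower interval shrinks, the degree is past both `a₀` and `b₁`, and the inequality `b₀ +
  -- b₁ ≤ a₀ + a₁` says that the upper one is no larger.
  · rw [Int.card_Icc, Int.card_Icc]
    omega

/-- Levels are single intervals up to the degree where the boxes separate; afterwards the box `b`
comes first. If it is already shrinking at that point, larger exponents of the second variable first
is the right order. Otherwise its part of the level first shifts upward, which requires starting
from its lower end, and the bitonic key switching at `a₁` serves all phases. -/
theorem IsRegion.isMacaulayPoset_of_heart (h : IsRegion r (heartRegion a₀ a₁ b₀ b₁) u v)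
    (h0 : b₀ < a₀) (h1 : a₁ < b₁) (hb : 1 ≤ b₀) (hab : b₁ ≤ a₀) (hs : b₀ + b₁ ≤ a₀ + a₁) :
    IsMacaulayPoset P := by
  have hfin := h.finite
  have hid : ∀ s : Set ℤ, StrictMonoOn id s := fun s => strictMonoOn_id
  have hV : ∀ e : ℕ, e + 1 ≤ a₁ + b₀ → heartLevel a₀ a₁ b₀ b₁ e =
      Finset.Icc (max 0 ((e : ℤ) + 1 - a₀)) (min ((b₁ : ℤ) - 1) e) := by
    intro e he
    ext t
    rw [mem_heartLevel, Finset.mem_Icc]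
    omega
  rcases lt_or_ge b₁ (b₀ + a₁) with hcase | hcase
  · refine h.isMacaulayPoset_of_key (key := id) (fun z w hzw => by simpa using hzw)
      (fun d t => mem_heartLevel_iff_exists) fun d => ?_
    rcases lt_or_ge (d + 1) (a₁ + b₀) with hd | hd
    · rw [hV d (by omega), hV (d + 1) (by omega)]
      push_cast
      rcases lt_or_ge (d + 1) b₁ with hd1 | hd1
      · rw [show max 0 ((d : ℤ) + 1 - a₀) = 0 by omega,
          show max 0 ((d : ℤ) + 1 + 1 - a₀) = 0 by omega,
          show min ((b₁ : ℤ) - 1) d = d by omega, show min ((b₁ : ℤ) - 1) (d + 1) = d + 1 by omega]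
        exact (hasGain_grow (by omega) (hid _)).isStripOptimal (by omega) (by omega) (by omega)
      rw [show min ((b₁ : ℤ) - 1) d = b₁ - 1 by omega,
        show min ((b₁ : ℤ) - 1) (d + 1) = b₁ - 1 by omega]
      rcases lt_or_ge (d + 1) a₀ with hd2 | hd2
      · rw [show max 0 ((d : ℤ) + 1 - a₀) = 0 by omega,
          show max 0 ((d : ℤ) + 1 + 1 - a₀) = 0 by omega]
        exact (hasGain_flat (hid _)).isStripOptimal (by omega) (by omega) (by omega)
      · rw [show max 0 ((d : ℤ) + 1 - a₀) = d + 1 - a₀ by omega,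
          show max 0 ((d : ℤ) + 1 + 1 - a₀) = d + 1 - a₀ + 1 by omega]
        exact (hasGain_shrink_of_mono (hid _)).isStripOptimal (by omega) (by omega) (by omega)
    · have hg := hasGain_shrink_of_mono (p := (d : ℤ) + 1 - b₀) (q := (b₁ : ℤ) - 1) (hid _)
      exact isStripOptimal_heart hab hs hd hg (by omega) (by congr 1 <;> omega) (Or.inl rfl)
        (hid _) fun s t h1 h2 h3 => h3.trans_le h1
  · have hkey : ∀ s t : ℤ, a₁ ≤ t → t < b₁ → s < a₁ →
        bitonicKey a₁ (a₁ + b₁) s < bitonicKey a₁ (a₁ + b₁) t := by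
      intro s t h1 h2 h3
      unfold bitonicKey
      split_ifs <;> omega
    refine h.isMacaulayPoset_of_key (key := bitonicKey a₁ (a₁ + b₁)) (fun z w hzw => ?_)
      (fun d t => mem_heartLevel_iff_exists) fun d => ?_
    · have hz : v z < b₁ := by
        have := h.mem z
        unfold heartRegion at this
        omega
      have hw : v w < b₁ := by
        have := h.mem w
        unfold heartRegion at this
        omega
      unfold bitonicKey at hzw
      split_ifs at hzw <;> omega
    rcases lt_or_ge (d + 1) (a₁ + b₀) with hd | hd
    · rw [hV d (by omega), hV (d + 1) (by omega)]
      push_cast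
      rw [show max 0 ((d : ℤ) + 1 - a₀) = 0 by omega, show max 0 ((d : ℤ) + 1 + 1 - a₀) = 0 by omega,
        show min ((b₁ : ℤ) - 1) d = d by omega, show min ((b₁ : ℤ) - 1) (d + 1) = d + 1 by omega]
      exact (hasGain_bitonic (by omega) (by omega) (by omega)).isStripOptimal (by omega) (by omega)
        (by omega)
    have hmono := strictMonoOn_bitonicKey (k := a₁) (N := a₁ + b₁) (p := 0) (q := (a₁ : ℤ) - 1)
      (by omega)
    rcases lt_or_ge (d + 1) b₁ with hd1 | hd1
    · have hg := hasGain_shift (p := (d : ℤ) + 1 - b₀) (q := d) (by omega)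
        (strictAntiOn_bitonicKey (k := a₁) (N := a₁ + b₁) (by omega))
      exact isStripOptimal_heart hab hs hd hg (by omega) (by congr 1 <;> omega)
        (Or.inr ⟨hd1, rfl⟩) hmono hkey
    · have hg := hasGain_shrink_of_anti (p := (d : ℤ) + 1 - b₀) (q := (b₁ : ℤ) - 1)
        (strictAntiOn_bitonicKey (k := a₁) (N := a₁ + b₁) (by omega))
      exact isStripOptimal_heart hab hs hd hg (by omega) (by congr 1 <;> omega) (Or.inl rfl)
        hmono hkey

theorem IsRegion.level_nonempty (h : IsRegion r (heartRegion a₀ a₁ b₀ b₁) u v) (ha₀ : 1 ≤ a₀)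
    (ha₁ : 1 ≤ a₁) {d : ℕ} (hd : d + 2 ≤ a₀ + a₁) : (level r d).Nonempty := by
  obtain ⟨z, h1, h2⟩ := h.surj (min d (a₀ - 1)) (d - min d (a₀ - 1)) (by
    unfold heartRegion
    omega)
  refine ⟨z, ?_⟩
  change r z = d
  rw [h.rank_eq]
  omega

/-- In a Macaulay order, the first element of each level lies below the maximum of the box of
smaller rank. -/
theorem IsRegion.first_le (h : IsRegion r (heartRegion a₀ a₁ b₀ b₁) u v) (ha₁ : 1 ≤ a₁)
    (h0 : b₀ < a₀) (h1 : a₁ < b₁) (hs : a₀ + a₁ < b₀ + b₁) {seg : ℕ → ℕ → Set P}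
    (hseg : IsSegFamily r seg) (k : ℕ) {d : ℕ} (hd : d + k + 2 = a₀ + a₁) {z : P}
    (hz : z ∈ seg d 1) : u z < a₀ ∧ v z < a₁ := by
  have hfin := h.finite
  have hone : ∀ {e : ℕ}, e + 2 ≤ a₀ + a₁ → ∃ y, seg e 1 = {y} := fun he =>
    Set.ncard_eq_one.1 (hseg.ncard_seg_one (h.level_nonempty (by omega) ha₁ he))
  have hrank : ∀ {e : ℕ} {y : P}, y ∈ seg e 1 → u y + v y = e := fun hy => by
    rw [← h.rank_eq]
    exact hseg.subset _ _ hy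
  have hup : ∀ y i j, heartRegion a₀ a₁ b₀ b₁ i j → (i = u y + 1 ∧ j = v y ∨ i = u y ∧ j = v y + 1) →
      ∃ w, y ⋖ w := by
    intro y i j hR hij
    obtain ⟨w, rfl, rfl⟩ := h.surj i j hR
    exact ⟨w, (h.cov y w).2 hij⟩
  induction k generalizing d z with
  -- The corner of the box `a` has empty shadow, so by minimality the first element of its level is
  -- maximal in the region. The other corner has larger rank, which leaves this one.
  | zero =>
    obtain ⟨c, hc0, hc1⟩ := h.surj (a₀ - 1) (a₁ - 1) (by unfold heartRegion; omega)
    have hcl : ({c} : Set P) ⊆ level r d := by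
      rintro _ rfl
      change r _ = d
      rw [h.rank_eq]
      omega
    have hcs : upperShadow ({c} : Set P) = ∅ := by
      rw [Set.eq_empty_iff_forall_notMem]
      rintro w ⟨_, rfl, hw⟩
      have := (h.cov _ w).1 hw
      have hR := h.mem w
      unfold heartRegion at hR
      omega
    have hsh := (hseg.shadow d _ hcl).1
    rw [hcs, Set.ncard_empty, Set.ncard_singleton, Nat.le_zero, Set.ncard_eq_zero] at hsh
    have hmax : ∀ w, ¬ z ⋖ w := fun w hw => by
      have : w ∈ upperShadow (seg d 1) := ⟨z, hz, hw⟩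
      rw [hsh] at this
      exact this
    have hzr := hrank hz
    have hzR := h.mem z
    have e1 : ¬ heartRegion a₀ a₁ b₀ b₁ (u z + 1) (v z) := fun hR => by
      obtain ⟨w, hw⟩ := hup z _ _ hR (Or.inl ⟨rfl, rfl⟩)
      exact hmax w hw
    have e2 : ¬ heartRegion a₀ a₁ b₀ b₁ (u z) (v z + 1) := fun hR => by
      obtain ⟨w, hw⟩ := hup z _ _ hR (Or.inr ⟨rfl, rfl⟩)
      exact hmax w hw
    unfold heartRegion at hzR e1 e2
    omega
  | succ k ih =>
    have hzr := hrank hz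
    have hzR := h.mem z
    -- The rank is below that of both corners, so `z` is not maximal; the first element of the next
    -- level then covers `z`.
    obtain ⟨y, hy⟩ : ∃ y, z ⋖ y := by
      by_contra hcon
      have e1 : ¬ heartRegion a₀ a₁ b₀ b₁ (u z + 1) (v z) := fun hR =>
        hcon (hup z _ _ hR (Or.inl ⟨rfl, rfl⟩))
      have e2 : ¬ heartRegion a₀ a₁ b₀ b₁ (u z) (v z + 1) := fun hR =>
        hcon (hup z _ _ hR (Or.inr ⟨rfl, rfl⟩))
      unfold heartRegion at hzR e1 e2
      omega
    obtain ⟨z', hz'⟩ := hone (e := d) (by omega)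
    have hzz' : z = z' := by rwa [hz'] at hz
    subst hzz'
    obtain ⟨w, hw⟩ := hone (e := d + 1) (by omega)
    have hws : w ∈ seg (d + 1) 1 := by rw [hw]; rfl
    have hsub := hseg.subset_upperShadow (d := d) (q := 1) (k := 1)
      (by rw [hz', Set.ncard_singleton]) ((Set.ncard_pos).2 ⟨y, z, hz, hy⟩)
    obtain ⟨x, hx, hxw⟩ := hsub hws
    have hxz : x = z := by rwa [hz'] at hx
    subst hxz
    have := ih (d := d + 1) (by omega) hws
    have := (h.cov _ _).1 hxw
    omega

/-- The corner of smaller rank forces the order to begin inside the box `a` on every level up to it.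
At level `b₁ - 1`, where the part of the box `b` outside `a` loses an element and that of `a` stays
flat because `b₁ < a₀`, beginning with `b` would be strictly better. -/
theorem IsRegion.not_isMacaulayPoset (h : IsRegion r (heartRegion a₀ a₁ b₀ b₁) u v) (ha₁ : 1 ≤ a₁)
    (hb₀ : 1 ≤ b₀) (h0 : b₀ < a₀) (h1 : a₁ < b₁) (hlt : b₁ < a₀) (hs : a₀ + a₁ < b₀ + b₁) :
    ¬ IsMacaulayPoset P := by
  intro hM
  have hfin := h.finite
  obtain ⟨seg, hseg⟩ := hM.exists_isSegFamily h.rank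
  obtain ⟨d, rfl⟩ : ∃ d, b₁ = d + 1 := ⟨b₁ - 1, by omega⟩
  obtain ⟨z, hz⟩ := Set.ncard_eq_one.1 (hseg.ncard_seg_one
    (h.level_nonempty (d := d) (by omega) ha₁ (by omega)))
  have hz1 : z ∈ seg d 1 := by rw [hz]; rfl
  have hzle := h.first_le ha₁ h0 h1 hs hseg (a₀ + a₁ - d - 2) (by omega) hz1
  have hzl : r z = d := hseg.subset _ _ hz1
  have hzr := hzl
  rw [h.rank_eq] at hzr
  -- the power of the second variable in this level has a small shadow
  obtain ⟨y, hy0, hy1⟩ := h.surj 0 d (by unfold heartRegion; omega)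
  have hyl : ({y} : Set P) ⊆ level r d := by
    rintro _ rfl
    change r _ = d
    rw [h.rank_eq]
    omega
  have hys : (upperShadow ({y} : Set P)).ncard ≤ 1 := by
    rw [Set.ncard_le_one]
    rintro w ⟨_, rfl, hw⟩ w' ⟨_, rfl, hw'⟩
    have hw := (h.cov _ _).1 hw
    have hw' := (h.cov _ _).1 hw'
    have hR := h.mem w
    have hR' := h.mem w'
    unfold heartRegion at hR hR'
    exact h.inj w w' (by omega) (by omega)
  have hsh := ((hseg.shadow d _ hyl).1).trans hys
  rw [Set.ncard_singleton, hz, Set.ncard_le_one] at hsh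
  -- The first element has at most one successor. If the level were still connected, both successors
  -- of `z` would lie in the region.
  have hwide : a₁ + b₀ ≤ d + 1 := by
    by_contra hcon
    obtain ⟨w, hw0, hw1⟩ := h.surj (u z + 1) (v z) (by unfold heartRegion; omega)
    obtain ⟨w', hw0', hw1'⟩ := h.surj (u z) (v z + 1) (by
      unfold heartRegion
      have := h.mem z
      unfold heartRegion at this
      omega)
    have := hsh w ⟨z, rfl, (h.cov z w).2 (by omega)⟩ w' ⟨z, rfl, (h.cov z w').2 (by omega)⟩
    rw [← this] at hw1'
    omega
  have hvz : v z = a₁ - 1 := by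
    by_contra hcon
    obtain ⟨w, hw0, hw1⟩ := h.surj (u z + 1) (v z) (by unfold heartRegion; omega)
    obtain ⟨w', hw0', hw1'⟩ := h.surj (u z) (v z + 1) (by unfold heartRegion; omega)
    have := hsh w ⟨z, rfl, (h.cov z w).2 (by omega)⟩ w' ⟨z, rfl, (h.cov z w').2 (by omega)⟩
    rw [← this] at hw1'
    omega
  -- compare the part of the level outside the first box with the initial segment of this size
  have hst := h.isStripLevel (d := d) (fun t => mem_heartLevel_iff_exists)
    (fun t => mem_heartLevel_iff_exists)
  have hV := heartLevel_eq_union (a₀ := a₀) (b₁ := d + 1) hwide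
  have hV' := heartLevel_eq_union (a₀ := a₀) (b₁ := d + 1) (d := d + 1) hwide.step
  push_cast at hV hV'
  rw [show min ((d : ℤ) + 1 - 1) d = d by omega, show max 0 ((d : ℤ) + 1 - a₀) = 0 by omega] at hV
  rw [show min ((d : ℤ) + 1 - 1) (d + 1) = d by omega,
    show max 0 ((d : ℤ) + 1 + 1 - a₀) = 0 by omega,
    show (d : ℤ) + 1 + 1 - b₀ = d + 1 - b₀ + 1 by omega] at hV'
  rw [hV, hV'] at hst
  have hgT := hasGain_shrink_of_mono (p := (d : ℤ) + 1 - b₀) (q := d) (strictMonoOn_id (s := Set.Icc _ _))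
  have hgF := hasGain_flat (p := 0) (q := (a₁ : ℤ) - 1) (strictMonoOn_id (s := Set.Icc _ _))
  have hTF : ∀ t ∈ Finset.Icc ((d : ℤ) + 1 - b₀) d, t ∉ Finset.Icc 0 ((a₁ : ℤ) - 1) := by
    intro t
    simp only [Finset.mem_Icc]
    omega
  set T := Finset.Icc ((d : ℤ) + 1 - b₀) d with hT
  set T' := Finset.Icc ((d : ℤ) + 1 - b₀ + 1) d with hT'
  set F := Finset.Icc 0 ((a₁ : ℤ) - 1) with hF
  have hTne : T.Nonempty := Finset.nonempty_Icc.2 (by omega)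
  have hTc := hgT.card_full hTne
  have hsT : ∀ t ∈ T', t ∉ F ∧ t - 1 ∉ F := by
    intro t
    simp only [hT', hF, Finset.mem_Icc]
    omega
  have hsF : ∀ t ∈ F, t ∉ T ∧ t - 1 ∉ T := by
    intro t
    simp only [hT, hF, Finset.mem_Icc]
    omega
  have hd' : Disjoint T' F := Finset.disjoint_left.2 fun t ht => (hsT t ht).1
  have hA : {x | r x = d ∧ (v x : ℤ) ∈ T} ⊆ level r d := fun x hx => hx.1
  obtain ⟨X, hXV, hX1, hX2, hX3, -⟩ := hst.exists_code hA
  have hXT : X = T := by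
    ext t
    constructor
    · intro ht
      obtain ⟨x, hx, rfl⟩ := (hst.mem t).1 (hXV ht)
      exact ((hX2 x hx).1 ht).2
    · intro ht
      obtain ⟨x, hx, rfl⟩ := (hst.mem t).1 (Finset.mem_union_left _ ht)
      exact (hX2 x hx).2 ⟨hx, ht⟩
  subst hXT
  rw [card_stripShadow_union hXV hsT hsF hd', Finset.inter_self, hgT.full,
    Finset.disjoint_iff_inter_eq_empty.1 (Finset.disjoint_left.2 hTF), stripShadow_empty,
    Finset.card_empty, add_zero] at hX3
  set A := {x | r x = d ∧ (v x : ℤ) ∈ T}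
  have hsegA := (hseg.shadow d A hA).1
  have hSc := hseg.ncard_seg hA
  have hSl : seg d A.ncard ⊆ level r d := hseg.subset _ _
  have hpos := Finset.card_pos.2 hTne
  have hzS : z ∈ seg d A.ncard := hseg.mono d (by omega) hz1
  obtain ⟨Y, hYV, hY1, hY2, hY3, -⟩ := hst.exists_code hSl
  have hzY : (v z : ℤ) ∈ Y ∩ F := by
    refine Finset.mem_inter.2 ⟨(hY2 z hzl).2 hzS, ?_⟩
    rw [hF, Finset.mem_Icc]
    omega
  rw [card_stripShadow_union hYV hsT hsF hd'] at hY3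
  have e3 := card_inter_add_card_inter (Finset.disjoint_left.2 hTF) hYV
  have e4 := Finset.card_pos.2 ⟨_, hzY⟩
  -- The segment has the size of `T` but contains `z` in `F`; so it meets `T` in a proper subset,
  -- and proper subsets do not shrink.
  have e1 := hgT.card_le (X := Y ∩ T) Finset.inter_subset_right le_rfl (Or.inl fun he => by
    rw [he] at e3
    omega)
  have e2 := hgF.card_le (X := Y ∩ F) Finset.inter_subset_right le_rfl (Or.inr le_rfl)
  omega

theorem IsRegion.isMacaulayPoset_iff_of_lt (h : IsRegion r (heartRegion a₀ a₁ b₀ b₁) u v)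
    (ha₁ : 1 ≤ a₁) (hb₀ : 1 ≤ b₀) (h0 : b₀ < a₀) (h1 : a₁ < b₁) :
    IsMacaulayPoset P ↔ HeartCondition a₀ a₁ b₀ b₁ := by
  have hsw : IsRegion r (heartRegion b₁ b₀ a₁ a₀) v u := h.swap.congr fun i j => by
    unfold heartRegion
    tauto
  unfold HeartCondition
  constructor
  · intro hM
    by_contra hcon
    rcases lt_trichotomy b₁ a₀ with h2 | h2 | h2
    · exact h.not_isMacaulayPoset ha₁ hb₀ h0 h1 h2 (by omega) hM
    · omega
    · exact hsw.not_isMacaulayPoset hb₀ ha₁ h1 h0 h2 (by omega) hM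
  · intro hC
    -- Exchanging the two variables turns the remaining possibilities into this one; for `a₀ = b₁`
    -- the comparison of sums decides which version applies.
    by_cases h2 : b₁ ≤ a₀ ∧ b₀ + b₁ ≤ a₀ + a₁
    · exact h.isMacaulayPoset_of_heart h0 h1 hb₀ h2.1 h2.2
    · exact hsw.isMacaulayPoset_of_heart h1 h0 ha₁ (by omega) (by omega)

/-- The classification of the Macaulay posets among the unions of two boxes in two variables. -/
theorem IsRegion.isMacaulayPoset_iff (h : IsRegion r (heartRegion a₀ a₁ b₀ b₁) u v) (ha₀ : 1 ≤ a₀)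
    (ha₁ : 1 ≤ a₁) (hb₀ : 1 ≤ b₀) (hb₁ : 1 ≤ b₁) :
    IsMacaulayPoset P ↔ (a₀ ≤ b₀ ∧ a₁ ≤ b₁) ∨ (b₀ ≤ a₀ ∧ b₁ ≤ a₁) ∨
      HeartCondition a₀ a₁ b₀ b₁ ∨ HeartCondition b₀ b₁ a₀ a₁ := by
  have hab : IsRegion r (heartRegion b₀ b₁ a₀ a₁) u v := h.congr fun i j => or_comm
  have hbox : ∀ {a₀ a₁ b₀ b₁ : ℕ}, IsRegion r (heartRegion a₀ a₁ b₀ b₁) u v → a₀ ≤ b₀ → a₁ ≤ b₁ →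
      IsMacaulayPoset P := by
    intro a₀ a₁ b₀ b₁ h h0 h1
    have hsw : IsRegion r (heartRegion a₁ a₀ b₁ b₀) v u := h.swap.congr fun i j => by
      unfold heartRegion
      tauto
    rcases le_total b₁ b₀ with h2 | h2
    · exact h.isMacaulayPoset_of_box h0 h1 h2
    · exact hsw.isMacaulayPoset_of_box h1 h0 h2
  by_cases h1 : a₀ ≤ b₀ ∧ a₁ ≤ b₁
  · exact ⟨fun _ => Or.inl h1, fun _ => hbox h h1.1 h1.2⟩
  by_cases h2 : b₀ ≤ a₀ ∧ b₁ ≤ a₁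
  · exact ⟨fun _ => Or.inr (Or.inl h2), fun _ => hbox hab h2.1 h2.2⟩
  rcases lt_or_ge b₀ a₀ with h3 | h3
  · rw [h.isMacaulayPoset_iff_of_lt ha₁ hb₀ h3 (by omega)]
    have : ¬ HeartCondition b₀ b₁ a₀ a₁ := fun hC => by
      have := hC.1
      omega
    tauto
  · rw [hab.isMacaulayPoset_iff_of_lt hb₁ ha₀ (by omega) (by omega)]
    have : ¬ HeartCondition a₀ a₁ b₀ b₁ := fun hC => by
      have := hC.1
      omega
    tauto

end Regions


/-! ### The heart ideal and the three classifications. -/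

section HeartIdeal

attribute [local instance] MvPolynomial.gradedAlgebra

variable {K : Type*} [Field K]

theorem mem_span_X_pow_pair {a₀ a₁ : ℕ} {p : MvPolynomial (Fin 2) K} :
    p ∈ Ideal.span {X 0 ^ a₀, (X 1 ^ a₁ : MvPolynomial (Fin 2) K)} ↔
      ∀ w ∈ p.support, a₀ ≤ w 0 ∨ a₁ ≤ w 1 := by
  have h : ({X 0 ^ a₀, X 1 ^ a₁} : Set (MvPolynomial (Fin 2) K)) =
      (fun s => monomial s (1 : K)) '' {Finsupp.single 0 a₀, Finsupp.single 1 a₁} := by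
    rw [Set.image_pair, X_pow_eq_monomial, X_pow_eq_monomial]
  rw [h, mem_ideal_span_monomial_image]
  refine forall₂_congr fun w _ => ?_
  simp [Finsupp.single_le_iff]

theorem mem_heartIdeal {a₀ a₁ b₀ b₁ : ℕ} {p : MvPolynomial (Fin 2) K} :
    p ∈ heartIdeal K a₀ a₁ b₀ b₁ ↔
      ∀ w ∈ p.support, ¬ heartRegion a₀ a₁ b₀ b₁ (w 0) (w 1) := by
  rw [heartIdeal, Submodule.mem_inf, mem_span_X_pow_pair, mem_span_X_pow_pair, ← forall₂_and]
  refine forall₂_congr fun w _ => ?_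
  unfold heartRegion
  omega

theorem isHomogeneous_heartIdeal (a₀ a₁ b₀ b₁ : ℕ) :
    (heartIdeal K a₀ a₁ b₀ b₁).IsHomogeneous (homogeneousSubmodule (Fin 2) K) := by
  have h : ∀ a₀ a₁ : ℕ, (Ideal.span {X 0 ^ a₀, (X 1 ^ a₁ : MvPolynomial (Fin 2) K)}).IsHomogeneous
      (homogeneousSubmodule (Fin 2) K) := by
    intro a₀ a₁
    refine isHomogeneous_span_of_forall ?_
    rintro _ (rfl | rfl)
    · exact ⟨_, isHomogeneous_X_pow _ _⟩
    · exact ⟨_, isHomogeneous_X_pow _ _⟩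
  exact (h a₀ a₁).inf (h b₀ b₁)

theorem exists_isRegion_heartIdeal {a₀ a₁ b₀ b₁ : ℕ} (ha₀ : 1 ≤ a₀) (ha₁ : 1 ≤ a₁) :
    ∃ r u v, @IsRegion (MonomialPoset (heartIdeal K a₀ a₁ b₀ b₁))
      (monomialPartialOrder _ (isHomogeneous_heartIdeal a₀ a₁ b₀ b₁)) r
      (heartRegion a₀ a₁ b₀ b₁) u v := by
  classical
  have hI := isHomogeneous_heartIdeal (K := K) a₀ a₁ b₀ b₁
  let _ := monomialPartialOrder _ hI
  have hmem : ∀ w : Fin 2 →₀ ℕ, monomial w (1 : K) ∉ heartIdeal K a₀ a₁ b₀ b₁ ↔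
      heartRegion a₀ a₁ b₀ b₁ (w 0) (w 1) := by
    intro w
    rw [mem_heartIdeal, support_monomial, if_neg one_ne_zero]
    simp
  have h0 : monomial 0 (1 : K) ∉ heartIdeal K a₀ a₁ b₀ b₁ := by
    rw [hmem]
    exact Or.inl ⟨ha₀, ha₁⟩
  choose e he hez using fun z => exists_monomialCoset_eq h0 z
  have hinj : ∀ w w' : Fin 2 →₀ ℕ, monomial w (1 : K) ∉ heartIdeal K a₀ a₁ b₀ b₁ →
      monomial w' (1 : K) ∉ heartIdeal K a₀ a₁ b₀ b₁ →
      monomialCoset h0 w = monomialCoset h0 w' → w = w' := by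
    intro w w' hw hw' h
    rw [monomialCoset_eq_iff h0 hw hw', mem_heartIdeal] at h
    by_contra hne
    refine h w ?_ ((hmem w).1 hw)
    simp [coeff_monomial, Ne.symm hne]
  have hecoset : ∀ w, monomial w (1 : K) ∉ heartIdeal K a₀ a₁ b₀ b₁ →
      e (monomialCoset h0 w) = w := fun w hw => hinj _ _ (he _) hw (hez _)
  have hext : ∀ w w' : Fin 2 →₀ ℕ, w 0 = w' 0 → w 1 = w' 1 → w = w' := by
    intro w w' h1 h2
    ext i
    revert i
    rw [Fin.forall_fin_two]
    exact ⟨h1, h2⟩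
  refine ⟨cosetDegree, fun z => e z 0, fun z => e z 1, isRankFunction_cosetDegree hI h0,
    fun z => (hmem _).1 (he z), fun i j hR => ?_, fun z w h1 h2 => ?_, fun z => ?_, fun z w => ?_⟩
  · set s : Fin 2 →₀ ℕ := Finsupp.single 0 i + Finsupp.single 1 j with hs
    have hs0 : s 0 = i := by simp [hs]
    have hs1 : s 1 = j := by simp [hs]
    have hsI := (hmem s).2 (by rwa [hs0, hs1])
    exact ⟨monomialCoset h0 s, by rw [hecoset s hsI, hs0], by rw [hecoset s hsI, hs1]⟩
  · rw [← hez z, ← hez w, hext _ _ h1 h2]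
  · nth_rw 1 [← hez z]
    rw [cosetDegree_monomialCoset hI h0 (he z), Finsupp.degree_eq_sum, Fin.sum_univ_two]
  · have hcov := monomialCoset_covBy_iff hI h0 (he z) w
    rw [hez z] at hcov
    refine hcov.trans ?_
    constructor
    · rintro ⟨i, hi, rfl⟩
      rw [hecoset _ hi]
      revert i
      rw [Fin.forall_fin_two]
      simp
    · rintro (h | h)
      · have : e w = e z + Finsupp.single 0 1 := hext _ _ (by simp [h.1]) (by simp [h.2])
        exact ⟨0, this ▸ he w, by rw [← this, hez]⟩
      · have : e w = e z + Finsupp.single 1 1 := hext _ _ (by simp [h.1]) (by simp [h.2])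
        exact ⟨1, this ▸ he w, by rw [← this, hez]⟩

theorem isMacaulayQuotient_heartIdeal_iff {a₀ a₁ b₀ b₁ : ℕ} (ha₀ : 1 ≤ a₀) (ha₁ : 1 ≤ a₁)
    (hb₀ : 1 ≤ b₀) (hb₁ : 1 ≤ b₁) : IsMacaulayQuotient (heartIdeal K a₀ a₁ b₀ b₁) ↔
      (a₀ ≤ b₀ ∧ a₁ ≤ b₁) ∨ (b₀ ≤ a₀ ∧ b₁ ≤ a₁) ∨
        HeartCondition a₀ a₁ b₀ b₁ ∨ HeartCondition b₀ b₁ a₀ a₁ := by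
  obtain ⟨r, u, v, h⟩ := exists_isRegion_heartIdeal (K := K) (b₀ := b₀) (b₁ := b₁) ha₀ ha₁
  let _ := monomialPartialOrder _ (isHomogeneous_heartIdeal (K := K) a₀ a₁ b₀ b₁)
  rw [isMacaulayQuotient_iff (isHomogeneous_heartIdeal a₀ a₁ b₀ b₁)]
  exact h.isMacaulayPoset_iff ha₀ ha₁ hb₀ hb₁

theorem isMacaulayQuotient_wedgeIdeal_iff {a b : Fin 2 → ℕ} (ha : ∀ i, 2 ≤ a i) (hb : ∀ j, 2 ≤ b j)
    (ha' : a 0 ≤ a 1) (hb' : b 0 ≤ b 1) : IsMacaulayQuotient (wedgeIdeal K a b) ↔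
      (a 0 ≤ b 0 ∧ a 1 ≤ b 1) ∨ (b 0 ≤ a 0 ∧ b 1 ≤ a 1) := by
  obtain ⟨r, f, g, h⟩ := exists_isGluing_wedgeIdeal (K := K) ha hb
    -- Nothing is glued at the top, so `D` is taken beyond all ranks, with room for a further level.
    (D := ∑ i, (a i - 1) + ∑ j, (b j - 1) + 2) (by omega) (by omega)
  let _ := monomialPartialOrder _ (isHomogeneous_wedgeIdeal (K := K) a b)
  have h0 := ha 0
  have h1 := ha 1
  have h2 := hb 0
  have h3 := hb 1
  rw [isMacaulayQuotient_iff (isHomogeneous_wedgeIdeal a b)]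
  refine (h.isMacaulayPoset_iff_le (by omega) (by omega) (by omega) (by omega) (by omega)
    (by omega)).trans ?_
  omega

theorem isLeast_range_two_iff {n : ℕ} {b : Fin n → ℕ} (hb : ∀ j, 2 ≤ b j) :
    IsLeast (Set.range b) 2 ↔ ∃ j, b j - 1 = 1 := by
  constructor
  · rintro ⟨⟨j, hj⟩, -⟩
    exact ⟨j, by omega⟩
  · rintro ⟨j, hj⟩
    refine ⟨⟨j, by omega⟩, ?_⟩
    rintro _ ⟨i, rfl⟩
    exact hb i

theorem exists_eq_one_of_card_filter {c : Fin 2 → ℕ} (hc : ∀ i, 1 ≤ c i)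
    (h : (Finset.univ.filter fun i => 2 ≤ c i).card ≤ 1) : ∃ j, c j = 1 := by
  rw [Finset.card_filter, Fin.sum_univ_two] at h
  have := hc 0
  have := hc 1
  by_cases h0 : c 0 = 1
  · exact ⟨0, h0⟩
  · refine ⟨1, ?_⟩
    split_ifs at h <;> omega

/-- The estimates of the necessity proof need a level strictly between the atoms' bottom and the
coatoms, that is `D ≥ 3`. For smaller `D` there are at most two variables on each side and the
listed shapes exhaust all possibilities. -/
theorem classify_of_sum_le_two {n m D : ℕ} {c : Fin n → ℕ} {c' : Fin m → ℕ} (hD : ∑ i, c i = D)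
    (hD' : ∑ j, c' j = D) (hc : ∀ i, 1 ≤ c i) (hc' : ∀ j, 1 ≤ c' j) (hD2 : D ≤ 2) :
    (n = 1 ∧ m = 2 ∧ ∃ j, c' j = 1) ∨ (n = 2 ∧ m = 1 ∧ ∃ i, c i = 1) ∨
      ∃ e : Fin n ≃ Fin m, ∀ i, c' (e i) = c i := by
  have hn := add_card_filter_two_le hc
  have hm := add_card_filter_two_le hc'
  have hn' := eq_sum_of_card_filter_two hc
  have hm' := eq_sum_of_card_filter_two hc'
  rw [hD] at hn hn'
  rw [hD'] at hm hm'
  have hn2 : n ≤ 2 := by omega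
  have hm2 : m ≤ 2 := by omega
  interval_cases n <;> interval_cases m
  · exact Or.inr (Or.inr ⟨Equiv.refl _, fun i => i.elim0⟩)
  · rw [Fin.sum_univ_zero] at hD
    have := hc' 0
    rw [Fin.sum_univ_one] at hD'
    omega
  · rw [Fin.sum_univ_zero] at hD
    have := hc' 0
    rw [Fin.sum_univ_two] at hD'
    omega
  · rw [Fin.sum_univ_zero] at hD'
    have := hc 0
    rw [Fin.sum_univ_one] at hD
    omega
  · rw [Fin.sum_univ_one] at hD hD'
    refine Or.inr (Or.inr ⟨Equiv.refl _, fun i => ?_⟩)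
    rw [Subsingleton.elim i 0]
    exact hD'.trans hD.symm
  · exact Or.inl ⟨rfl, rfl, exists_eq_one_of_card_filter hc' (by omega)⟩
  · rw [Fin.sum_univ_zero] at hD'
    have := hc 0
    rw [Fin.sum_univ_two] at hD
    omega
  · exact Or.inr (Or.inl ⟨rfl, rfl, exists_eq_one_of_card_filter hc (by omega)⟩)
  · exact Or.inr (Or.inr (exists_equiv_of_two hc hc' (hD.trans hD'.symm) (by omega) (by omega)))

/-- The classification of the Macaulay posets among the gluings of two boxes at top and bottom. -/
theorem IsGluing.isMacaulayPoset_iff {P : Type*} [PartialOrder P] {n m : ℕ} {r : P → ℕ} {D : ℕ}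
    {c : Fin n → ℕ} {c' : Fin m → ℕ} {f : (Fin n → ℕ) → P} {g : (Fin m → ℕ) → P}
    (h : IsGluing r D c c' f g) (hD : ∑ i, c i = D) (hD' : ∑ j, c' j = D) (htop : f c = g c')
    (hc : ∀ i, 1 ≤ c i) (hc' : ∀ j, 1 ≤ c' j) : IsMacaulayPoset P ↔
      (n = 1 ∧ m = 2 ∧ ∃ j, c' j = 1) ∨ (n = 2 ∧ m = 1 ∧ ∃ i, c i = 1) ∨
        ∃ e : Fin n ≃ Fin m, ∀ i, c' (e i) = c i := by
  constructor
  · intro hM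
    rcases le_or_gt D 2 with hD2 | hD2
    · exact classify_of_sum_le_two hD hD' hc hc' hD2
    · rcases h.classify hM hD hD' hD2 hc hc' with ⟨rfl, rfl, h1⟩ | ⟨rfl, rfl, h1⟩ | h1
      · exact Or.inl ⟨rfl, rfl, exists_eq_one_of_card_filter hc' h1⟩
      · exact Or.inr (Or.inl ⟨rfl, rfl, exists_eq_one_of_card_filter hc h1⟩)
      · exact Or.inr (Or.inr h1)
  · rintro (⟨rfl, rfl, j, hj⟩ | ⟨rfl, rfl, j, hj⟩ | ⟨e, he⟩)
    · exact h.isMacaulayPoset_of_chain hD hD' htop hc' hj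
    · exact h.symm.isMacaulayPoset_of_chain hD' hD htop.symm hc hj
    · exact h.isMacaulayPoset_of_equiv hD htop hc e he

theorem isMacaulayQuotient_diamondIdeal_iff {n m : ℕ} {a : Fin n → ℕ} {b : Fin m → ℕ}
    (ha : ∀ i, 2 ≤ a i) (hb : ∀ j, 2 ≤ b j)
    (hab : (∑ i, (a i : ℤ)) - n = (∑ j, (b j : ℤ)) - m) :
    IsMacaulayQuotient (diamondIdeal K a b) ↔
      (n = 1 ∧ m = 2 ∧ IsLeast (Set.range b) 2) ∨ (n = 2 ∧ m = 1 ∧ IsLeast (Set.range a) 2) ∨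
        ∃ e : Fin n ≃ Fin m, ∀ i, b (e i) = a i := by
  have hcast : ∀ {k : ℕ} {d : Fin k → ℕ}, (∀ i, 2 ≤ d i) →
      ((∑ i, (d i - 1) : ℕ) : ℤ) = (∑ i, (d i : ℤ)) - k := by
    intro k d hd
    rw [Nat.cast_sum]
    have : ∀ i, ((d i - 1 : ℕ) : ℤ) = d i - 1 := fun i => by
      have := hd i
      omega
    simp [this]
  have hsum : ∑ i, (a i - 1) = ∑ j, (b j - 1) := by
    have h1 := hcast ha
    have h2 := hcast hb
    omega
  obtain ⟨r, f, g, h, htop⟩ := exists_isGluing_diamondIdeal (K := K) ha hb hsum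
  let _ := monomialPartialOrder _ (isHomogeneous_diamondIdeal (K := K) hsum)
  rw [isMacaulayQuotient_iff (isHomogeneous_diamondIdeal hsum), isLeast_range_two_iff ha,
    isLeast_range_two_iff hb]
  refine (h.isMacaulayPoset_iff rfl hsum.symm htop (fun i => ?_) fun j => ?_).trans ?_
  · have := ha i
    omega
  · have := hb j
    omega
  · refine or_congr_right (or_congr_right (exists_congr fun e => forall_congr' fun i => ?_))
    have := ha i
    have := hb (e i)
    omega

end HeartIdeal

theorem theoremD (K : Type*) [Field K] :
    -- gluing two monomial complete intersections along their socles
    (∀ (n m : ℕ) (a : Fin n → ℕ) (b : Fin m → ℕ),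
      (∀ i, 2 ≤ a i) → (∀ j, 2 ≤ b j) →
      ((∑ i, (a i : ℤ)) - n = (∑ j, (b j : ℤ)) - m) →
      (IsMacaulayQuotient (diamondIdeal K a b) ↔
        (n = 1 ∧ m = 2 ∧ IsLeast (Set.range b) 2) ∨
        (n = 2 ∧ m = 1 ∧ IsLeast (Set.range a) 2) ∨
        (∃ e : Fin n ≃ Fin m, ∀ i, b (e i) = a i))) ∧
    -- fiber products over `K` of two complete intersections in two variables
    (∀ a b : Fin 2 → ℕ,
      (∀ i, 2 ≤ a i) → (∀ j, 2 ≤ b j) → a 0 ≤ a 1 → b 0 ≤ b 1 →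
      (IsMacaulayQuotient (wedgeIdeal K a b) ↔
        (a 0 ≤ b 0 ∧ a 1 ≤ b 1) ∨ (b 0 ≤ a 0 ∧ b 1 ≤ a 1))) ∧
    -- intersections of two complete intersections in the same two variables
    (∀ a₀ a₁ b₀ b₁ : ℕ,
      1 ≤ a₀ → 1 ≤ a₁ → 1 ≤ b₀ → 1 ≤ b₁ →
      (IsMacaulayQuotient (heartIdeal K a₀ a₁ b₀ b₁) ↔
        (a₀ ≤ b₀ ∧ a₁ ≤ b₁) ∨ (b₀ ≤ a₀ ∧ b₁ ≤ a₁) ∨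
        HeartCondition a₀ a₁ b₀ b₁ ∨ HeartCondition b₀ b₁ a₀ a₁)) := by
  exact ⟨fun _ _ _ _ ha hb hab => isMacaulayQuotient_diamondIdeal_iff ha hb hab,
    fun _ _ ha hb ha' hb' => isMacaulayQuotient_wedgeIdeal_iff ha hb ha' hb',
    fun _ _ _ _ ha₀ ha₁ hb₀ hb₁ => isMacaulayQuotient_heartIdeal_iff ha₀ ha₁ hb₀ hb₁⟩
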